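/- For a partition $\pi$ of a nonnegative integer (the empty partition of $0$ included, with largest part $0$), the rank of $\pi$ is its largest part minus its number of parts. The crank of $\pi$ is its largest part if $\pi$ has no part equal to $1$; otherwise, if $\pi$ has $\omega\ge 1$ ones, it is the number of parts of $\pi$ larger than $\omega$, minus $\omega$. Let $N(m,n)$ be the number of partitions of $n$ with rank $m$. For $n\neq 1$ let $M(m,n)$ be the number of partitions of $n$ with crank $m$; for $n=1$ put $M(-1,1)=M(1,1)=1$, $M(0,1)=-1$, and $M(m,1)=0$ for all other $m$. For even $j\ge 2$ define the moments $$N_j(n)=\sum_{k\in\mathbb Z}k^jN(k,n),\qquad M_j(n)=\sum_{k\in\mathbb Z}k^jM(k,n).$$ **Theorem 6.2.** For every integer $n\ge 0$, the integer $$\begin{aligned} L(n)={}&4(n^2+n+14)(n^3+n^2+15)\,M_2(n)+(10n^4+2n^3+8n^2+21n+22)\,M_4(n)\\ &+13(n+18)(n^2+21n+13)\,M_6(n)+5n(n+6)\,M_8(n)+15(n+19)\,M_{10}(n)+M_{12}(n)\\ &+12(n+10)(n+14)(n+19)(n+20)(n+21)\,N_2(n)+N_{12}(n) \end{aligned}$$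 satisfies $$L(n)\equiv\begin{cases}(-1)^k \pmod{23}, & \text{if } n=\dfrac{23k(3k\pm1)}{2}+1 \text{ for some integer } k\ge 0 \text{ and some choice of sign},\\[4pt] 0 \pmod{23}, & \text{otherwise.}\end{cases}$$ -/

import Mathlib

namespace PartitionStat

/-- The largest part of a partition (`0` for the empty partition). -/
def largestPart {n : ℕ} (p : n.Partition) : ℕ :=
  p.parts.sup

/-- The rank of a partition: the largest part minus the number of parts. -/
def rank {n : ℕ} (p : n.Partition) : ℤ :=
  (largestPart p : ℤ) - (Multiset.card p.parts : ℤ)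

/-- The number of ones in a partition. -/
def ones {n : ℕ} (p : n.Partition) : ℕ :=
  p.parts.count 1

/-- The crank of a partition: the largest part if there are no ones, and otherwise the number of
parts larger than the number of ones, minus the number of ones. -/
def crank {n : ℕ} (p : n.Partition) : ℤ :=
  if ones p = 0 then (largestPart p : ℤ)
  else (p.parts.countP (fun a => ones p < a) : ℤ) - (ones p : ℤ)

/-- `N(m,n)`: the number of partitions of `n` with rank `m`. -/
def rankCount (m : ℤ) (n : ℕ) : ℤ :=
  ((Finset.univ.filter (fun p : n.Partition => rank p = m)).card : ℤ)

/-- `M(m,n)`: the number of partitions of `n` with crank `m`, with the usual amendment at `n = 1`,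
where `M(-1,1) = M(1,1) = 1`, `M(0,1) = -1` and `M(m,1) = 0` for all other `m`; these are the
coefficients of `q` in the product of `(1 - q^n) / ((1 - z q^n) (1 - z⁻¹ q^n))` over `n ≥ 1`. -/
def crankCount (m : ℤ) (n : ℕ) : ℤ :=
  if n = 1 then
    if m = 0 then -1 else if m = 1 ∨ m = -1 then 1 else 0
  else ((Finset.univ.filter (fun p : n.Partition => crank p = m)).card : ℤ)

/-- The rank moment `N_j(n)`, the sum of `k^j N(k,n)` over all integers `k`
(only finitely many terms are nonzero, see `finite_support_rankCount`). -/
noncomputable def rankMoment (j n : ℕ) : ℤ :=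
  ∑ᶠ k : ℤ, k ^ j * rankCount k n

/-- The crank moment `M_j(n)`, the sum of `k^j M(k,n)` over all integers `k`
(only finitely many terms are nonzero, see `finite_support_crankCount`). -/
noncomputable def crankMoment (j n : ℕ) : ℤ :=
  ∑ᶠ k : ℤ, k ^ j * crankCount k n

theorem finite_support_rankCount (n : ℕ) :
    (Function.support fun k : ℤ => rankCount k n).Finite := by
  refine (Set.finite_range (fun p : n.Partition => rank p)).subset ?_
  intro k hk
  by_contra h
  apply hk
  have h0 : Finset.univ.filter (fun p : n.Partition => rank p = k) = ∅ :=
    Finset.filter_eq_empty_iff.2 fun p _ hp => h ⟨p, hp⟩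
  simp [rankCount, h0]

theorem finite_support_crankCount (n : ℕ) :
    (Function.support fun k : ℤ => crankCount k n).Finite := by
  refine ((Set.finite_range (fun p : n.Partition => crank p)).union
    (Set.finite_Icc (-1 : ℤ) 1)).subset ?_
  intro k hk
  by_contra h
  rw [Set.mem_union, not_or] at h
  apply hk
  have h0 : Finset.univ.filter (fun p : n.Partition => crank p = k) = ∅ :=
    Finset.filter_eq_empty_iff.2 fun p _ hp => h.1 ⟨p, hp⟩
  have h2 : ¬ (-1 ≤ k ∧ k ≤ 1) := h.2
  have h3 : k ≠ 0 := by omega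
  have h4 : ¬ (k = 1 ∨ k = -1) := by omega
  simp [crankCount, h0, h3, h4]

end PartitionStat

/-! Write `P` for `partSeries`, `D = q d/dq` for `qD`, and E₂, E₄, E₆ for the Eisenstein series. The
combination of moments is arranged so that its generating series is congruent modulo 23 to 8 P (E₄³
- E₆²) (`momentCombination_eq`). Over the integers, P (E₄³ - E₆²) = 1728 q ∏ (1 - q^n)^23
(`discriminant_mul_partSeries_eq`). Since 8 · 1728 ≡ 1 and Frobenius turns the 23rd power into ∏ (1
- q^(23 n)), Euler's pentagonal number theorem gives the coefficients.

Crank moments. The crank is generated by the product `crankProd` (`coeff_crankProd`, by the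
q-binomial theorem). Its logarithmic derivative in z is a difference of two Lambert series, whose
moments are the divisor-sum series `phi k` for odd k. This gives a recursion making each even moment
`P` times a polynomial in `phi 1`, `phi 3`, .... Liouville's elementary method supplies Ramanujan's
differential equations for E₂, E₄, E₆ and writes `phi 7`, `phi 9`, `phi 11` through E₄ and E₆.

Rank moments. They are reached through the rank-crank differential equation (`rank_crank_pde`): the
moments of `crankCube`, which obey a recursion of the same kind as the crank moments, are
combinations of rank moments and their `D`-derivatives. Modulo 23 the rank moments of orders 4 to 10
can be eliminated, and exactly the given terms in N₂ and N₁₂ remain (`linear_relation`).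

The differential equation itself rests on two families indexed by m. Dyson's map gives a recursion
between `rankLe m` and `rankLe (m + 3)` (`rankLe_add`). The Laurent coefficients `cubeCoeff m` of a
cubed theta-like quotient obey a reflection law (`two_mul_cubeCoeff_add`). Together these show that
(6D + m(m+1)) `rankLe m` = 2 P `cubeCoeff (m - 1)` (`qD_rankLe`), as the difference of the two sides
satisfies a contracting recursion. The third difference in m of this identity is the differential
equation. -/

open PowerSeries

namespace RankCrank

/-! ### Adic sums and evaluation of power series. -/

section QAdic

variable {R S : Type*} [CommRing R] [CommRing S]

theorem eq_zero_of_forall_X_pow_dvd {f : S⟦X⟧} (h : ∀ K : ℕ, X ^ K ∣ f) : f = 0 := by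
  ext n
  exact PowerSeries.X_pow_dvd_iff.1 (h (n + 1)) n (Nat.lt_succ_self n)

theorem eq_of_forall_X_pow_dvd_sub {f g : S⟦X⟧} (h : ∀ K : ℕ, X ^ K ∣ f - g) : f = g :=
  sub_eq_zero.1 (eq_zero_of_forall_X_pow_dvd h)

/-- `s` is the `X`-adic sum of the family `f`, the `j`-th term being negligible modulo `X ^ j`. -/
def HasQSum (f : ℕ → S⟦X⟧) (s : S⟦X⟧) : Prop :=
  ∀ K : ℕ, X ^ K ∣ s - ∑ j ∈ Finset.range K, f j

/-- The `X`-adic sum of a family whose `j`-th term is divisible by `X ^ j`. -/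
noncomputable def qsum (f : ℕ → S⟦X⟧) : S⟦X⟧ :=
  PowerSeries.mk fun n => ∑ j ∈ Finset.range (n + 1), coeff n (f j)

theorem hasQSum_qsum {f : ℕ → S⟦X⟧} (hf : ∀ j, X ^ j ∣ f j) : HasQSum f (qsum f) := by
  intro K
  rw [PowerSeries.X_pow_dvd_iff]
  intro n hn
  rw [map_sub, qsum, coeff_mk, map_sum, sub_eq_zero]
  apply Finset.sum_subset
  · intro j; simp only [Finset.mem_range]; omega
  · intro j _ hj
    simp only [Finset.mem_range] at hj
    exact PowerSeries.X_pow_dvd_iff.1 (hf j) n (by omega)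

theorem HasQSum.unique {f : ℕ → S⟦X⟧} {s t : S⟦X⟧} (hs : HasQSum f s) (ht : HasQSum f t) :
    s = t := by
  apply eq_of_forall_X_pow_dvd_sub
  intro K
  have := dvd_sub (hs K) (ht K)
  rwa [sub_sub_sub_cancel_right] at this

theorem HasQSum.qsum_eq {f : ℕ → S⟦X⟧} {s : S⟦X⟧} (hs : HasQSum f s) (hf : ∀ j, X ^ j ∣ f j) :
    qsum f = s :=
  (hasQSum_qsum hf).unique hs

theorem HasQSum.add {f g : ℕ → S⟦X⟧} {s t : S⟦X⟧} (hs : HasQSum f s) (ht : HasQSum g t) :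
    HasQSum (fun j => f j + g j) (s + t) := by
  intro K
  rw [Finset.sum_add_distrib, add_sub_add_comm]
  exact dvd_add (hs K) (ht K)

theorem HasQSum.mul_left {f : ℕ → S⟦X⟧} {s : S⟦X⟧} (c : S⟦X⟧) (hs : HasQSum f s) :
    HasQSum (fun j => c * f j) (c * s) := by
  intro K
  rw [← Finset.mul_sum, ← mul_sub]
  exact (hs K).mul_left c

theorem HasQSum.map {f : ℕ → R⟦X⟧} {s : R⟦X⟧} (φ : R⟦X⟧ →+ S⟦X⟧)
    (hφ : ∀ (K : ℕ) (x : R⟦X⟧), X ^ K ∣ x → X ^ K ∣ φ x) (hs : HasQSum f s) :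
    HasQSum (fun j => φ (f j)) (φ s) := by
  intro K
  rw [← map_sum, ← map_sub]
  exact hφ K _ (hs K)

/-- Removing `m` vanishing initial terms. -/
theorem HasQSum.shift {f : ℕ → S⟦X⟧} {s : S⟦X⟧} (m : ℕ) (hs : HasQSum f s)
    (h0 : ∀ j < m, f j = 0) : HasQSum (fun j => f (j + m)) s := by
  intro K
  have h := (pow_dvd_pow X (Nat.le_add_left K m)).trans (hs (m + K))
  rw [Finset.sum_range_add, Finset.sum_eq_zero (fun j hj => h0 j (Finset.mem_range.1 hj)),
    zero_add] at h
  simpa only [add_comm m] using h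

section Evaluation

variable (φ : R →+* S⟦X⟧) (a : S⟦X⟧)

theorem hasQSum_eval_terms (ha : X ∣ a) (F : R⟦X⟧) (j : ℕ) :
    (X : S⟦X⟧) ^ j ∣ φ (coeff j F) * a ^ j :=
  (pow_dvd_pow_of_dvd ha j).mul_left _

theorem X_pow_dvd_eval₂ (ha : X ∣ a) (p : Polynomial R) (K : ℕ) (hp : Polynomial.X ^ K ∣ p) :
    (X : S⟦X⟧) ^ K ∣ p.eval₂ φ a := by
  obtain ⟨r, rfl⟩ := hp
  rw [Polynomial.eval₂_mul, Polynomial.eval₂_X_pow]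
  exact (pow_dvd_pow_of_dvd ha K).mul_right _

/-- Evaluation of a power series with coefficients mapped to `S⟦X⟧` at an element divisible
by `X`. -/
noncomputable def evalHom (ha : X ∣ a) : R⟦X⟧ →+* S⟦X⟧ where
  toFun F := qsum fun j => φ (coeff j F) * a ^ j
  map_one' := by
    refine HasQSum.qsum_eq (fun K => ?_) (hasQSum_eval_terms φ a ha 1)
    rcases K with _ | K
    · simp
    · rw [Finset.sum_range_succ']
      simp [PowerSeries.coeff_one]
  map_zero' := by
    refine HasQSum.qsum_eq (fun K => ?_) (hasQSum_eval_terms φ a ha 0)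
    simp
  map_add' F H := by
    refine HasQSum.qsum_eq ?_ (hasQSum_eval_terms φ a ha _)
    simp only [map_add, add_mul]
    exact (hasQSum_qsum (hasQSum_eval_terms φ a ha F)).add
      (hasQSum_qsum (hasQSum_eval_terms φ a ha H))
  map_mul' F H := by
    refine HasQSum.qsum_eq (fun K => ?_) (hasQSum_eval_terms φ a ha _)
    have h1 := hasQSum_qsum (hasQSum_eval_terms φ a ha F) K
    have h2 := hasQSum_qsum (hasQSum_eval_terms φ a ha H) K
    simp only [← eval₂_trunc_eq_sum_range] at h1 h2 ⊢
    set s := qsum fun j => φ (coeff j F) * a ^ j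
    set t := qsum fun j => φ (coeff j H) * a ^ j
    -- As polynomials, the product of the truncations and the truncation of the product agree below
    -- degree K, so after evaluation at a multiple of `X` they agree modulo `X ^ K`.
    have h3 : (X : S⟦X⟧) ^ K ∣ (trunc K F * trunc K H - trunc K (F * H)).eval₂ φ a := by
      apply X_pow_dvd_eval₂ φ a ha
      rw [Polynomial.X_pow_dvd_iff]
      intro d hd
      rw [Polynomial.coeff_sub, Polynomial.coeff_mul, coeff_trunc, if_pos hd, coeff_mul,
        sub_eq_zero]
      refine Finset.sum_congr rfl fun p hp => ?_
      have := Finset.HasAntidiagonal.mem_antidiagonal.1 hp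
      rw [coeff_trunc, coeff_trunc, if_pos (by omega), if_pos (by omega)]
    rw [Polynomial.eval₂_sub, Polynomial.eval₂_mul] at h3
    have h4 := dvd_add (dvd_add (h1.mul_right t) (h2.mul_left ((trunc K F).eval₂ φ a))) h3
    convert h4 using 1
    ring

variable {φ a}

theorem hasQSum_evalHom (ha : X ∣ a) (F : R⟦X⟧) :
    HasQSum (fun j => φ (coeff j F) * a ^ j) (evalHom φ a ha F) :=
  hasQSum_qsum (hasQSum_eval_terms φ a ha F)

@[simp] theorem evalHom_C (ha : X ∣ a) (r : R) : evalHom φ a ha (C r) = φ r := by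
  refine (hasQSum_evalHom ha _).unique fun K => ?_
  rcases K with _ | K
  · simp
  · rw [Finset.sum_range_succ']
    simp [PowerSeries.coeff_C]

@[simp] theorem evalHom_X (ha : X ∣ a) : evalHom φ a ha X = a := by
  refine (hasQSum_evalHom ha _).unique fun K => ?_
  rcases K with _ | _ | K
  · simp
  · simpa using ha
  · rw [Finset.sum_range_succ', Finset.sum_range_succ']
    simp [PowerSeries.coeff_X]

end Evaluation

end QAdic

/-! ### The operator X d/dX. -/

section QDeriv

variable {S : Type*} [CommRing S]

/-- The operator `X d/dX` on power series. -/
noncomputable def qD (S : Type*) [CommRing S] : S⟦X⟧ →+ S⟦X⟧ where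
  toFun f := X * PowerSeries.derivative S f
  map_zero' := by simp
  map_add' f g := by rw [map_add, mul_add]

@[simp] theorem coeff_qD (f : S⟦X⟧) (n : ℕ) : coeff n (qD S f) = n * coeff n f := by
  change coeff n (X * PowerSeries.derivative S f) = _
  rcases n with _ | n
  · simp
  · rw [coeff_succ_X_mul, PowerSeries.coeff_derivative]; push_cast; ring

theorem qD_mul (f g : S⟦X⟧) : qD S (f * g) = f * qD S g + g * qD S f := by
  change X * PowerSeries.derivative S (f * g)
    = f * (X * PowerSeries.derivative S g) + g * (X * PowerSeries.derivative S f)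
  rw [Derivation.leibniz, smul_eq_mul, smul_eq_mul]; ring

theorem qD_one : qD S 1 = 0 := by
  have := qD_mul (S := S) 1 1
  simpa using this

theorem qD_X_pow_mul (k : ℕ) (f : S⟦X⟧) :
    qD S (X ^ k * f) = X ^ k * (qD S f + (k : S⟦X⟧) * f) := by
  have h : qD S ((X : S⟦X⟧) ^ k) = (k : S⟦X⟧) * X ^ k := by
    ext n
    have : (k : S⟦X⟧) = C (k : S) := by simp
    rw [coeff_qD, this, coeff_C_mul, coeff_X_pow]
    split_ifs with h
    · rw [h]
    · simp
  rw [qD_mul, h]; ring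

end QDeriv

/-! ### Euler's product and the series `eulerG`. -/

section Euler

/-- The finite product `(1 - X) ⋯ (1 - X ^ n)`. -/
noncomputable def qpoch (n : ℕ) : ℤ⟦X⟧ := ∏ i ∈ Finset.range n, (1 - X ^ (i + 1))

theorem qpoch_succ (n : ℕ) : qpoch (n + 1) = qpoch n * (1 - X ^ (n + 1)) :=
  Finset.prod_range_succ _ _

theorem constantCoeff_qpoch (n : ℕ) : constantCoeff (qpoch n) = 1 := by
  simp [qpoch]

/-- The inverse of `(1 - X) ⋯ (1 - X ^ n)`. -/
noncomputable def invQpoch (n : ℕ) : ℤ⟦X⟧ := invOfUnit (qpoch n) 1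

theorem qpoch_mul_invQpoch (n : ℕ) : qpoch n * invQpoch n = 1 :=
  mul_invOfUnit _ _ (by simp [constantCoeff_qpoch])

theorem isUnit_qpoch (n : ℕ) : IsUnit (qpoch n) :=
  IsUnit.of_mul_eq_one _ (qpoch_mul_invQpoch n)

@[simp] theorem invQpoch_zero : invQpoch 0 = 1 := by
  simpa [qpoch] using qpoch_mul_invQpoch 0

theorem invQpoch_succ_mul (n : ℕ) : invQpoch (n + 1) * (1 - X ^ (n + 1)) = invQpoch n := by
  apply (isUnit_qpoch n).mul_left_cancel
  have := qpoch_mul_invQpoch (n + 1)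
  rw [qpoch_succ] at this
  rw [qpoch_mul_invQpoch]; linear_combination this

/-- The infinite product `∏ (1 - X ^ n)`, `n ≥ 1`. -/
noncomputable def euler : ℤ⟦X⟧ := pentagonalSeries ℤ

theorem X_pow_dvd_qpoch_sub (n m : ℕ) : (X : ℤ⟦X⟧) ^ (n + 1) ∣ qpoch (n + m) - qpoch n := by
  induction m with
  | zero => simp
  | succ m ih =>
    have : qpoch (n + (m + 1)) - qpoch n
        = (qpoch (n + m) - qpoch n) - X ^ (n + 1) * (X ^ m * qpoch (n + m)) := by
      rw [← add_assoc, qpoch_succ]; ring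
    rw [this]
    exact dvd_sub ih (dvd_mul_right _ _)

/-- Euler's pentagonal number theorem enters here: `euler` is defined as the pentagonal series, and
its coefficients are the eventual coefficients of the finite products. The factors beyond the n-th
do not affect degrees up to n, which makes the bound explicit. -/
theorem X_pow_dvd_euler_sub_qpoch (n : ℕ) : (X : ℤ⟦X⟧) ^ (n + 1) ∣ euler - qpoch n := by
  rw [PowerSeries.X_pow_dvd_iff]
  intro d hd
  have h := Filter.tendsto_finset_range.eventually
    (coeff_prod_one_sub_X_pow_eventually_eq ℤ d)
  obtain ⟨N, hN⟩ := Filter.eventually_atTop.1 h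
  have h1 : coeff d (qpoch (n + N)) = coeff d euler := hN (n + N) (by omega)
  have h2 := PowerSeries.X_pow_dvd_iff.1 (X_pow_dvd_qpoch_sub n N) d hd
  rw [map_sub, h1] at h2
  rw [map_sub, h2]

/-- The power series `∑ x ^ i / ((1 - q) ⋯ (1 - q ^ i))`, that is `∏ 1 / (1 - x q ^ n)` over
`n ≥ 0`. -/
noncomputable def eulerG : ℤ⟦X⟧⟦X⟧ := PowerSeries.mk invQpoch

/-- The functional equation G(xq) = (1 - x) G(x), with x the outer variable and q the inner one. On
coefficients it says q^n/(q)_n = 1/(q)_n - 1/(q)_(n-1). -/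
theorem rescale_eulerG : rescale (X : ℤ⟦X⟧) eulerG = (1 - X) * eulerG := by
  ext1 n
  rw [coeff_rescale, sub_mul, one_mul, map_sub]
  rcases n with _ | n
  · simp
  · rw [coeff_succ_X_mul, eulerG, coeff_mk, coeff_mk, ← invQpoch_succ_mul n]; ring

theorem rescale_pow_eulerG (k : ℕ) : rescale ((X : ℤ⟦X⟧) ^ k) eulerG
    = (∏ l ∈ Finset.range k, (1 - C ((X : ℤ⟦X⟧) ^ l) * X)) * eulerG := by
  induction k with
  | zero => simp
  | succ k ih =>
    have hX : rescale ((X : ℤ⟦X⟧) ^ k) (X : ℤ⟦X⟧⟦X⟧) = C ((X : ℤ⟦X⟧) ^ k) * X := rescale_X _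
    rw [pow_succ, mul_comm, ← rescale_rescale, rescale_eulerG, map_mul, ih, map_sub, map_one,
      hX, Finset.prod_range_succ]
    ring

/-- The power series `∑ x ^ k / (1 - q ^ k)` over `k ≥ 1`. -/
noncomputable def lambert : ℤ⟦X⟧⟦X⟧ :=
  PowerSeries.mk fun k => if k = 0 then 0 else invOfUnit (1 - X ^ k) 1

theorem one_sub_mul_coeff_lambert {k : ℕ} (hk : k ≠ 0) :
    (1 - X ^ k) * coeff k lambert = 1 := by
  rw [lambert, coeff_mk, if_neg hk]
  exact mul_invOfUnit _ _ (by simp [hk])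

/-- Since q^k/(1 - q^k) = 1/(1 - q^k) - 1, rescaling subtracts x/(1 - x); the factor 1 - x clears
the denominator. -/
theorem rescale_lambert : (1 - X) * rescale (X : ℤ⟦X⟧) lambert = (1 - X) * lambert - X := by
  have h : rescale (X : ℤ⟦X⟧) lambert = lambert - PowerSeries.mk fun k => if k
      = 0 then 0 else 1 := by
    ext1 k
    rw [coeff_rescale, map_sub, coeff_mk]
    split_ifs with hk
    · simp [hk]
    · rw [← one_sub_mul_coeff_lambert hk]; ring
  rw [h]
  have h2 : (1 - X) * (PowerSeries.mk fun k => if k = 0 then (0 : ℤ⟦X⟧) else 1) = X := by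
    ext1 k
    rw [sub_mul, one_mul, map_sub]
    rcases k with _ | _ | k
    · simp
    · simp [coeff_succ_X_mul]
    · simp [coeff_succ_X_mul, PowerSeries.coeff_X]
  rw [mul_sub, h2]

theorem rescale_qD (F : ℤ⟦X⟧⟦X⟧) : rescale (X : ℤ⟦X⟧) (qD _ F) = qD _ (rescale X F) := by
  ext1 n
  simp only [coeff_rescale, coeff_qD]; ring

/-- The functional equation of `eulerG` determines a solution from its constant term: the
coefficients satisfy (1 - q^(n+1)) h_(n+1) = h_n. -/
theorem eq_zero_of_rescale_eq {H : ℤ⟦X⟧⟦X⟧} (h : rescale (X : ℤ⟦X⟧) H = (1 - X) * H)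
    (h0 : coeff 0 H = 0) : H = 0 := by
  ext1 n
  induction n with
  | zero => simpa using h0
  | succ n ih =>
    have h1 := congrArg (coeff (n + 1)) h
    rw [coeff_rescale, sub_mul, one_mul, map_sub, coeff_succ_X_mul, ih, map_zero, sub_zero] at h1
    have h2 : (1 - X ^ (n + 1) : ℤ⟦X⟧) * coeff (n + 1) H = 0 := by
      rw [sub_mul, h1]; ring
    rw [map_zero]
    refine (mul_eq_zero.1 h2).resolve_left fun h3 => ?_
    have := congrArg (constantCoeff (R := ℤ)) h3
    simp at this

/-- `lambert` is the logarithmic derivative of `eulerG`. The difference of the two sides satisfies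
the functional equation of `eulerG` and has zero constant term. -/
theorem qD_eulerG : qD _ eulerG = lambert * eulerG := by
  rw [← sub_eq_zero]
  apply eq_zero_of_rescale_eq
  · rw [map_sub, rescale_qD, rescale_eulerG, map_mul (rescale _), rescale_eulerG,
      qD_mul]
    have hX : qD _ (1 - X : ℤ⟦X⟧⟦X⟧) = - X := by
      rw [map_sub, qD_one, zero_sub]
      congr 1
      have := qD_X_pow_mul 1 (1 : ℤ⟦X⟧⟦X⟧)
      simpa [qD_one] using this
    rw [hX]
    linear_combination -eulerG * rescale_lambert
  · rw [map_sub, coeff_qD, coeff_zero_eq_constantCoeff_apply (_ * _), map_mul]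
    have h : constantCoeff lambert = 0 := by
      rw [← coeff_zero_eq_constantCoeff_apply, lambert, coeff_mk, if_pos rfl]
    rw [h]; simp

/-- F(q^k a) tends to F(0) in the adic sense. With `rescale_pow_eulerG` this replaces infinite
products by finite ones plus a negligible tail. -/
theorem X_pow_dvd_evalHom_rescale {S : Type*} [CommRing S] (φ : ℤ⟦X⟧ →+* S⟦X⟧) (hφ : φ X = X)
    {a : S⟦X⟧} (ha : X ∣ a) (F : ℤ⟦X⟧⟦X⟧) (k : ℕ) :
    X ^ (k + 1) ∣ evalHom φ a ha (rescale (X ^ k) F) - φ (coeff 0 F) := by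
  have h := hasQSum_evalHom (φ := φ) ha (rescale (X ^ k) F) (k + 1)
  rw [Finset.sum_range_succ'] at h
  have h2 : (X : S⟦X⟧) ^ (k + 1) ∣
      ∑ j ∈ Finset.range k, φ (coeff (j + 1) (rescale (X ^ k) F)) * a ^ (j + 1) := by
    refine Finset.dvd_sum fun j _ => ?_
    rw [coeff_rescale, map_mul, map_pow, map_pow, hφ, pow_succ a, mul_assoc, pow_succ X]
    refine mul_dvd_mul ?_ ((ha.mul_left _).mul_left _)
    rw [pow_succ (X ^ k)]
    exact dvd_mul_left _ _
  have h3 := dvd_add h h2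
  convert h3 using 1
  rw [coeff_rescale, pow_zero, pow_zero, one_mul, mul_one]
  ring

/-- Evaluation at `x = q`. -/
noncomputable def evalX : ℤ⟦X⟧⟦X⟧ →+* ℤ⟦X⟧ := evalHom (RingHom.id _) X dvd_rfl

/-- Iterating the functional equation K times gives G(q^(K+1)) = (1 - q) ⋯ (1 - q^K) G(q), and the
left side is 1 modulo q^(K+1). -/
theorem evalX_eulerG_mul : evalX eulerG * euler = 1 := by
  apply eq_of_forall_X_pow_dvd_sub
  intro K
  refine (pow_dvd_pow _ (Nat.le_succ K)).trans ?_
  have h1 := X_pow_dvd_evalHom_rescale (RingHom.id _) rfl (dvd_refl (X : ℤ⟦X⟧)) eulerG K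
  change X ^ (K + 1) ∣ evalX _ - _ at h1
  rw [rescale_pow_eulerG, map_mul, map_prod] at h1
  have h2 : ∏ l ∈ Finset.range K, evalX (1 - C ((X : ℤ⟦X⟧) ^ l) * X) = qpoch K := by
    refine Finset.prod_congr rfl fun l _ => ?_
    simp [evalX, pow_succ]
  rw [h2] at h1
  have h3 := (X_pow_dvd_euler_sub_qpoch K).mul_left (evalX eulerG)
  have h4 := dvd_add h1 h3
  convert h4 using 1
  simp [eulerG]
  ring

end Euler

/-! ### Series in q over Laurent polynomials in z: coefficients, moments and z d/dz. -/

section MapAdd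

variable {R S : Type*} [CommRing R] [CommRing S]

/-- Coefficientwise application of an additive map. -/
noncomputable def mapAdd (g : R →+ S) : R⟦X⟧ →+ S⟦X⟧ where
  toFun F := PowerSeries.mk fun n => g (coeff n F)
  map_zero' := by ext; simp
  map_add' F G := by ext; simp

@[simp] theorem coeff_mapAdd (g : R →+ S) (F : R⟦X⟧) (n : ℕ) :
    coeff n (mapAdd g F) = g (coeff n F) := by
  change coeff n (PowerSeries.mk fun n => g (coeff n F)) = _
  rw [coeff_mk]

theorem X_pow_dvd_mapAdd (g : R →+ S) (K : ℕ) (F : R⟦X⟧) (h : X ^ K ∣ F) :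
    X ^ K ∣ mapAdd g F := by
  rw [PowerSeries.X_pow_dvd_iff] at h ⊢
  intro m hm
  rw [coeff_mapAdd, h m hm, map_zero]

theorem mapAdd_qD (g : R →+ S) (F : R⟦X⟧) : mapAdd g (qD R F) = qD S (mapAdd g F) := by
  ext n
  rw [coeff_mapAdd, coeff_qD, coeff_qD, coeff_mapAdd, ← nsmul_eq_mul, map_nsmul, nsmul_eq_mul]

end MapAdd

/-- The ring of power series in `q` with coefficients Laurent polynomials in `z`. -/
abbrev LSeries : Type := (LaurentPolynomial ℤ)⟦X⟧

/-- Series in `q` as constants in `z`. -/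
noncomputable def iota : ℤ⟦X⟧ →+* LSeries := PowerSeries.map LaurentPolynomial.C

/-- The power `z ^ k`. -/
noncomputable def zpow (k : ℤ) : LSeries := PowerSeries.C (LaurentPolynomial.T k)

theorem zpow_zero : zpow 0 = 1 := by simp [zpow]

theorem zpow_add (k l : ℤ) : zpow (k + l) = zpow k * zpow l := by
  rw [zpow, LaurentPolynomial.T_add, map_mul]; rfl

theorem zpow_pow (k : ℤ) (n : ℕ) : zpow k ^ n = zpow (n * k) := by
  rw [zpow, ← map_pow, LaurentPolynomial.T_pow]; rfl

@[simp] theorem iota_X : iota X = X := by simp [iota]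

/-- The coefficient of `z ^ m` of a Laurent polynomial. -/
noncomputable def coeffL (m : ℤ) : LaurentPolynomial ℤ →+ ℤ where
  toFun p := p.coeff m
  map_zero' := by simp
  map_add' p r := by simp

theorem coeffL_C_mul_T (m k a : ℤ) :
    coeffL m (LaurentPolynomial.C a * LaurentPolynomial.T k) = if k = m then a else 0 := by
  rw [← LaurentPolynomial.single_eq_C_mul_T]
  change (AddMonoidAlgebra.single k a).coeff m = _
  rw [AddMonoidAlgebra.coeff_single, Finsupp.single_apply]

/-- An additive map out of Laurent polynomials given on monomials. -/
noncomputable def liftL {M : Type*} [AddCommMonoid M] (f : ℤ → ℤ →+ M) :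
    LaurentPolynomial ℤ →+ M where
  toFun p := Finsupp.liftAddHom f p.coeff
  map_zero' := by simp
  map_add' p r := by rw [AddMonoidAlgebra.coeff_add, map_add]

theorem liftL_C_mul_T {M : Type*} [AddCommMonoid M] (f : ℤ → ℤ →+ M) (k a : ℤ) :
    liftL f (LaurentPolynomial.C a * LaurentPolynomial.T k) = f k a := by
  rw [← LaurentPolynomial.single_eq_C_mul_T]
  change Finsupp.liftAddHom f (AddMonoidAlgebra.single k a).coeff = _
  rw [AddMonoidAlgebra.coeff_single, Finsupp.liftAddHom_apply_single]

/-- The `k`-th moment `∑ m ^ k c_m` of a Laurent polynomial `∑ c_m z ^ m`. -/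
noncomputable def momentL (k : ℕ) : LaurentPolynomial ℤ →+ ℤ :=
  liftL fun m => AddMonoidHom.mulLeft (m ^ k)

/-- The derivation `z d/dz` of Laurent polynomials. -/
noncomputable def deltaL : LaurentPolynomial ℤ →+ LaurentPolynomial ℤ :=
  liftL fun m => (AddMonoidHom.mulRight (LaurentPolynomial.T m)).comp
    (LaurentPolynomial.C.toAddMonoidHom.comp (AddMonoidHom.mulLeft m))

theorem momentL_C_mul_T (k : ℕ) (m a : ℤ) :
    momentL k (LaurentPolynomial.C a * LaurentPolynomial.T m) = m ^ k * a :=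
  liftL_C_mul_T _ _ _

theorem deltaL_C_mul_T (m a : ℤ) : deltaL (LaurentPolynomial.C a * LaurentPolynomial.T m)
    = LaurentPolynomial.C (m * a) * LaurentPolynomial.T m :=
  liftL_C_mul_T _ _ _

theorem C_mul_T_mul (a b k l : ℤ) : (LaurentPolynomial.C a * LaurentPolynomial.T k)
    * (LaurentPolynomial.C b * LaurentPolynomial.T l)
    = LaurentPolynomial.C (a * b) * LaurentPolynomial.T (k + l) := by
  rw [map_mul, LaurentPolynomial.T_add]; ring

/-- The k-th moment is (z d/dz)^k at z = 1, so this is Leibniz's rule; on monomials it is the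
binomial expansion of (m + l)^k. -/
theorem momentL_mul (k : ℕ) (p r : LaurentPolynomial ℤ) : momentL k (p * r)
    = ∑ i ∈ Finset.range (k + 1), (k.choose i : ℤ) * (momentL i p * momentL (k - i) r) := by
  induction p using LaurentPolynomial.induction_on' with
  | add p p' hp hp' =>
    rw [add_mul, map_add, hp, hp', ← Finset.sum_add_distrib]
    refine Finset.sum_congr rfl fun i _ => ?_
    rw [map_add]; ring
  | C_mul_T m a =>
    induction r using LaurentPolynomial.induction_on' with
    | add p p' hp hp' =>
      rw [mul_add, map_add, hp, hp', ← Finset.sum_add_distrib]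
      refine Finset.sum_congr rfl fun i _ => ?_
      rw [map_add]; ring
    | C_mul_T l b =>
      rw [C_mul_T_mul, momentL_C_mul_T, add_pow, Finset.sum_mul]
      refine Finset.sum_congr rfl fun i _ => ?_
      rw [momentL_C_mul_T, momentL_C_mul_T]; ring

theorem deltaL_mul (p r : LaurentPolynomial ℤ) :
    deltaL (p * r) = deltaL p * r + p * deltaL r := by
  induction p using LaurentPolynomial.induction_on' with
  | add p p' hp hp' => rw [add_mul, map_add, hp, hp', map_add]; ring
  | C_mul_T m a =>
    induction r using LaurentPolynomial.induction_on' with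
    | add p p' hp hp' => rw [mul_add, map_add, hp, hp', map_add]; ring
    | C_mul_T l b =>
      rw [C_mul_T_mul, deltaL_C_mul_T, deltaL_C_mul_T, deltaL_C_mul_T, C_mul_T_mul, C_mul_T_mul,
        ← add_mul, ← map_add]
      congr 2; ring

theorem momentL_deltaL (k : ℕ) (p : LaurentPolynomial ℤ) :
    momentL k (deltaL p) = momentL (k + 1) p := by
  induction p using LaurentPolynomial.induction_on' with
  | add p p' hp hp' => simp only [map_add, hp, hp']
  | C_mul_T m a => rw [deltaL_C_mul_T, momentL_C_mul_T, momentL_C_mul_T]; ring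

theorem coeffL_deltaL (m : ℤ) (p : LaurentPolynomial ℤ) :
    coeffL m (deltaL p) = m * coeffL m p := by
  induction p using LaurentPolynomial.induction_on' with
  | add p p' hp hp' => simp only [map_add, hp, hp', mul_add]
  | C_mul_T k a =>
    rw [deltaL_C_mul_T, coeffL_C_mul_T, coeffL_C_mul_T]
    split_ifs with h
    · rw [h]
    · simp

theorem coeffL_T_mul (m k : ℤ) (p : LaurentPolynomial ℤ) :
    coeffL m (LaurentPolynomial.T k * p) = coeffL (m - k) p := by
  induction p using LaurentPolynomial.induction_on' with
  | add p p' hp hp' => simp only [map_add, hp, hp', mul_add]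
  | C_mul_T l a =>
    rw [mul_left_comm, ← LaurentPolynomial.T_add, coeffL_C_mul_T, coeffL_C_mul_T]
    refine if_congr ?_ rfl rfl
    constructor <;> intro h <;> linarith

/-- The coefficient of `z ^ m`. -/
noncomputable def zcoeff (m : ℤ) : LSeries →+ ℤ⟦X⟧ := mapAdd (coeffL m)

/-- The `k`-th moment with respect to the powers of `z`. -/
noncomputable def moment (k : ℕ) : LSeries →+ ℤ⟦X⟧ := mapAdd (momentL k)

/-- The derivation `z d/dz`. -/
noncomputable def zD : LSeries →+ LSeries := mapAdd deltaL

theorem zcoeff_ext {F G : LSeries} (h : ∀ m, zcoeff m F = zcoeff m G) : F = G := by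
  ext n : 1
  apply LaurentPolynomial.ext
  intro m
  have := congrArg (coeff n) (h m)
  simp only [zcoeff, coeff_mapAdd] at this
  exact this

theorem coeffL_C_mul (m a : ℤ) (p : LaurentPolynomial ℤ) :
    coeffL m (LaurentPolynomial.C a * p) = a * coeffL m p := by
  induction p using LaurentPolynomial.induction_on' with
  | add p p' hp hp' => simp only [map_add, hp, hp', mul_add]
  | C_mul_T l b =>
    rw [← mul_assoc, ← map_mul, coeffL_C_mul_T, coeffL_C_mul_T]
    split_ifs <;> simp

theorem zcoeff_iota_mul (m : ℤ) (c : ℤ⟦X⟧) (F : LSeries) :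
    zcoeff m (iota c * F) = c * zcoeff m F := by
  ext n
  rw [zcoeff, coeff_mapAdd, coeff_mul, coeff_mul, map_sum]
  refine Finset.sum_congr rfl fun p _ => ?_
  rw [iota, coeff_map, coeffL_C_mul, coeff_mapAdd]

theorem zcoeff_zpow_mul (m k : ℤ) (F : LSeries) : zcoeff m (zpow k * F) = zcoeff (m - k) F := by
  ext n
  rw [zcoeff, coeff_mapAdd, zpow, coeff_C_mul, coeffL_T_mul, zcoeff, coeff_mapAdd]

theorem zcoeff_one (m : ℤ) : zcoeff m 1 = if m = 0 then 1 else 0 := by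
  ext n
  rw [zcoeff, coeff_mapAdd, coeff_one]
  have h : coeffL m 1 = if m = 0 then 1 else 0 := by
    have := coeffL_C_mul_T m 0 1
    rw [map_one, one_mul, LaurentPolynomial.T_zero] at this
    rw [this]; exact if_congr eq_comm rfl rfl
  split_ifs with h1 h2 h2 <;> simp_all

theorem zcoeff_iota_mul_zpow (m k : ℤ) (c : ℤ⟦X⟧) :
    zcoeff m (iota c * zpow k) = if m = k then c else 0 := by
  have := zcoeff_zpow_mul m k 1
  rw [mul_one, zcoeff_one] at this
  rw [zcoeff_iota_mul, this]
  by_cases h : m = k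
  · rw [if_pos h, if_pos (by omega), mul_one]
  · rw [if_neg h, if_neg (by omega), mul_zero]

theorem zcoeff_zD (m : ℤ) (F : LSeries) : zcoeff m (zD F) = (m : ℤ⟦X⟧) * zcoeff m F := by
  ext n
  have h : (m : ℤ⟦X⟧) = C m := by simp
  rw [zcoeff, coeff_mapAdd, zD, coeff_mapAdd, coeffL_deltaL, h, coeff_C_mul, coeff_mapAdd]

theorem zcoeff_qD (m : ℤ) (F : LSeries) : zcoeff m (qD _ F) = qD _ (zcoeff m F) := mapAdd_qD _ _

theorem moment_qD (k : ℕ) (F : LSeries) : moment k (qD _ F) = qD _ (moment k F) := mapAdd_qD _ _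

theorem moment_zD (k : ℕ) (F : LSeries) : moment k (zD F) = moment (k + 1) F := by
  ext n
  rw [moment, coeff_mapAdd, zD, coeff_mapAdd, momentL_deltaL, moment, coeff_mapAdd]

theorem zD_mul (F G : LSeries) : zD (F * G) = zD F * G + F * zD G := by
  ext n : 1
  rw [map_add, zD, coeff_mapAdd, coeff_mul, coeff_mul, coeff_mul, map_sum, ← Finset.sum_add_distrib]
  refine Finset.sum_congr rfl fun p _ => ?_
  rw [deltaL_mul, coeff_mapAdd, coeff_mapAdd]

theorem moment_mul (k : ℕ) (F G : LSeries) : moment k (F * G)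
    = ∑ i ∈ Finset.range (k + 1), (k.choose i : ℤ⟦X⟧) * (moment i F * moment (k - i) G) := by
  ext n
  rw [moment, coeff_mapAdd, coeff_mul, map_sum, map_sum]
  simp only [momentL_mul]
  rw [Finset.sum_comm]
  refine Finset.sum_congr rfl fun i _ => ?_
  have h : (k.choose i : ℤ⟦X⟧) = C (k.choose i : ℤ) := by simp
  rw [h, coeff_C_mul, coeff_mul, Finset.mul_sum]
  refine Finset.sum_congr rfl fun p _ => ?_
  rw [moment, coeff_mapAdd, moment, coeff_mapAdd]

theorem moment_iota (k : ℕ) (c : ℤ⟦X⟧) : moment k (iota c) = if k = 0 then c else 0 := by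
  ext n
  have := momentL_C_mul_T k 0 (coeff n c)
  rw [LaurentPolynomial.T_zero, mul_one] at this
  rw [moment, coeff_mapAdd, iota, coeff_map, this]
  split_ifs with h <;> simp [h]

theorem moment_zero_mul (F G : LSeries) : moment 0 (F * G) = moment 0 F * moment 0 G := by
  rw [moment_mul]; simp

theorem moment_iota_mul (k : ℕ) (c : ℤ⟦X⟧) (F : LSeries) :
    moment k (iota c * F) = c * moment k F := by
  rw [moment_mul, Finset.sum_eq_single 0]
  · simp [moment_iota]
  · intro i _ hi
    rw [moment_iota, if_neg hi]; simp
  · simp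

theorem moment_zpow (k : ℕ) (m : ℤ) : moment k (zpow m) = (m : ℤ⟦X⟧) ^ k := by
  ext n
  have := momentL_C_mul_T k m 1
  have h : (m : ℤ⟦X⟧) ^ k = C (m ^ k) := by simp
  rw [map_one, one_mul] at this
  rw [moment, coeff_mapAdd, zpow, coeff_C, h, coeff_C]
  split_ifs
  · rw [this, mul_one]
  · simp

theorem zD_iota_mul (c : ℤ⟦X⟧) (F : LSeries) : zD (iota c * F) = iota c * zD F := by
  apply zcoeff_ext
  intro m
  rw [zcoeff_zD, zcoeff_iota_mul, zcoeff_iota_mul, zcoeff_zD]; ring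

theorem zD_zpow (k : ℤ) : zD (zpow k) = (k : LSeries) * zpow k := by
  have h : (k : LSeries) = iota k := by simp
  apply zcoeff_ext
  intro m
  have h2 := zcoeff_iota_mul_zpow m k 1
  rw [map_one, one_mul] at h2
  rw [zcoeff_zD, h, zcoeff_iota_mul, h2]
  split_ifs with h3
  · rw [h3]
  · simp

/-- Substitution of `z ^ e q` for the variable of a power series over `ℤ⟦q⟧`. -/
noncomputable def tau (e : ℤ) : ℤ⟦X⟧⟦X⟧ →+* LSeries :=
  evalHom iota (zpow e * X) (Dvd.intro_left _ rfl)

theorem hasQSum_tau (e : ℤ) (F : ℤ⟦X⟧⟦X⟧) :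
    HasQSum (fun j => iota (coeff j F * X ^ j) * zpow (j * e)) (tau e F) := by
  have : HasQSum (fun j => iota (coeff j F) * (zpow e * X) ^ j) (tau e F) :=
    hasQSum_evalHom _ F
  convert this using 2 with j
  rw [mul_pow, zpow_pow, map_mul, map_pow, iota_X]; ring

@[simp] theorem tau_C (e : ℤ) (c : ℤ⟦X⟧) : tau e (C c) = iota c := evalHom_C _ _

@[simp] theorem tau_X (e : ℤ) : tau e X = zpow e * X := evalHom_X _

/-- Chain rule for the substitution x = z^e q. -/
theorem zD_tau (e : ℤ) (F : ℤ⟦X⟧⟦X⟧) : zD (tau e F) = (e : LSeries) * tau e (qD _ F) := by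
  refine ((hasQSum_tau e F).map zD fun K x hx => X_pow_dvd_mapAdd _ K x hx).unique ?_
  convert (hasQSum_tau e (qD _ F)).mul_left (e : LSeries) using 2 with j
  have h : (e : LSeries) * iota j = iota ((j * e : ℤ) : ℤ⟦X⟧) := by simp [mul_comm]
  rw [zD_iota_mul, zD_zpow, coeff_qD, mul_assoc, map_mul _ (j : ℤ⟦X⟧)]
  simp
  ring

theorem moment_zero_tau (e : ℤ) (F : ℤ⟦X⟧⟦X⟧) : moment 0 (tau e F) = evalX F := by
  refine ((hasQSum_tau e F).map (moment 0) fun K x hx => X_pow_dvd_mapAdd _ K x hx).unique ?_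
  have : HasQSum (fun j => RingHom.id _ (coeff j F) * X ^ j) (evalX F) := hasQSum_evalHom _ F
  convert this using 2 with j
  rw [moment_iota_mul, moment_zpow, pow_zero, mul_one]; rfl

theorem HasQSum.coeff_eq {S : Type*} [CommRing S] {f : ℕ → S⟦X⟧} {s : S⟦X⟧} (h : HasQSum f s)
    (n : ℕ) : coeff n s = ∑ j ∈ Finset.range (n + 1), coeff n (f j) := by
  have := PowerSeries.X_pow_dvd_iff.1 (h (n + 1)) n (Nat.lt_succ_self n)
  rwa [map_sub, map_sum, sub_eq_zero] at this

/-! ### Moments of Lambert series as divisor sums. -/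

section DivisorSums

/-- The generating series of the divisor power sums `∑ d ^ k` over `d ∣ n`. -/
noncomputable def phi (k : ℕ) : ℤ⟦X⟧ := PowerSeries.mk fun n => ∑ d ∈ n.divisors, (d : ℤ) ^ k

theorem coeff_lambert_mul_X_pow {j : ℕ} (hj : j ≠ 0) : coeff j lambert * X ^ j
    = PowerSeries.mk fun n => if j ∣ n ∧ n ≠ 0 then (1 : ℤ) else 0 := by
  have h0 : (1 - X ^ j : ℤ⟦X⟧) ≠ 0 := by
    intro h
    have := congrArg (constantCoeff (R := ℤ)) h
    simp [hj] at this
  apply mul_left_cancel₀ h0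
  rw [← mul_assoc, one_sub_mul_coeff_lambert hj, one_mul]
  ext n
  rw [sub_mul, one_mul, map_sub, coeff_mk, coeff_X_pow_mul', coeff_X_pow]
  by_cases hn : j ≤ n
  · obtain ⟨m, rfl⟩ := Nat.exists_eq_add_of_le hn
    rw [if_pos hn, coeff_mk]
    have h1 : j + m - j = m := by omega
    rw [h1]
    have h2 : (j ∣ j + m ∧ j + m ≠ 0) ↔ j ∣ m := by
      rw [Nat.dvd_add_right (dvd_refl j)]
      exact ⟨fun h => h.1, fun h => ⟨h, by omega⟩⟩
    simp only [h2]
    by_cases hm : m = 0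
    · subst hm; simp
    · simp [hm]
  · rw [if_neg hn, if_neg (by omega), if_neg, sub_zero]
    rintro ⟨h1, h2⟩
    exact hn (Nat.le_of_dvd (Nat.pos_of_ne_zero h2) h1)

/-- The j-th term of the substituted series is z^(e j) q^j/(1 - q^j). It contributes (e j)^k to
every positive multiple of j, hence the sum over divisors. -/
theorem moment_tau_lambert (k : ℕ) (e : ℤ) :
    moment k (tau e lambert) = (e : ℤ⟦X⟧) ^ k * phi k := by
  have h := (hasQSum_tau e lambert).map (moment k) fun K x hx => X_pow_dvd_mapAdd _ K x hx
  ext n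
  rw [h.coeff_eq]
  have hc : (e : ℤ⟦X⟧) ^ k = C (e ^ k) := by simp
  rw [hc, coeff_C_mul, phi, coeff_mk, Finset.mul_sum]
  have h2 : n.divisors ⊆ Finset.range (n + 1) := fun d hd =>
    Finset.mem_range.2 (Nat.lt_succ_of_le (Nat.divisor_le hd))
  rw [← Finset.sum_subset h2 (f := fun j => coeff n
    (moment k (iota ((coeff j) lambert * X ^ j) * zpow (j * e))))]
  · refine Finset.sum_congr rfl fun j hj => ?_
    have hj' := Nat.mem_divisors.1 hj
    have hj0 : j ≠ 0 := by rintro rfl; exact hj'.2 (zero_dvd_iff.1 hj'.1)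
    have hc2 : ((j * e : ℤ) : ℤ⟦X⟧) ^ k = C ((j * e) ^ k) := by simp
    rw [moment_iota_mul, moment_zpow, hc2, coeff_mul_C, coeff_lambert_mul_X_pow hj0, coeff_mk,
      if_pos hj']
    ring
  · intro j _ hj
    rw [Nat.mem_divisors] at hj
    have hc2 : ((j * e : ℤ) : ℤ⟦X⟧) ^ k = C ((j * e) ^ k) := by simp
    rw [moment_iota_mul, moment_zpow, hc2, coeff_mul_C]
    by_cases hj0 : j = 0
    · subst hj0
      simp [lambert]
    · rw [coeff_lambert_mul_X_pow hj0, coeff_mk, if_neg hj, zero_mul]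

end DivisorSums

/-! ### The crank product, its cube and recursions for their moments. -/

section CrankProduct

/-- The generating series of partitions. -/
noncomputable def partSeries : ℤ⟦X⟧ := evalX eulerG

theorem partSeries_mul_euler : partSeries * euler = 1 := evalX_eulerG_mul

/-- The product of `(1 - q ^ n) / ((1 - z q ^ n) (1 - z⁻¹ q ^ n))` over `n ≥ 1`. -/
noncomputable def crankProd : LSeries := iota euler * (tau 1 eulerG * tau (-1) eulerG)

/-- The cube of the crank product times the square of the Euler product. -/
noncomputable def crankCube : LSeries := iota (euler ^ 2) * crankProd ^ 3

/-- The logarithmic derivative of the crank product. -/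
noncomputable def crankLog : LSeries := tau 1 lambert - tau (-1) lambert

theorem zD_crankProd : zD crankProd = crankLog * crankProd := by
  rw [crankProd, zD_iota_mul, zD_mul, zD_tau, zD_tau, qD_eulerG, map_mul, map_mul, crankLog]
  push_cast
  ring

theorem zD_crankCube : zD crankCube = 3 * (crankLog * crankCube) := by
  rw [crankCube, zD_iota_mul, show crankProd ^ 3 = crankProd * crankProd * crankProd by ring,
      zD_mul, zD_mul, zD_crankProd]
  ring

theorem moment_crankLog (k : ℕ) : moment k crankLog = (1 - (-1) ^ k) * phi k := by
  rw [crankLog, map_sub, moment_tau_lambert, moment_tau_lambert]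
  push_cast
  ring

theorem moment_zero_crankProd : moment 0 crankProd = partSeries := by
  rw [crankProd, moment_iota_mul, moment_zero_mul, moment_zero_tau, moment_zero_tau]
  change euler * (partSeries * partSeries) = _
  linear_combination partSeries * partSeries_mul_euler

theorem moment_zero_crankCube : moment 0 crankCube = partSeries := by
  rw [crankCube, moment_iota_mul, show crankProd ^ 3 = crankProd * crankProd * crankProd by ring,
    moment_zero_mul, moment_zero_mul,
    moment_zero_crankProd]
  linear_combination (partSeries * (partSeries * euler + 1)) * partSeries_mul_euler

/-- Moments of the equation z C' = (log derivative) · C. Only odd i contribute, so starting from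
`moment_zero_crankProd` every even moment is `partSeries` times a polynomial in the odd `phi i`. -/
theorem moment_succ_crankProd (k : ℕ) : moment (k + 1) crankProd
    = ∑ i ∈ Finset.range (k + 1),
      (k.choose i : ℤ⟦X⟧) * ((1 - (-1) ^ i) * phi i * moment (k - i) crankProd) := by
  rw [← moment_zD, zD_crankProd, moment_mul]
  simp only [moment_crankLog]

theorem moment_succ_crankCube (k : ℕ) : moment (k + 1) crankCube
    = 3 * ∑ i ∈ Finset.range (k + 1),
      (k.choose i : ℤ⟦X⟧) * ((1 - (-1) ^ i) * phi i * moment (k - i) crankCube) := by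
  have h3 : (3 : LSeries) = iota 3 := (map_ofNat iota 3).symm
  rw [← moment_zD, zD_crankCube, h3, moment_iota_mul, moment_mul]
  simp only [moment_crankLog]

/-- The extra factor `euler` makes the right side a perfect cube, namely of ∏ (1 - q^n)² / ((1 - z
q^n)(1 - z⁻¹ q^n)). -/
theorem crankCube_eq : iota euler * crankCube
    = iota (euler ^ 6) * (tau 1 (eulerG ^ 3) * tau (-1) (eulerG ^ 3)) := by
  rw [crankCube, crankProd, map_pow, map_pow, map_pow, map_pow]; ring

end CrankProduct

/-! ### Coefficients of z^m in products F(zq) H(q/z). -/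

section Diagonal

/-- Coefficients of a power series, extended by zero to negative indices. -/
noncomputable def zext (F : ℤ⟦X⟧⟦X⟧) (i : ℤ) : ℤ⟦X⟧ := if i < 0 then 0 else coeff i.toNat F

theorem zext_natCast (F : ℤ⟦X⟧⟦X⟧) (i : ℕ) : zext F i = coeff i F := by
  rw [zext, if_neg (by omega), Int.toNat_natCast]

theorem zext_neg (F : ℤ⟦X⟧⟦X⟧) {i : ℤ} (hi : i < 0) : zext F i = 0 := if_pos hi

theorem zext_X_mul (F : ℤ⟦X⟧⟦X⟧) (i : ℤ) : zext (X * F) i = zext F (i - 1) := by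
  rcases lt_or_ge i 0 with h | h
  · rw [zext_neg _ h, zext_neg _ (by omega)]
  · obtain ⟨n, rfl⟩ := Int.eq_ofNat_of_zero_le h
    rw [zext_natCast]
    rcases n with _ | n
    · rw [zext_neg _ (by simp)]; simp
    · rw [coeff_succ_X_mul]
      have : ((n + 1 : ℕ) : ℤ) - 1 = n := by push_cast; ring
      rw [this, zext_natCast]

/-- The sum of `q ^ j F_{m + j} H_j` over `j ≥ 0`. -/
noncomputable def diagSum (F H : ℤ⟦X⟧⟦X⟧) (m : ℤ) : ℤ⟦X⟧ :=
  qsum fun j => X ^ j * (zext F (m + j) * coeff j H)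

theorem hasQSum_diagSum (F H : ℤ⟦X⟧⟦X⟧) (m : ℤ) :
    HasQSum (fun j => X ^ j * (zext F (m + j) * coeff j H)) (diagSum F H m) :=
  hasQSum_qsum fun _ => dvd_mul_right _ _

theorem diagSum_sub_left (F F' H : ℤ⟦X⟧⟦X⟧) (m : ℤ) :
    diagSum (F - F') H m = diagSum F H m - diagSum F' H m := by
  rw [eq_sub_iff_add_eq]
  refine ((hasQSum_diagSum _ _ _).add (hasQSum_diagSum _ _ _)).unique ?_
  convert hasQSum_diagSum F H m using 2 with j
  have : zext F (m + j) = zext (F - F') (m + j) + zext F' (m + j) := by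
    simp only [zext]; split_ifs <;> simp
  rw [this]; ring

theorem diagSum_X_mul_left (F H : ℤ⟦X⟧⟦X⟧) (m : ℤ) :
    diagSum (X * F) H m = diagSum F H (m - 1) := by
  refine (hasQSum_diagSum _ _ _).unique ?_
  convert hasQSum_diagSum F H (m - 1) using 2 with j
  rw [zext_X_mul]
  congr 3; ring

/-- The first m terms vanish because the index of F is negative there; shifting j by m exchanges the
roles of F and H. This is the symmetry z ↦ q/z. -/
theorem diagSum_neg (F H : ℤ⟦X⟧⟦X⟧) (m : ℕ) :
    diagSum F H (-m) = X ^ m * diagSum H F m := by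
  refine ((hasQSum_diagSum F H (-m)).shift m ?_).unique ?_
  · intro j hj
    rw [zext_neg _ (by omega)]; ring
  · convert (hasQSum_diagSum H F m).mul_left (X ^ m) using 2 with j
    have h1 : (-(m : ℤ) + ((j + m : ℕ) : ℤ)) = j := by push_cast; ring
    have h2 : (m : ℤ) + j = ((j + m : ℕ) : ℤ) := by push_cast; ring
    rw [h1, h2, zext_natCast, zext_natCast]; ring

/-- The monomials z^(i - j) q^(i + j) F_i H_j with i - j = m are collected; the power q^i of the
first factor is absorbed into `rescale X F`. -/
theorem zcoeff_tau_mul_tau (F H : ℤ⟦X⟧⟦X⟧) (m : ℤ) :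
    zcoeff m (tau 1 F * tau (-1) H) = diagSum (rescale X F) H m := by
  apply eq_of_forall_X_pow_dvd_sub
  intro K
  have h1 := hasQSum_tau 1 F K
  have h2 := hasQSum_tau (-1) H K
  set s := ∑ j ∈ Finset.range K, iota (coeff j F * X ^ j) * zpow (j * 1)
  set t := ∑ j ∈ Finset.range K, iota (coeff j H * X ^ j) * zpow (j * -1)
  have h3 : X ^ K ∣ tau 1 F * tau (-1) H - s * t := by
    have := dvd_add (h1.mul_right (tau (-1) H)) (h2.mul_left s)
    convert this using 1; ring
  have h4 := X_pow_dvd_mapAdd (coeffL m) K _ h3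
  change X ^ K ∣ zcoeff m _ at h4
  rw [map_sub] at h4
  have h5 := hasQSum_diagSum (rescale X F) H m K
  have h6 : zcoeff m (s * t) = ∑ j ∈ Finset.range K, ∑ i ∈ Finset.range K,
      if m = (i : ℤ) - j then coeff i F * X ^ i * (coeff j H * X ^ j) else 0 := by
    rw [Finset.sum_comm, Finset.sum_mul_sum, map_sum]
    refine Finset.sum_congr rfl fun i _ => ?_
    rw [map_sum]
    refine Finset.sum_congr rfl fun j _ => ?_
    rw [mul_mul_mul_comm, ← map_mul, ← zpow_add, zcoeff_iota_mul_zpow]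
    congr 2; ring
  -- For each j < K the index i = m + j is negative, below K, or at least K. In the first two cases
  -- the inner sum equals the diagonal term; in the last, the diagonal term carries q^i and is
  -- divisible by `X ^ K`.
  have h7 : (X : ℤ⟦X⟧) ^ K ∣ ∑ j ∈ Finset.range K, X ^ j * (zext (rescale X F) (m + j) * coeff j H)
      - zcoeff m (s * t) := by
    rw [h6, ← Finset.sum_sub_distrib]
    refine Finset.dvd_sum fun j _ => ?_
    by_cases hneg : m + j < 0
    · rw [zext_neg _ hneg, Finset.sum_eq_zero]
      · simp
      · intro i _; rw [if_neg (by omega)]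
    · obtain ⟨i, hi⟩ := Int.eq_ofNat_of_zero_le (not_lt.1 hneg)
      rw [hi, zext_natCast, coeff_rescale]
      by_cases hiK : i < K
      · rw [Finset.sum_eq_single_of_mem i (Finset.mem_range.2 hiK), if_pos (by omega)]
        · ring_nf; simp
        · intro l _ hl; rw [if_neg (by omega)]
      · rw [Finset.sum_eq_zero, sub_zero]
        · exact (((pow_dvd_pow X (not_lt.1 hiK)).mul_right _).mul_right _).mul_left _
        · intro l hl
          have := Finset.mem_range.1 hl
          rw [if_neg (by omega)]
  have h8 := dvd_sub h4 (dvd_add h5 h7)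
  convert h8 using 1
  ring

end Diagonal

/-! ### Sequences determined by their third differences. -/

section ThirdDifference

/-- Three consecutive zeros propagate to the right through the recurrence. -/
theorem eq_zero_of_third_difference_of_le {d : ℤ → ℤ} {a : ℤ}
    (h : ∀ m, d m - 3 * d (m - 1) + 3 * d (m - 2) - d (m - 3) = 0) (h0 : ∀ m < a, d m = 0)
    (m : ℤ) : d m = 0 := by
  have key : ∀ i : ℕ, d (a - 3 + i) = 0 ∧ d (a - 2 + i) = 0 ∧ d (a - 1 + i) = 0 := by
    intro i
    induction i with
    | zero => exact ⟨h0 _ (by simp), h0 _ (by simp), h0 _ (by simp)⟩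
    | succ i ih =>
      obtain ⟨h1, h2, h3⟩ := ih
      have h4 := h (a + i)
      rw [show a + i - 1 = a - 1 + (i : ℤ) by ring, show a + i - 2 = a - 2 + (i : ℤ) by ring,
        show a + i - 3 = a - 3 + (i : ℤ) by ring, h1, h2, h3] at h4
      push_cast
      refine ⟨?_, ?_, ?_⟩
      · rw [show a - 3 + ((i : ℤ) + 1) = a - 2 + i by ring, h2]
      · rw [show a - 2 + ((i : ℤ) + 1) = a - 1 + i by ring, h3]
      · rw [show a - 1 + ((i : ℤ) + 1) = a + i by ring]; linarith
  rcases lt_or_ge m a with hm | hm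
  · exact h0 m hm
  · have := (key (m - a + 1).toNat).2.2
    rwa [Int.toNat_of_nonneg (by omega), show a - 1 + (m - a + 1) = m by ring] at this

theorem eq_zero_of_third_difference_of_ge {d : ℤ → ℤ} {a : ℤ}
    (h : ∀ m, d m - 3 * d (m - 1) + 3 * d (m - 2) - d (m - 3) = 0) (h0 : ∀ m, a ≤ m → d m = 0)
    (m : ℤ) : d m = 0 := by
  have := eq_zero_of_third_difference_of_le (d := fun m => d (-m)) (a := -a + 1) (fun m => ?_)
    (fun m hm => h0 _ (by omega)) (-m)
  · simpa using this
  · have h1 := h (-m + 3)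
    rw [show -(m - 1) = -m + 3 - 2 by ring, show -(m - 2) = -m + 3 - 1 by ring,
      show -(m - 3) = -m + 3 by ring]
    rw [show -m + 3 - 3 = -m by ring] at h1
    linarith

/-- Twice the coefficients of `(1 - x) ^ (-3)`. -/
def cubeKernel (x : ℤ) : ℤ := if x < 0 then 0 else (x + 1) * (x + 2)

theorem cubeKernel_third_difference (x : ℤ) : cubeKernel x - 3 * cubeKernel (x - 1)
    + 3 * cubeKernel (x - 2) - cubeKernel (x - 3) = if x = 0 then 2 else 0 := by
  have h : x < 0 ∨ x = 0 ∨ x = 1 ∨ x = 2 ∨ 3 ≤ x := by omega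
  rcases h with h | rfl | rfl | rfl | h
  · simp only [cubeKernel]
    rw [if_pos h, if_pos (by omega), if_pos (by omega), if_pos (by omega), if_neg (by omega)]
    ring
  · decide
  · decide
  · decide
  · simp only [cubeKernel]
    rw [if_neg (by omega), if_neg (by omega), if_neg (by omega), if_neg (by omega),
      if_neg (by omega)]
    ring

/-- A double-sided sequence vanishing far to the left is recovered from its third difference. -/
theorem two_mul_eq_of_third_difference {β γ : ℤ → ℤ} {n : ℤ}
    (h : ∀ m, β m - 3 * β (m - 1) + 3 * β (m - 2) - β (m - 3) = γ m)
    (hβ : ∀ m < -n, β m = 0) (hγ : ∀ m, m ∉ Finset.Icc (-n) n → γ m = 0) {m : ℤ} (hm : n ≤ m) :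
    2 * β m = (m + 1) * (m + 2) * ∑ k ∈ Finset.Icc (-n) n, γ k
      - (2 * m + 3) * (∑ k ∈ Finset.Icc (-n) n, k * γ k)
      + ∑ k ∈ Finset.Icc (-n) n, k ^ 2 * γ k := by
  -- 2β is compared with the convolution of γ and `cubeKernel`, both zero far to the left. For m ≥ n
  -- every kernel value is polynomial, and (m-k+1)(m-k+2) = (m+1)(m+2) - (2m+3)k + k² yields the
  -- three moments of γ.
  have key := eq_zero_of_third_difference_of_le
    (d := fun m => 2 * β m - ∑ k ∈ Finset.Icc (-n) n, γ k * cubeKernel (m - k)) (a := -n)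
    (fun m => ?_) (fun m hm => ?_) m
  · have h1 : ∑ k ∈ Finset.Icc (-n) n, γ k * cubeKernel (m - k)
        = ∑ k ∈ Finset.Icc (-n) n,
          ((m + 1) * (m + 2) * γ k - (2 * m + 3) * (k * γ k) + k ^ 2 * γ k) := by
      refine Finset.sum_congr rfl fun k hk => ?_
      have := Finset.mem_Icc.1 hk
      rw [cubeKernel, if_neg (by omega)]; ring
    rw [h1, Finset.sum_add_distrib, Finset.sum_sub_distrib, ← Finset.mul_sum,
      ← Finset.mul_sum] at key
    linarith
  · have h1 : ∑ k ∈ Finset.Icc (-n) n, γ k * cubeKernel (m - k)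
        - 3 * (∑ k ∈ Finset.Icc (-n) n, γ k * cubeKernel (m - 1 - k))
        + 3 * (∑ k ∈ Finset.Icc (-n) n, γ k * cubeKernel (m - 2 - k))
        - ∑ k ∈ Finset.Icc (-n) n, γ k * cubeKernel (m - 3 - k) = 2 * γ m := by
      rw [Finset.mul_sum, Finset.mul_sum, ← Finset.sum_sub_distrib, ← Finset.sum_add_distrib,
        ← Finset.sum_sub_distrib]
      have h2 : ∀ k ∈ Finset.Icc (-n) n, γ k * cubeKernel (m - k)
          - 3 * (γ k * cubeKernel (m - 1 - k)) + 3 * (γ k * cubeKernel (m - 2 - k))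
          - γ k * cubeKernel (m - 3 - k) = if k = m then 2 * γ m else 0 := by
        intro k _
        have h3 := cubeKernel_third_difference (m - k)
        rw [show m - k - 1 = m - 1 - k by ring, show m - k - 2 = m - 2 - k by ring,
          show m - k - 3 = m - 3 - k by ring] at h3
        split_ifs with hk
        · subst hk
          rw [if_pos (by ring)] at h3
          linear_combination γ k * h3
        · rw [if_neg (by omega)] at h3
          linear_combination γ k * h3
      rw [Finset.sum_congr rfl h2, Finset.sum_ite_eq']
      split_ifs with hm
      · rfl
      · rw [hγ m hm]; simp
    linarith [h m]
  · rw [hβ m hm, Finset.sum_eq_zero]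
    · simp
    · intro k hk
      have := Finset.mem_Icc.1 hk
      rw [cubeKernel, if_pos (by omega), mul_zero]

end ThirdDifference

/-! ### Laurent coefficients of the cubed quotient and their reflection law. -/

section CubeCoeff

theorem momentL_eq_sum (k : ℕ) (p : LaurentPolynomial ℤ) (s : Finset ℤ)
    (hs : ∀ m, m ∉ s → coeffL m p = 0) : momentL k p = ∑ m ∈ s, m ^ k * coeffL m p := by
  change Finsupp.liftAddHom _ p.coeff = _
  rw [Finsupp.liftAddHom_apply, Finsupp.sum]
  change ∑ m ∈ p.coeff.support, m ^ k * coeffL m p = _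
  apply Finset.sum_subset_zero_on_sdiff
  · intro m hm
    by_contra h
    exact (Finsupp.mem_support_iff.1 hm) (hs m h)
  · intro m hm
    have : coeffL m p = 0 := Finsupp.notMem_support_iff.1 (Finset.mem_sdiff.1 hm).2
    rw [this, mul_zero]
  · intro m _; rfl

theorem coeff_moment_eq_sum (k n : ℕ) (F : LSeries) (s : Finset ℤ)
    (hs : ∀ m, m ∉ s → coeff n (zcoeff m F) = 0) :
    coeff n (moment k F) = ∑ m ∈ s, m ^ k * coeff n (zcoeff m F) := by
  simp only [zcoeff, moment, coeff_mapAdd] at hs ⊢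
  exact momentL_eq_sum k _ s hs

/-- The coefficients of the cube of `∏ (1 - q ^ n) ^ 2 / ((1 - z q ^ (n - 1)) (1 - z⁻¹ q ^ n))`,
expanded in the annulus `|q| < |z| < 1`. -/
noncomputable def cubeCoeff (m : ℤ) : ℤ⟦X⟧ := euler ^ 6 * diagSum (eulerG ^ 3) (eulerG ^ 3) m

theorem cubeCoeff_neg (m : ℕ) : cubeCoeff (-m) = X ^ m * cubeCoeff m := by
  rw [cubeCoeff, diagSum_neg, cubeCoeff]; ring

theorem rescale_eulerG_cube : rescale (X : ℤ⟦X⟧) (eulerG ^ 3) = (1 - X) ^ 3 * eulerG ^ 3 := by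
  rw [map_pow, rescale_eulerG, mul_pow]

theorem diagSum_one_sub_X_mul (F H : ℤ⟦X⟧⟦X⟧) (m : ℤ) :
    diagSum ((1 - X) * F) H m = diagSum F H m - diagSum F H (m - 1) := by
  rw [sub_mul, one_mul, diagSum_sub_left, diagSum_X_mul_left]

/-- G(zq)³ = (1 - z)³ G(z)³, and multiplication by (1 - z)³ is the third difference on coefficients
in z. -/
theorem zcoeff_crankCube (m : ℤ) : zcoeff m (iota euler * crankCube)
    = cubeCoeff m - 3 * cubeCoeff (m - 1) + 3 * cubeCoeff (m - 2) - cubeCoeff (m - 3) := by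
  rw [crankCube_eq, zcoeff_iota_mul, zcoeff_tau_mul_tau, rescale_eulerG_cube,
    show (1 - X : ℤ⟦X⟧⟦X⟧) ^ 3 * eulerG ^ 3 = (1 - X) * ((1 - X) * ((1 - X) * eulerG ^ 3)) by ring]
  simp only [diagSum_one_sub_X_mul, cubeCoeff]
  rw [show m - 1 - 1 = m - 2 by ring, show m - 2 - 1 = m - 3 by ring]
  ring

theorem diagSum_rescale_left (F : ℤ⟦X⟧⟦X⟧) (m : ℕ) :
    diagSum (rescale X F) F m = X ^ m * diagSum F (rescale X F) m := by
  refine (hasQSum_diagSum _ _ _).unique ?_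
  convert (hasQSum_diagSum F (rescale X F) m).mul_left (X ^ m) using 2 with j
  rw [show (m : ℤ) + j = ((m + j : ℕ) : ℤ) by push_cast; ring, zext_natCast, zext_natCast,
    coeff_rescale, coeff_rescale]
  ring

theorem zcoeff_neg_crankCube (m : ℤ) :
    zcoeff (-m) (iota euler * crankCube) = zcoeff m (iota euler * crankCube) := by
  have key : ∀ n : ℕ, zcoeff (-n : ℤ) (iota euler * crankCube)
      = zcoeff n (iota euler * crankCube) := by
    intro n
    rw [crankCube_eq, zcoeff_iota_mul, zcoeff_iota_mul, zcoeff_tau_mul_tau, zcoeff_tau_mul_tau,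
      diagSum_neg, diagSum_rescale_left]
  rcases Int.eq_nat_or_neg m with ⟨n, rfl | rfl⟩
  · exact key n
  · rw [neg_neg, key]

theorem coeff_cubeCoeff_eq_zero {n : ℕ} {m : ℤ} (hm : m < -n) : coeff n (cubeCoeff m) = 0 := by
  obtain ⟨k, hk⟩ := Int.eq_ofNat_of_zero_le (show 0 ≤ -m by omega)
  obtain rfl : m = -(k : ℤ) := by omega
  rw [cubeCoeff_neg, coeff_X_pow_mul', if_neg (by omega)]

/-- To the left the factor q^(-m) of `cubeCoeff m` for negative m kills the coefficient; the right
side follows by the symmetry z ↦ z⁻¹. -/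
theorem coeff_zcoeff_crankCube_eq_zero {n : ℕ} {m : ℤ} (hm : m ∉ Finset.Icc (-n : ℤ) n) :
    coeff n (zcoeff m (iota euler * crankCube)) = 0 := by
  have key : ∀ m : ℤ, m < -n → coeff n (zcoeff m (iota euler * crankCube)) = 0 := by
    intro m hm
    have h3 : (3 : ℤ⟦X⟧) = C 3 := by simp
    rw [zcoeff_crankCube, map_sub, map_add, map_sub, h3, coeff_C_mul, coeff_C_mul,
      coeff_cubeCoeff_eq_zero hm, coeff_cubeCoeff_eq_zero (by omega),
      coeff_cubeCoeff_eq_zero (by omega), coeff_cubeCoeff_eq_zero (by omega)]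
    simp
  rw [Finset.mem_Icc, not_and_or] at hm
  rcases hm with hm | hm
  · exact key m (by omega)
  · rw [← zcoeff_neg_crankCube]
    exact key _ (by omega)

theorem moment_euler_mul_crankCube_zero : moment 0 (iota euler * crankCube) = 1 := by
  rw [moment_iota_mul, moment_zero_crankCube, mul_comm, partSeries_mul_euler]

theorem moment_euler_mul_crankCube_one : moment 1 (iota euler * crankCube) = 0 := by
  rw [moment_iota_mul, moment_succ_crankCube]; simp

theorem moment_euler_mul_crankCube_two :
    moment 2 (iota euler * crankCube) = 6 * phi 1 := by
  rw [moment_iota_mul, moment_succ_crankCube]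
  simp only [Finset.sum_range_succ, Finset.sum_range_zero, Nat.sub_self, moment_zero_crankCube]
  simp only [Nat.choose_zero_right, Nat.choose_self, pow_zero, pow_one, sub_self]
  push_cast
  linear_combination (6 * phi 1) * partSeries_mul_euler

/-- The third differences of `cubeCoeff m` and of its reflection `cubeCoeff (-m - 3)` cancel by the
symmetry z ↦ z⁻¹, so their sum is quadratic in m. For m ≥ n the coefficient of q^n in the reflected
term vanishes, and the other is fixed by the moments 1, 0 and 6 `phi 1` of `euler` times
`crankCube`. -/
theorem two_mul_cubeCoeff_add (m : ℤ) :
    2 * (cubeCoeff m + cubeCoeff (-m - 3)) = (((m + 1) * (m + 2) : ℤ) : ℤ⟦X⟧) + 6 * phi 1 := by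
  ext n
  have h2 : (2 : ℤ⟦X⟧) = C 2 := by simp
  have h6 : (6 : ℤ⟦X⟧) = C 6 := by simp
  have h3 : (3 : ℤ⟦X⟧) = C 3 := by simp
  have hc : (((m + 1) * (m + 2) : ℤ) : ℤ⟦X⟧) = C ((m + 1) * (m + 2)) := by simp
  rw [hc, h2, h6, coeff_C_mul, map_add, map_add, coeff_C_mul, ← sub_eq_zero]
  have hβ : ∀ m, coeff n (cubeCoeff m) - 3 * coeff n (cubeCoeff (m - 1))
      + 3 * coeff n (cubeCoeff (m - 2)) - coeff n (cubeCoeff (m - 3))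
      = coeff n (zcoeff m (iota euler * crankCube)) := by
    intro m
    rw [zcoeff_crankCube, map_sub, map_add, map_sub, h3, coeff_C_mul, coeff_C_mul]
  have hconst : ∀ a : ℤ, coeff n (C a : ℤ⟦X⟧) = a * coeff n (1 : ℤ⟦X⟧) := by
    intro a; rw [← coeff_C_mul, mul_one]
  refine eq_zero_of_third_difference_of_ge (d := fun m => 2 * (coeff n (cubeCoeff m)
    + coeff n (cubeCoeff (-m - 3))) - (coeff n (C ((m + 1) * (m + 2)) : ℤ⟦X⟧)
        + 6 * coeff n (phi 1)))
    (a := n) (fun m => ?_) (fun m hm => ?_) m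
  · have h4 := hβ m
    have h5 := hβ (-m)
    rw [zcoeff_neg_crankCube] at h5
    simp only [hconst]
    rw [show -(m - 1) - 3 = -m - 2 by ring, show -(m - 2) - 3 = -m - 1 by ring,
      show -(m - 3) - 3 = -m by ring]
    linear_combination 2 * h4 - 2 * h5
  · have h4 := two_mul_eq_of_third_difference hβ (fun m hm => coeff_cubeCoeff_eq_zero hm)
      (fun m hm => coeff_zcoeff_crankCube_eq_zero hm) hm
    have hm0 := coeff_moment_eq_sum 0 n (iota euler * crankCube) (Finset.Icc (-n : ℤ) n)
      (fun m hm => coeff_zcoeff_crankCube_eq_zero hm)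
    have hm1 := coeff_moment_eq_sum 1 n (iota euler * crankCube) (Finset.Icc (-n : ℤ) n)
      (fun m hm => coeff_zcoeff_crankCube_eq_zero hm)
    have hm2 := coeff_moment_eq_sum 2 n (iota euler * crankCube) (Finset.Icc (-n : ℤ) n)
      (fun m hm => coeff_zcoeff_crankCube_eq_zero hm)
    simp only [pow_zero, one_mul, pow_one] at hm0 hm1
    rw [← hm0, ← hm1, ← hm2, moment_euler_mul_crankCube_zero, moment_euler_mul_crankCube_one,
      moment_euler_mul_crankCube_two, h6, coeff_C_mul, map_zero] at h4
    rw [coeff_cubeCoeff_eq_zero (m := -m - 3) (by omega), hconst]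
    linear_combination h4

end CubeCoeff

/-! ### Generating functions of weighted partitions. -/

section WeightedPartitions

variable {S : Type*} [CommRing S]

/-- The generating series of partitions, each weighted by the product of the weights of its
parts. -/
noncomputable def weightSeries (w : ℕ → S) : S⟦X⟧ :=
  PowerSeries.mk fun n => ∑ p : n.Partition, (p.parts.map w).prod

theorem weightSeries_eq_genFun (w : ℕ → S) :
    weightSeries w = Nat.Partition.genFun fun i c => w i ^ c := by
  ext n
  rw [weightSeries, coeff_mk, Nat.Partition.coeff_genFun]
  refine Finset.sum_congr rfl fun p _ => ?_
  rw [Finset.prod_multiset_map_count, Finsupp.prod, Multiset.toFinsupp_support]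
  rfl

-- A criterion free of limits: Y is the generating function as soon as Y ∏ (1 - w_i q^i) is adically
-- close to 1. The offset m lets the finite products begin at a convenient length.
open scoped PowerSeries.WithPiTopology in
theorem weightSeries_eq_of_dvd {w : ℕ → S} {Y : S⟦X⟧} (m : ℕ)
    (hY : ∀ N : ℕ, X ^ N ∣ Y * ∏ i ∈ Finset.range (m + N), (1 - C (w (i + 1)) * X ^ (i + 1)) - 1) :
    weightSeries w = Y := by
  let : TopologicalSpace S := ⊥
  have : DiscreteTopology S := ⟨rfl⟩
  rw [weightSeries_eq_genFun]
  set f : ℕ → ℕ → S := fun i c => w i ^ c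
  have hu : ∀ i : ℕ, (1 - C (w (i + 1)) * X ^ (i + 1)) *
      (1 + ∑' j, f (i + 1) (j + 1) • (X : S⟦X⟧) ^ ((i + 1) * (j + 1))) = 1 := by
    intro i
    set y : S⟦X⟧ := C (w (i + 1)) * X ^ (i + 1) with hy
    have h0 : y.constantCoeff = 0 := by simp [hy]
    have h1 := WithPiTopology.one_sub_mul_tsum_pow_of_constantCoeff_eq_zero h0
    have h2 := (WithPiTopology.summable_pow_of_constantCoeff_eq_zero h0).tsum_eq_zero_add
    rw [h2, pow_zero] at h1
    rw [← h1]
    congr 3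
    ext1 j
    rw [hy, mul_pow, ← pow_mul, smul_eq_C_mul, map_pow]
  have hprod := Nat.Partition.hasProd_genFun f
  rw [HasProd, WithPiTopology.tendsto_iff_coeff_tendsto] at hprod
  ext n
  have hn := (hprod n).comp Filter.tendsto_finset_range
  rw [nhds_discrete, Filter.tendsto_pure] at hn
  obtain ⟨N, hN⟩ := Filter.eventually_atTop.1 hn
  -- The length passes N, so that coefficient n of the partial product has stabilised, and is at
  -- least m + n + 1, so that `hY` controls degree n.
  have h1 := hN (m + (n + 1 + N)) (by omega)
  simp only [Function.comp_apply] at h1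
  rw [← h1]
  have h2 := (pow_dvd_pow X (Nat.le_add_right (n + 1) N)).trans (hY (n + 1 + N))
  set u := ∏ i ∈ Finset.range (m + (n + 1 + N)),
    (1 + ∑' j, f (i + 1) (j + 1) • (X : S⟦X⟧) ^ ((i + 1) * (j + 1))) with hu_def
  have h3 : (∏ i ∈ Finset.range (m + (n + 1 + N)), (1 - C (w (i + 1)) * X ^ (i + 1))) * u = 1 := by
    rw [hu_def, ← Finset.prod_mul_distrib]
    exact Finset.prod_eq_one fun i _ => hu i
  have h4 := h2.mul_right u
  have h5 : (Y * ∏ i ∈ Finset.range (m + (n + 1 + N)), (1 - C (w (i + 1)) * X ^ (i + 1)) - 1) * u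
      = Y - u := by
    linear_combination Y * h3
  rw [h5, PowerSeries.X_pow_dvd_iff] at h4
  have := h4 n (by omega)
  rw [map_sub, sub_eq_zero] at this
  exact this.symm

end WeightedPartitions

theorem coeff_partSeries (n : ℕ) : coeff n partSeries = (Fintype.card n.Partition : ℤ) := by
  have h : weightSeries (fun _ => (1 : ℤ)) = partSeries := by
    refine weightSeries_eq_of_dvd 0 fun N => ?_
    have h1 : ∏ i ∈ Finset.range (0 + N), (1 - C (1 : ℤ) * X ^ (i + 1)) = qpoch N := by
      rw [zero_add, qpoch]; simp
    rw [h1]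
    have h2 := ((pow_dvd_pow X (Nat.le_succ N)).trans
      (X_pow_dvd_euler_sub_qpoch N)).mul_left partSeries
    rw [mul_sub, partSeries_mul_euler] at h2
    rwa [← neg_sub, dvd_neg]
  rw [← h, weightSeries, coeff_mk]
  simp

/-! ### Partitions without ones, by largest part. -/

section NoOnes

theorem one_sub_mul_prod_eq_qpoch (K : ℕ) (hK : 1 ≤ K) (M : ℕ) : (1 - X) *
    ∏ i ∈ Finset.range (K + M),
      (1 - C (if 2 ≤ i + 1 ∧ i + 1 ≤ K then (1 : ℤ) else 0) * X ^ (i + 1)) = qpoch K := by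
  obtain ⟨k, rfl⟩ := Nat.exists_eq_add_of_le' hK
  rw [Finset.prod_range_add, Finset.prod_range_succ', qpoch, Finset.prod_range_succ']
  have h1 : ∏ x ∈ Finset.range M, ((1 : ℤ⟦X⟧) - C (if 2 ≤ k + 1 + x + 1 ∧ k + 1 + x + 1 ≤ k + 1
      then (1 : ℤ) else 0) * X ^ (k + 1 + x + 1)) = 1 := by
    refine Finset.prod_eq_one fun i _ => ?_
    rw [if_neg (by omega)]; simp
  have h2 : ∏ i ∈ Finset.range k, ((1 : ℤ⟦X⟧) - C (if 2 ≤ i + 1 + 1 ∧ i + 1 + 1 ≤ k + 1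
      then (1 : ℤ) else 0) * X ^ (i + 1 + 1)) = ∏ i ∈ Finset.range k, (1 - X ^ (i + 1 + 1)) := by
    refine Finset.prod_congr rfl fun i hi => ?_
    have := Finset.mem_range.1 hi
    rw [if_pos (by omega)]; simp
  rw [h1, h2, if_neg (by omega)]
  simp
  ring

theorem weightSeries_le (K : ℕ) (hK : 1 ≤ K) :
    weightSeries (fun i => if 2 ≤ i ∧ i ≤ K then (1 : ℤ) else 0) = (1 - X) * invQpoch K := by
  refine weightSeries_eq_of_dvd K fun N => ?_
  have h1 := one_sub_mul_prod_eq_qpoch K hK N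
  have h2 := qpoch_mul_invQpoch K
  rw [← h1] at h2
  rw [show ∀ y : ℤ⟦X⟧, (1 - X) * invQpoch K * y - 1 = ((1 - X) * y) * invQpoch K - 1 by
    intro y; ring, h2, sub_self]
  exact dvd_zero _

theorem prod_map_ite_one {S : Type*} [CommRing S] (s : Multiset ℕ) (q : ℕ → Prop)
    [DecidablePred q] :
    (s.map fun i => if q i then (1 : S) else 0).prod = if ∀ i ∈ s, q i then 1 else 0 := by
  induction s using Multiset.induction with
  | empty => simp
  | cons a s ih =>
    rw [Multiset.map_cons, Multiset.prod_cons, ih]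
    simp only [Multiset.mem_cons, forall_eq_or_imp]
    split_ifs <;> simp_all

open PartitionStat in
/-- The number of partitions of `n` without ones and with largest part `K`. -/
theorem card_ones_eq_zero_largestPart (n K : ℕ) :
    (((Finset.univ.filter fun p : n.Partition => ones p = 0 ∧ largestPart p = K).card : ℕ) : ℤ)
      = coeff n ((1 - X) * (invQpoch K * X ^ K))
        + (if n = 1 then (if K = 0 then 1 else 0) - (if K = 1 then 1 else 0) else 0) := by
  have hle : ∀ K : ℕ, 1 ≤ K → (((Finset.univ.filter fun p : n.Partition =>
      ones p = 0 ∧ largestPart p ≤ K).card : ℕ) : ℤ) = coeff n ((1 - X) * invQpoch K) := by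
    intro K hK
    rw [← weightSeries_le K hK, weightSeries, coeff_mk, Finset.card_filter, Nat.cast_sum]
    refine Finset.sum_congr rfl fun p _ => ?_
    rw [prod_map_ite_one]
    push_cast
    refine if_congr ?_ rfl rfl
    rw [ones, Multiset.count_eq_zero, largestPart, Multiset.sup_le]
    constructor
    · rintro ⟨h1, h2⟩ i hi
      have := p.parts_pos hi
      have : i ≠ 1 := by rintro rfl; exact h1 hi
      exact ⟨by omega, h2 i hi⟩
    · intro h
      exact ⟨fun h1 => by have := h 1 h1; omega, fun i hi => (h i hi).2⟩
  have hzero : (((Finset.univ.filter fun p : n.Partition =>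
      ones p = 0 ∧ largestPart p = 0).card : ℕ) : ℤ) = if n = 0 then 1 else 0 := by
    have hp : ∀ p : n.Partition, largestPart p = 0 ↔ n = 0 := by
      intro p
      constructor
      · intro h
        have h1 : p.parts = 0 := by
          refine Multiset.eq_zero_of_forall_notMem fun a ha => ?_
          have := p.parts_pos ha
          have h2 : a ≤ p.parts.sup := Multiset.le_sup ha
          rw [largestPart] at h
          omega
        rw [← p.parts_sum, h1, Multiset.sum_zero]
      · rintro rfl; simp [largestPart]
    split_ifs with h
    · subst h
      rw [Finset.filter_true_of_mem]
      · simp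
      · intro p _; exact ⟨by simp [ones], (hp p).2 rfl⟩
    · rw [Finset.filter_false_of_mem]
      · simp
      · intro p _ h1; exact h ((hp p).1 h1.2)
  have ha1 : (1 - X) * invQpoch 1 = 1 := by
    have := invQpoch_succ_mul 0
    rw [invQpoch_zero, zero_add, pow_one] at this
    linear_combination this
  have hsub : ∀ K, (((Finset.univ.filter fun p : n.Partition =>
      ones p = 0 ∧ largestPart p = K + 1).card : ℕ) : ℤ)
      = (((Finset.univ.filter fun p : n.Partition => ones p = 0 ∧ largestPart p ≤ K
          + 1).card : ℕ) : ℤ)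
        - ((Finset.univ.filter fun p : n.Partition => ones p
            = 0 ∧ largestPart p ≤ K).card : ℕ) := by
    intro K
    rw [eq_sub_iff_add_eq, ← Nat.cast_add, ← Finset.card_union_of_disjoint]
    · congr 2
      ext p
      simp only [Finset.mem_union, Finset.mem_filter, Finset.mem_univ, true_and]
      rw [← and_or_left]
      exact and_congr_right fun _ => by omega
    · rw [Finset.disjoint_filter]
      intro p _ h1 h2
      omega
  -- The correction at n = 1 comes from K = 0, where the series is 1 - q instead of 1, and from K =
  -- 1, where it is q instead of 0. For larger K the count is a difference of two counts with
  -- bounded largest part.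
  rcases K with _ | _ | K
  · rw [hzero, invQpoch_zero, pow_zero, one_mul, mul_one, map_sub, coeff_one, coeff_X]
    split_ifs <;> simp_all
  · have h0 : ∀ p : n.Partition, largestPart p ≤ 0 ↔ largestPart p = 0 := fun p => Nat.le_zero
    rw [hsub, hle _ le_rfl]
    simp only [h0]
    rw [hzero, zero_add, ha1, pow_one, ← mul_assoc, ha1, one_mul, coeff_one, coeff_X]
    split_ifs <;> simp_all
  · rw [hsub, hle _ (by omega), hle _ (by omega), ← map_sub]
    have : (1 - X) * invQpoch (K + 1 + 1) - (1 - X) * invQpoch (K + 1)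
        = (1 - X) * (invQpoch (K + 1 + 1) * X ^ (K + 1 + 1)) := by
      rw [← invQpoch_succ_mul (K + 1)]; ring
    rw [this]
    simp

end NoOnes

/-! ### The q-binomial theorem at a = zq. -/

section QBinomial

/-- The product of `1 - z q ^ l` over `1 ≤ l ≤ j`. -/
noncomputable def zpoch (j : ℕ) : LSeries := ∏ l ∈ Finset.range j, (1 - zpow 1 * X ^ (l + 1))

theorem zpoch_succ (j : ℕ) : zpoch (j + 1) = zpoch j * (1 - zpow 1 * X ^ (j + 1)) :=
  Finset.prod_range_succ _ _

/-- The terms of the series in the `q`-binomial theorem at `a = z q`, `t = z⁻¹ q ^ (k + 1)`. -/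
noncomputable def binTerm (k j : ℕ) : LSeries :=
  X ^ (k * j) * (iota (invQpoch j) * ((zpow (-1) * X) ^ j * zpoch j))

theorem X_pow_dvd_binTerm (k j : ℕ) : X ^ ((k + 1) * j) ∣ binTerm k j := by
  rw [binTerm, mul_pow, show (X : LSeries) ^ (k * j) * (iota (invQpoch j) *
    (zpow (-1) ^ j * X ^ j * zpoch j)) = X ^ ((k + 1) * j) * (iota (invQpoch j) *
    (zpow (-1) ^ j * zpoch j)) by ring]
  exact dvd_mul_right _ _

theorem X_pow_dvd_binTerm' (k j : ℕ) : X ^ j ∣ binTerm k j :=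
  (pow_dvd_pow X (Nat.le_mul_of_pos_left j k.succ_pos)).trans (X_pow_dvd_binTerm k j)

theorem binTerm_succ_left (k j : ℕ) : binTerm (k + 1) j = X ^ j * binTerm k j := by
  rw [binTerm, binTerm]; ring

theorem zpow_mul_zpow_neg : zpow 1 * zpow (-1) = 1 := by
  rw [← zpow_add]; simp [zpow_zero]

theorem binTerm_succ_right (k K : ℕ) : binTerm k (K + 1) * (1 - X ^ (K + 1))
    = (1 - zpow 1 * X ^ (K + 1)) * (zpow (-1) * X) * X ^ k * binTerm k K := by
  rw [binTerm, binTerm, ← invQpoch_succ_mul K, zpoch_succ, map_mul, map_sub, map_one, map_pow,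
    iota_X]
  ring

/-- The equation (1 - t) f(t) = (1 - a t) f(tq) for partial sums, where a t = q^(k+2) because z z⁻¹
cancels. All terms telescope except one boundary term, which tends to zero. -/
theorem binTerm_partial_sum (k K : ℕ) :
    (1 - zpow (-1) * X * X ^ k) * ∑ j ∈ Finset.range (K + 1), binTerm k j
      - (1 - X ^ (k + 2)) * ∑ j ∈ Finset.range (K + 1), binTerm (k + 1) j
      = -((1 - zpow 1 * X ^ (K + 1)) * (zpow (-1) * X) * X ^ k * binTerm k K) := by
  induction K with
  | zero =>
    have h : ∀ k, binTerm k 0 = 1 := by intro k; simp [binTerm, zpoch]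
    simp only [zero_add, Finset.sum_range_one, h]
    linear_combination (-X ^ (k + 2)) * zpow_mul_zpow_neg
  | succ K ih =>
    have h := binTerm_succ_right k K
    rw [Finset.sum_range_succ, Finset.sum_range_succ (fun j => binTerm (k + 1) j),
      binTerm_succ_left k (K + 1)]
    linear_combination ih + h - X ^ (K + 2 + 1 + k) * binTerm k (K + 1) * zpow_mul_zpow_neg

/-- The series in the `q`-binomial theorem at `a = z q`, `t = z⁻¹ q ^ (k + 1)`. -/
noncomputable def binSeries (k : ℕ) : LSeries := qsum (binTerm k)

theorem hasQSum_binSeries (k : ℕ) : HasQSum (binTerm k) (binSeries k) :=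
  hasQSum_qsum (X_pow_dvd_binTerm' k)

theorem binSeries_functional (k : ℕ) :
    (1 - zpow (-1) * X * X ^ k) * binSeries k = (1 - X ^ (k + 2)) * binSeries (k + 1) := by
  apply eq_of_forall_X_pow_dvd_sub
  intro K
  have h1 := (hasQSum_binSeries k (K + 1)).mul_left (1 - zpow (-1) * X * X ^ k)
  have h2 := (hasQSum_binSeries (k + 1) (K + 1)).mul_left (1 - X ^ (k + 2))
  have h3 := binTerm_partial_sum k K
  have h4 : (X : LSeries) ^ (K + 1) ∣
      (1 - zpow 1 * X ^ (K + 1)) * (zpow (-1) * X) * X ^ k * binTerm k K := by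
    refine dvd_trans (dvd_of_eq (pow_succ' X K)) ?_
    rw [show (1 - zpow 1 * X ^ (K + 1)) * (zpow (-1) * X) * X ^ k * binTerm k K
      = X * ((1 - zpow 1 * X ^ (K + 1)) * zpow (-1) * X ^ k * binTerm k K) by ring]
    exact mul_dvd_mul_left X ((X_pow_dvd_binTerm' k K).mul_left _)
  refine (pow_dvd_pow X (Nat.le_succ K)).trans ?_
  have h5 := dvd_sub (dvd_sub h1 h2) h4
  convert h5 using 1
  linear_combination h3

theorem binSeries_iterate (K : ℕ) :
    (∏ l ∈ Finset.range K, (1 - zpow (-1) * X * X ^ l)) * ((1 - X) * binSeries 0)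
      = iota (qpoch (K + 1)) * binSeries K := by
  induction K with
  | zero => simp [qpoch]
  | succ K ih =>
    rw [Finset.prod_range_succ, qpoch_succ, map_mul, map_sub, map_one, map_pow, iota_X]
    linear_combination (1 - zpow (-1) * X * X ^ K) * ih
      + iota (qpoch (K + 1)) * binSeries_functional K

theorem tau_rescale_pow_eulerG (e : ℤ) (k : ℕ) : tau e (rescale (X ^ k) eulerG)
    = (∏ l ∈ Finset.range k, (1 - zpow e * X * X ^ l)) * tau e eulerG := by
  rw [rescale_pow_eulerG, map_mul, map_prod]
  congr 1
  refine Finset.prod_congr rfl fun l _ => ?_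
  rw [map_sub, map_one, map_mul, tau_C, tau_X, map_pow, iota_X]; ring

theorem X_pow_dvd_tau_rescale (e : ℤ) (k : ℕ) :
    X ^ (k + 1) ∣ tau e (rescale (X ^ k) eulerG) - 1 := by
  have := X_pow_dvd_evalHom_rescale iota iota_X
    (show (X : LSeries) ∣ zpow e * X from Dvd.intro_left _ rfl) eulerG k
  rwa [eulerG, coeff_mk, invQpoch_zero, map_one] at this

/-- Both sides are multiplied by the unit ∏ (1 - z⁻¹ q^(l+1)) over l < K. Then `binSeries_iterate`
on one side and the functional equation of `eulerG` on the other leave factors congruent to 1 modulo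
q^K. The factor 1 - X completes the product from q² to Euler's product. -/
theorem binSeries_zero : (1 - X) * binSeries 0 = iota euler * tau (-1) eulerG := by
  apply eq_of_forall_X_pow_dvd_sub
  intro K
  have hunit : IsUnit (∏ l ∈ Finset.range K, (1 - zpow (-1) * X * X ^ l)) := by
    rw [PowerSeries.isUnit_iff_constantCoeff, map_prod]
    simp
  rw [← hunit.dvd_mul_left, mul_sub, binSeries_iterate]
  have h1 := tau_rescale_pow_eulerG (-1) K
  have h2 := (pow_dvd_pow X (Nat.le_succ K)).trans (X_pow_dvd_tau_rescale (-1) K)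
  have h3 : X ^ K ∣ binSeries K - 1 := by
    have h4 := hasQSum_binSeries K (K + 1)
    rw [Finset.sum_range_succ'] at h4
    have h5 : (X : LSeries) ^ K ∣ ∑ j ∈ Finset.range K, binTerm K (j + 1) := by
      refine Finset.dvd_sum fun j _ => ?_
      exact (pow_dvd_pow X (by nlinarith)).trans (X_pow_dvd_binTerm K (j + 1))
    have h6 := dvd_add ((pow_dvd_pow X (Nat.le_succ K)).trans h4) h5
    convert h6 using 1
    have : binTerm K 0 = 1 := by simp [binTerm, zpoch]
    rw [this]; ring
  have h7 : (X : LSeries) ^ K ∣ iota euler - iota (qpoch (K + 1)) := by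
    obtain ⟨c, hc⟩ := X_pow_dvd_euler_sub_qpoch (K + 1)
    rw [← map_sub, hc, map_mul, map_pow, iota_X]
    exact (pow_dvd_pow X (by omega)).mul_right _
  have h8 := dvd_sub (dvd_sub (h3.mul_left (iota (qpoch (K + 1))))
    (h2.mul_left (iota euler))) h7
  convert h8 using 1
  rw [h1]
  ring

end QBinomial

/-! ### The crank generating function. -/

section CrankGenerating

/-- The terms in the expansion of the crank product by the number of ones. -/
noncomputable def crankTerm (j : ℕ) : LSeries :=
  zpow (-j) * X ^ j * (iota ((1 - X) * invQpoch j) * tau 1 (rescale (X ^ j) eulerG))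

theorem crankTerm_eq (j : ℕ) :
    crankTerm j = (iota (1 - X) * tau 1 eulerG) * binTerm 0 j := by
  rw [crankTerm, binTerm, tau_rescale_pow_eulerG, mul_pow, zpow_pow, zpoch, map_mul]
  have : ∏ l ∈ Finset.range j, (1 - zpow 1 * X * X ^ l)
      = ∏ l ∈ Finset.range j, (1 - zpow 1 * X ^ (l + 1)) :=
    Finset.prod_congr rfl fun l _ => by ring
  rw [this]
  simp only [mul_neg, mul_one, zero_mul, pow_zero]
  ring

theorem hasQSum_crankTerm : HasQSum crankTerm crankProd := by
  have h := (hasQSum_binSeries 0).mul_left (iota (1 - X) * tau 1 eulerG)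
  simp only [← crankTerm_eq] at h
  have h2 : iota (1 - X) * tau 1 eulerG * binSeries 0 = crankProd := by
    have := binSeries_zero
    rw [crankProd, map_sub, map_one, iota_X]
    linear_combination tau 1 eulerG * this
  rwa [h2] at h

/-- Partitions without ones, weighted by `z` to the number of parts larger than `j`. -/
theorem weightSeries_no_ones (j : ℕ) (hj : 1 ≤ j) :
    weightSeries (fun i => if 2 ≤ i then (if i ≤ j then 1 else LaurentPolynomial.T 1) else 0)
      = iota ((1 - X) * invQpoch j) * tau 1 (rescale (X ^ j) eulerG) := by
  refine weightSeries_eq_of_dvd j fun M => ?_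
  have h1 : (1 - X) * ∏ i ∈ Finset.range (j + M), ((1 : LSeries) -
      C (if 2 ≤ i + 1 then (if i + 1 ≤ j then 1 else LaurentPolynomial.T 1) else 0) * X ^ (i + 1))
      = iota (qpoch j) * ∏ l ∈ Finset.range M, (1 - zpow 1 * X * X ^ (j + l)) := by
    obtain ⟨k, rfl⟩ := Nat.exists_eq_add_of_le' hj
    rw [Finset.prod_range_add, Finset.prod_range_succ', qpoch, Finset.prod_range_succ', map_mul,
      map_prod]
    have h2 : ∏ x ∈ Finset.range M, ((1 : LSeries) - C (if 2 ≤ k + 1 + x + 1 then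
        (if k + 1 + x + 1 ≤ k + 1 then 1 else LaurentPolynomial.T 1) else 0) * X ^ (k + 1 + x + 1))
        = ∏ l ∈ Finset.range M, (1 - zpow 1 * X * X ^ (k + 1 + l)) := by
      refine Finset.prod_congr rfl fun i _ => ?_
      rw [if_pos (by omega), if_neg (by omega), zpow]; ring
    have h3 : ∏ i ∈ Finset.range k, ((1 : LSeries) - C (if 2 ≤ i + 1 + 1 then
        (if i + 1 + 1 ≤ k + 1 then 1 else LaurentPolynomial.T 1) else 0) * X ^ (i + 1 + 1))
        = ∏ i ∈ Finset.range k, iota (1 - X ^ (i + 1 + 1)) := by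
      refine Finset.prod_congr rfl fun i hi => ?_
      have := Finset.mem_range.1 hi
      rw [if_pos (by omega), if_pos (by omega)]; simp
    rw [h2, h3, if_neg (by omega)]
    simp
    ring
  have h2 := tau_rescale_pow_eulerG 1 (j + M)
  rw [Finset.prod_range_add] at h2
  have h3 := tau_rescale_pow_eulerG 1 j
  have h4 := X_pow_dvd_tau_rescale 1 (j + M)
  have h5 : iota (qpoch j) * iota (invQpoch j) = 1 := by
    rw [← map_mul, qpoch_mul_invQpoch, map_one]
  refine (pow_dvd_pow X (show M ≤ j + M + 1 by omega)).trans ?_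
  convert h4 using 1
  rw [h2, h3, map_mul, map_sub, map_one, iota_X]
  linear_combination (iota (invQpoch j) * (∏ l ∈ Finset.range j, (1 - zpow 1 * X * X ^ l))
    * tau 1 eulerG) * h1 + ((∏ l ∈ Finset.range j, (1 - zpow 1 * X * X ^ l)) * tau 1 eulerG
    * ∏ l ∈ Finset.range M, (1 - zpow 1 * X * X ^ (j + l))) * h5

end CrankGenerating

open PartitionStat

theorem largestPart_le {n : ℕ} (p : n.Partition) : largestPart p ≤ n :=
  Multiset.sup_le.2 fun _ ha => Nat.Partition.le_of_mem_parts ha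

/-- The term is (1 - q) G(zq), whose coefficient of z^K counts partitions without ones and with
largest part K, which is their crank, apart from the discrepancy at n = 1. -/
theorem coeff_crankTerm_zero (n : ℕ) : coeff n (crankTerm 0)
    = ∑ p : n.Partition with ones p = 0, LaurentPolynomial.T (crank p)
      + if n = 1 then LaurentPolynomial.T 1 - LaurentPolynomial.T 0 else 0 := by
  have h1 : crankTerm 0 = iota (1 - X) * tau 1 eulerG := by simp [crankTerm, zpow_zero]
  rw [h1, ((hasQSum_tau 1 eulerG).mul_left (iota (1 - X))).coeff_eq]
  have h2 : ∑ p : n.Partition with ones p = 0, (LaurentPolynomial.T (crank p) : LaurentPolynomial ℤ)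
      = ∑ K ∈ Finset.range (n + 1), LaurentPolynomial.C ((Finset.univ.filter fun p : n.Partition =>
        ones p = 0 ∧ largestPart p = K).card : ℤ) * LaurentPolynomial.T (K : ℤ) := by
    rw [← Finset.sum_fiberwise_of_maps_to (g := fun p : n.Partition => largestPart p)
      (t := Finset.range (n + 1))
      (fun p _ => Finset.mem_range.2 (Nat.lt_succ_of_le (largestPart_le p)))]
    refine Finset.sum_congr rfl fun K _ => ?_
    rw [Finset.filter_filter, Finset.sum_congr rfl (g := fun _ => LaurentPolynomial.T (K : ℤ))]
    · rw [Finset.sum_const, nsmul_eq_mul]; simp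
    · intro p hp
      obtain ⟨hp1, hp2⟩ := (Finset.mem_filter.1 hp).2
      rw [crank, if_pos hp1, hp2]
  have h3 : (if n = 1 then LaurentPolynomial.T 1 - LaurentPolynomial.T 0 else 0 :
      LaurentPolynomial ℤ) = ∑ K ∈ Finset.range (n + 1), LaurentPolynomial.C
        (if n = 1 then (if K = 1 then 1 else 0) - (if K = 0 then 1 else 0) else 0 : ℤ)
          * LaurentPolynomial.T (K : ℤ) := by
    split_ifs with hn
    · subst hn
      simp [Finset.sum_range_succ]; ring
    · simp
  rw [h2, h3, ← Finset.sum_add_distrib]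
  refine Finset.sum_congr rfl fun K _ => ?_
  rw [← mul_assoc, ← map_mul, zpow, coeff_mul_C, iota, coeff_map, eulerG, coeff_mk, mul_one,
    ← add_mul, ← map_add, card_ones_eq_zero_largestPart]
  congr 2
  split_ifs <;> ring

/-- Removing all ones from a partition. -/
theorem sum_ones_eq (n j : ℕ) (f : Multiset ℕ → LaurentPolynomial ℤ)
    (hf : ∀ s : Multiset ℕ, f (s + Multiset.replicate j 1) = f s) :
    ∑ p : (n + j).Partition with ones p = j, f p.parts
      = ∑ p : n.Partition with ones p = 0, f p.parts := by
  symm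
  refine Finset.sum_bij (fun p _ => (⟨p.parts + Multiset.replicate j 1, ?_, ?_⟩ :
    (n + j).Partition)) ?_ ?_ ?_ ?_
  · intro i hi
    rcases Multiset.mem_add.1 hi with h | h
    · exact p.parts_pos h
    · rw [Multiset.eq_of_mem_replicate h]; exact one_pos
  · rw [Multiset.sum_add, p.parts_sum]; simp
  · intro p hp
    have hp' := (Finset.mem_filter.1 hp).2
    refine Finset.mem_filter.2 ⟨Finset.mem_univ _, ?_⟩
    rw [ones] at hp' ⊢
    simp only [Multiset.count_add, hp', Multiset.count_replicate_self, zero_add]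
  · intro p _ r _ h
    have h1 := congrArg Nat.Partition.parts h
    exact Nat.Partition.ext (add_right_cancel h1)
  · intro p hp
    have hp' := (Finset.mem_filter.1 hp).2
    have hle : Multiset.replicate j 1 ≤ p.parts := Multiset.le_count_iff_replicate_le.1 hp'.ge
    have hadd : p.parts - Multiset.replicate j 1 + Multiset.replicate j 1 = p.parts :=
      tsub_add_cancel_of_le hle
    refine ⟨⟨p.parts - Multiset.replicate j 1, fun {i} hi => ?_, ?_⟩, ?_, ?_⟩
    · exact p.parts_pos (Multiset.mem_of_le (Multiset.sub_le_self _ _) hi)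
    · have h1 := congrArg Multiset.sum hadd
      rw [Multiset.sum_add, p.parts_sum] at h1
      simpa using h1
    · refine Finset.mem_filter.2 ⟨Finset.mem_univ _, ?_⟩
      rw [ones] at hp' ⊢
      simp only [Multiset.count_sub, hp', Multiset.count_replicate_self, Nat.sub_self]
    · exact Nat.Partition.ext hadd
  · intro p _
    exact (hf _).symm

theorem prod_map_weight (j : ℕ) (s : Multiset ℕ) (hs : ∀ i ∈ s, 0 < i) :
    (s.map fun i => if 2 ≤ i then (if i ≤ j then 1 else LaurentPolynomial.T 1) else
      (0 : LaurentPolynomial ℤ)).prod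
      = if s.count 1 = 0 then LaurentPolynomial.T (s.countP (fun a => j < a) : ℤ) else 0 := by
  induction s using Multiset.induction with
  | empty => simp
  | cons a s ih =>
    rw [Multiset.map_cons, Multiset.prod_cons, ih fun i hi => hs i (Multiset.mem_cons_of_mem hi),
      Multiset.count_cons, Multiset.countP_cons]
    have ha := hs a (Multiset.mem_cons_self a s)
    by_cases h1 : a = 1
    · subst h1; simp
    · rw [if_pos (show 2 ≤ a by omega), if_neg (Ne.symm h1), add_zero]
      by_cases h2 : a ≤ j
      · rw [if_pos h2, if_neg (show ¬ j < a by omega), one_mul, add_zero]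
      · rw [if_neg h2, if_pos (show j < a by omega)]
        split_ifs
        · rw [← LaurentPolynomial.T_add]; congr 1; push_cast; ring
        · rw [mul_zero]

/-- Since j ≥ 1, deleting the j ones changes neither the number of parts above j nor the
contribution z^(-j), so the weighted count of partitions without ones applies after dividing by q^j.
-/
theorem coeff_crankTerm_succ (n j : ℕ) (hj : 1 ≤ j) : coeff n (crankTerm j)
    = ∑ p : n.Partition with ones p = j, LaurentPolynomial.T (crank p) := by
  rw [crankTerm, ← weightSeries_no_ones j hj, zpow, mul_assoc, coeff_C_mul, coeff_X_pow_mul']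
  split_ifs with hn
  · obtain ⟨m, rfl⟩ := Nat.exists_eq_add_of_le' hn
    rw [Nat.add_sub_cancel, weightSeries, coeff_mk, Finset.mul_sum]
    have h1 := sum_ones_eq m j (fun s => LaurentPolynomial.T (s.countP (fun a => j < a) - j : ℤ))
      (fun s => by
        simp only [Multiset.countP_add]
        have hr : (Multiset.replicate j 1).countP (fun a => j < a) = 0 :=
          Multiset.countP_eq_zero.2 fun a ha => by rw [Multiset.eq_of_mem_replicate ha]; omega
        rw [hr, add_zero])
    have h2 : ∑ p : (m + j).Partition with ones p = j,
        (LaurentPolynomial.T (crank p) : LaurentPolynomial ℤ)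
        = ∑ p : (m + j).Partition with ones p = j,
          LaurentPolynomial.T (p.parts.countP (fun a => j < a) - j : ℤ) := by
      refine Finset.sum_congr rfl fun p hp => ?_
      have hp' := (Finset.mem_filter.1 hp).2
      rw [crank, if_neg (by omega), hp']
    rw [h2, h1, Finset.sum_filter]
    refine Finset.sum_congr rfl fun p _ => ?_
    rw [prod_map_weight j _ fun i hi => p.parts_pos hi, ones]
    split_ifs
    · rw [← LaurentPolynomial.T_add]; congr 1; ring
    · rw [mul_zero]
  · rw [mul_zero, Finset.sum_eq_zero]
    intro p hp
    have hp' := (Finset.mem_filter.1 hp).2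
    exfalso
    apply hn
    have hle : Multiset.replicate j 1 ≤ p.parts := Multiset.le_count_iff_replicate_le.1 hp'.ge
    have h1 := congrArg Multiset.sum (tsub_add_cancel_of_le hle)
    rw [Multiset.sum_add, p.parts_sum] at h1
    simp at h1
    omega

/-- The Andrews–Garvan theorem: the crank product generates the crank. -/
theorem coeff_crankProd (n : ℕ) : coeff n crankProd
    = ∑ p : n.Partition, LaurentPolynomial.T (crank p)
      + if n = 1 then LaurentPolynomial.T 1 - LaurentPolynomial.T 0 else 0 := by
  rw [hasQSum_crankTerm.coeff_eq, Finset.sum_range_succ', coeff_crankTerm_zero, ← add_assoc]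
  congr 1
  rw [← Finset.sum_fiberwise_of_maps_to (s := Finset.univ) (g := fun p : n.Partition => ones p)
    (t := Finset.range (n + 1)), Finset.sum_range_succ']
  · congr 1
    exact Finset.sum_congr rfl fun j _ => coeff_crankTerm_succ n (j + 1) (by omega)
  · intro p _
    refine Finset.mem_range.2 (Nat.lt_succ_of_le ?_)
    have hle : Multiset.replicate (ones p) 1 ≤ p.parts :=
      Multiset.le_count_iff_replicate_le.1 le_rfl
    have h1 := congrArg Multiset.sum (tsub_add_cancel_of_le hle)
    rw [Multiset.sum_add, p.parts_sum] at h1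
    simp at h1
    omega

theorem crank_partition_one (p : Nat.Partition 1) : crank p = -1 := by
  simp [crank, ones]
  rfl

/-- At n = 1 the only partition has crank -1, and the correction z - 1 turns z⁻¹ into z⁻¹ + z - 1,
which is the amended convention. -/
theorem crankCount_eq_coeffL (m : ℤ) (n : ℕ) : crankCount m n = coeffL m (coeff n crankProd) := by
  have hT : ∀ k : ℤ, coeffL m (LaurentPolynomial.T k) = if k = m then 1 else 0 := by
    intro k
    have := coeffL_C_mul_T m k 1
    rwa [map_one, one_mul] at this
  rw [coeff_crankProd, map_add, map_sum]
  simp only [hT]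
  rw [crankCount]
  split_ifs with h1 h2 h3
  · subst h1 h2
    rw [map_sub, hT, hT]
    simp [crank_partition_one]
  · subst h1
    rw [map_sub, hT, hT]
    rcases h3 with rfl | rfl <;> simp [crank_partition_one]
  · subst h1
    rw [map_sub, hT, hT]
    simp only [crank_partition_one]
    rw [if_neg (by omega), if_neg (by omega), if_neg (by omega)]; simp
  · rw [map_zero, add_zero, Finset.card_filter]; push_cast; rfl

theorem finsum_mul_coeffL (k : ℕ) (p : LaurentPolynomial ℤ) :
    ∑ᶠ m : ℤ, m ^ k * coeffL m p = momentL k p := by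
  rw [momentL_eq_sum k p p.coeff.support fun m hm => Finsupp.notMem_support_iff.1 hm]
  apply finsum_eq_sum_of_support_subset
  intro m hm
  refine Finsupp.mem_support_iff.2 fun h => hm ?_
  change m ^ k * coeffL m p = 0
  have : coeffL m p = 0 := h
  rw [this, mul_zero]

theorem crankMoment_eq (k n : ℕ) : crankMoment k n = coeff n (moment k crankProd) := by
  rw [crankMoment, moment, coeff_mapAdd, ← finsum_mul_coeffL]
  simp only [crankCount_eq_coeffL]

/-- The generating series of the rank. -/
noncomputable def rankSeries : LSeries :=
  PowerSeries.mk fun n => ∑ p : n.Partition, LaurentPolynomial.T (rank p)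

theorem coeff_zcoeff_rankSeries (m : ℤ) (n : ℕ) : coeff n (zcoeff m rankSeries)
    = rankCount m n := by
  have hT : ∀ k : ℤ, coeffL m (LaurentPolynomial.T k) = if k = m then 1 else 0 := by
    intro k
    have := coeffL_C_mul_T m k 1
    rwa [map_one, one_mul] at this
  rw [zcoeff, coeff_mapAdd, rankSeries, coeff_mk, map_sum, rankCount, Finset.card_filter]
  simp only [hT]
  push_cast; rfl

theorem rankMoment_eq (k n : ℕ) : rankMoment k n = coeff n (moment k rankSeries) := by
  rw [rankMoment, moment, coeff_mapAdd, ← finsum_mul_coeffL]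
  simp only [← coeff_zcoeff_rankSeries, zcoeff, coeff_mapAdd]

/-! ### Removing and adding the first column of a Ferrers diagram. -/

section Columns

/-- Removing the first column of a partition: all parts decrease by one. -/
def removeColumn (s : Multiset ℕ) : Multiset ℕ := (s.map fun a => a - 1).filter (· ≠ 0)

/-- Adding a first column of length `L` to a partition. -/
def addColumn (L : ℕ) (s : Multiset ℕ) : Multiset ℕ :=
  s.map (fun a => a + 1) + Multiset.replicate (L - Multiset.card s) 1

theorem sum_filter_ne_zero (s : Multiset ℕ) : (s.filter (· ≠ 0)).sum = s.sum := by
  induction s using Multiset.induction with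
  | empty => simp
  | cons a s ih =>
    by_cases h : a = 0
    · rw [Multiset.filter_cons_of_neg _ (by simpa using h), ih, h]; simp
    · rw [Multiset.filter_cons_of_pos (p := fun x => x ≠ 0) _ h, Multiset.sum_cons, ih,
        Multiset.sum_cons]

theorem sum_removeColumn {s : Multiset ℕ} (hs : ∀ a ∈ s, 0 < a) :
    (removeColumn s).sum + Multiset.card s = s.sum := by
  rw [removeColumn, sum_filter_ne_zero]
  induction s using Multiset.induction with
  | empty => simp
  | cons a s ih =>
    have := ih fun i hi => hs i (Multiset.mem_cons_of_mem hi)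
    have ha := hs a (Multiset.mem_cons_self a s)
    simp only [Multiset.map_cons, Multiset.sum_cons, Multiset.card_cons]
    omega

theorem card_removeColumn_le (s : Multiset ℕ) :
    Multiset.card (removeColumn s) ≤ Multiset.card s :=
  (Multiset.card_le_card (Multiset.filter_le _ _)).trans (Multiset.card_map _ _).le

theorem mem_removeColumn {s : Multiset ℕ} {b : ℕ} (hb : b ∈ removeColumn s) :
    b ≠ 0 ∧ b + 1 ≤ s.sup := by
  obtain ⟨h1, h2⟩ := Multiset.mem_filter.1 hb
  obtain ⟨a, ha, rfl⟩ := Multiset.mem_map.1 h1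
  have : a ≤ s.sup := Multiset.le_sup ha
  exact ⟨h2, by omega⟩

theorem addColumn_removeColumn {s : Multiset ℕ} (hs : ∀ a ∈ s, 0 < a) :
    addColumn (Multiset.card s) (removeColumn s) = s := by
  induction s using Multiset.induction with
  | empty => simp [addColumn, removeColumn]
  | cons a s ih =>
    have ih' := ih fun i hi => hs i (Multiset.mem_cons_of_mem hi)
    have ha := hs a (Multiset.mem_cons_self a s)
    have hc := card_removeColumn_le s
    rw [addColumn] at ih' ⊢
    by_cases h1 : a = 1
    · have h2 : removeColumn (a ::ₘ s) = removeColumn s := by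
        simp [removeColumn, h1]
      rw [h2, Multiset.card_cons, Nat.succ_sub hc, Multiset.replicate_succ, Multiset.add_cons, ih',
        h1]
    · have h2 : removeColumn (a ::ₘ s) = (a - 1) ::ₘ removeColumn s := by
        rw [removeColumn, Multiset.map_cons, Multiset.filter_cons_of_pos _ (by omega), removeColumn]
      rw [h2, Multiset.card_cons, Multiset.card_cons, Nat.add_sub_add_right, Multiset.map_cons,
        Multiset.cons_add, ih', Nat.sub_add_cancel ha]

theorem removeColumn_addColumn (L : ℕ) {s : Multiset ℕ} (hs : ∀ a ∈ s, 0 < a) :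
    removeColumn (addColumn L s) = s := by
  rw [removeColumn, addColumn, Multiset.map_add, Multiset.filter_add, Multiset.map_map,
    Multiset.map_replicate]
  have h1 : Multiset.filter (· ≠ 0) (Multiset.replicate (L - Multiset.card s) (1 - 1)) = 0 := by
    refine Multiset.filter_eq_nil.2 fun a ha => ?_
    rw [Multiset.eq_of_mem_replicate ha]; simp
  rw [h1, add_zero]
  simp only [Function.comp_def, Nat.add_sub_cancel, Multiset.map_id']
  exact Multiset.filter_eq_self.2 fun a ha => (hs a ha).ne'

theorem card_addColumn {L : ℕ} {s : Multiset ℕ} (h : Multiset.card s ≤ L) :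
    Multiset.card (addColumn L s) = L := by
  rw [addColumn, Multiset.card_add, Multiset.card_map, Multiset.card_replicate]; omega

theorem sum_addColumn {L : ℕ} {s : Multiset ℕ} (h : Multiset.card s ≤ L) :
    (addColumn L s).sum = s.sum + L := by
  rw [addColumn, Multiset.sum_add, Multiset.sum_map_add]
  simp
  omega

theorem mem_addColumn {L : ℕ} {s : Multiset ℕ} {b : ℕ} (hb : b ∈ addColumn L s) :
    0 < b ∧ b ≤ s.sup + 1 := by
  rcases Multiset.mem_add.1 hb with h | h
  · obtain ⟨a, ha, rfl⟩ := Multiset.mem_map.1 h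
    have : a ≤ s.sup := Multiset.le_sup ha
    omega
  · rw [Multiset.eq_of_mem_replicate h]; omega

end Columns

/-! ### Dyson's map and rank recursions. -/

section Dyson

theorem sup_mem_of_ne_zero {s : Multiset ℕ} (hs : s ≠ 0) : s.sup ∈ s := by
  induction s using Multiset.induction with
  | empty => exact absurd rfl hs
  | cons a s ih =>
    rw [Multiset.sup_cons]
    by_cases h : s = 0
    · subst h; simp
    · rcases le_total a s.sup with h1 | h1
      · rw [sup_eq_right.2 h1]; exact Multiset.mem_cons_of_mem (ih h)
      · rw [sup_eq_left.2 h1]; exact Multiset.mem_cons_self _ _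

/-- The new largest part c may be 0. Then `s` is forced to be empty, the filter discards c, and
erasing 0 does nothing, so c is still recovered as the supremum. -/
theorem filter_cons_sup (c : ℕ) (s : Multiset ℕ) (hs : ∀ b ∈ s, b ≠ 0 ∧ b ≤ c) :
    ((c ::ₘ s).filter (· ≠ 0)).sup = c ∧ ((c ::ₘ s).filter (· ≠ 0)).erase c = s := by
  have hself : s.filter (· ≠ 0) = s := Multiset.filter_eq_self.2 fun b hb => (hs b hb).1
  by_cases hc : c = 0
  · subst hc
    have h0 : s = 0 := Multiset.eq_zero_of_forall_notMem fun b hb => by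
      have := hs b hb; omega
    subst h0; simp
  · rw [Multiset.filter_cons_of_pos (p := fun x => x ≠ 0) _ hc, hself]
    refine ⟨?_, Multiset.erase_cons_head _ _⟩
    rw [Multiset.sup_cons, sup_eq_left]
    exact Multiset.sup_le.2 fun b hb => (hs b hb).2

theorem cons_erase_sup_filter {s : Multiset ℕ} (hs : ∀ b ∈ s, 0 < b) :
    (s.sup ::ₘ s.erase s.sup).filter (· ≠ 0) = s := by
  by_cases h : s = 0
  · subst h; simp
  · rw [Multiset.cons_erase (sup_mem_of_ne_zero h)]
    exact Multiset.filter_eq_self.2 fun b hb => (hs b hb).ne'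

/-- The part to be added has size ℓ + r - 1, with ℓ the number of parts. For a nonempty partition
the rank bound makes it at least the largest part minus one; for the empty one it equals n'. -/
theorem dyson_nonneg {n n' : ℕ} {r : ℤ} (h : (n' : ℤ) = n + r - 1) {p : n.Partition}
    (hp : rank p ≤ r) : 0 ≤ (Multiset.card p.parts : ℤ) + r - 1 := by
  rw [rank, largestPart] at hp
  by_cases h0 : p.parts = 0
  · have := p.parts_sum
    rw [h0, Multiset.sum_zero] at this
    rw [h0, Multiset.card_zero]; omega
  · have := p.parts_pos (sup_mem_of_ne_zero h0)
    omega

theorem dyson_inv_nonneg {n n' : ℕ} {r : ℤ} (h : (n' : ℤ) = n + r - 1) {p : n'.Partition}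
    (hp : r - 2 ≤ rank p) : 0 ≤ (largestPart p : ℤ) - r + 1 ∧
      (Multiset.card (p.parts.erase (largestPart p)) : ℤ) ≤ (largestPart p : ℤ) - r + 1 ∧
      (p.parts.erase (largestPart p)).sum + largestPart p = n' := by
  rw [rank] at hp
  by_cases h0 : p.parts = 0
  · have := p.parts_sum
    rw [h0, Multiset.sum_zero] at this
    simp [largestPart, h0]; omega
  · have h1 : largestPart p ∈ p.parts := sup_mem_of_ne_zero h0
    have h2 := Multiset.card_erase_add_one h1
    have h3 := congrArg Multiset.sum (Multiset.cons_erase h1)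
    rw [Multiset.sum_cons, p.parts_sum] at h3
    omega

/-- Dyson's map: remove the first column of a partition and add a new largest part. -/
theorem card_rank_le_eq_card_le_rank {n n' : ℕ} {r : ℤ} (h : (n' : ℤ) = n + r - 1) :
    (Finset.univ.filter fun p : n.Partition => rank p ≤ r).card
      = (Finset.univ.filter fun p : n'.Partition => r - 2 ≤ rank p).card := by
  have hfwd : ∀ p : n.Partition, rank p ≤ r → ∀ b ∈ removeColumn p.parts,
      b ≠ 0 ∧ b ≤ ((Multiset.card p.parts : ℤ) + r - 1).toNat := by
    intro p hp b hb
    obtain ⟨h1, h2⟩ := mem_removeColumn hb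
    have := dyson_nonneg h hp
    rw [rank, largestPart] at hp
    exact ⟨h1, by omega⟩
  -- Deleting the column costs ℓ and the new part adds ℓ + r - 1, so the size becomes n + r - 1. The
  -- image has at most ℓ + 1 parts, so its rank is at least r - 2. Conversely ℓ is recovered as the
  -- largest part minus r plus 1.
  refine Finset.card_bij'
    (fun p hp => (⟨((((Multiset.card p.parts : ℤ) + r - 1).toNat ::ₘ removeColumn p.parts).filter
      (· ≠ 0)), fun {i} hi => Nat.pos_of_ne_zero (Multiset.mem_filter.1 hi).2, ?_⟩ : n'.Partition))
    (fun p hp => (⟨addColumn ((largestPart p : ℤ) - r + 1).toNat (p.parts.erase (largestPart p)),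
      fun {i} hi => (mem_addColumn hi).1, ?_⟩ : n.Partition)) ?_ ?_ ?_ ?_
  · have hp := (Finset.mem_filter.1 hp).2
    have h1 := dyson_nonneg h hp
    have h2 := sum_removeColumn fun a ha => p.parts_pos ha
    rw [p.parts_sum] at h2
    rw [sum_filter_ne_zero, Multiset.sum_cons]
    omega
  · have hp := (Finset.mem_filter.1 hp).2
    obtain ⟨h1, h2, h3⟩ := dyson_inv_nonneg h hp
    rw [sum_addColumn (by omega)]
    omega
  · intro p hp
    have hp := (Finset.mem_filter.1 hp).2
    refine Finset.mem_filter.2 ⟨Finset.mem_univ _, ?_⟩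
    rw [rank, largestPart]
    simp only
    rw [(filter_cons_sup _ _ (hfwd p hp)).1]
    have h1 := dyson_nonneg h hp
    have h2 := Multiset.card_le_card (Multiset.filter_le (· ≠ 0)
      (((Multiset.card p.parts : ℤ) + r - 1).toNat ::ₘ removeColumn p.parts))
    have h3 := card_removeColumn_le p.parts
    rw [Multiset.card_cons] at h2
    omega
  · intro p hp
    have hp := (Finset.mem_filter.1 hp).2
    obtain ⟨h1, h2, h3⟩ := dyson_inv_nonneg h hp
    refine Finset.mem_filter.2 ⟨Finset.mem_univ _, ?_⟩
    rw [rank]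
    simp only
    rw [card_addColumn (by omega)]
    have h4 : (addColumn ((largestPart p : ℤ) - r + 1).toNat (p.parts.erase (largestPart p))).sup
        ≤ largestPart p + 1 := by
      refine Multiset.sup_le.2 fun b hb => (mem_addColumn hb).2.trans ?_
      have : (p.parts.erase (largestPart p)).sup ≤ p.parts.sup :=
        Multiset.sup_mono (Multiset.erase_subset _ _)
      rw [largestPart] at this ⊢
      omega
    rw [largestPart]
    simp only
    omega
  · intro p hp
    have hp := (Finset.mem_filter.1 hp).2
    obtain ⟨h1, h2⟩ := filter_cons_sup _ _ (hfwd p hp)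
    apply Nat.Partition.ext
    simp only [largestPart]
    rw [h1, h2]
    have h3 := dyson_nonneg h hp
    have h4 : ((((Multiset.card p.parts : ℤ) + r - 1).toNat : ℤ) - r + 1).toNat
        = Multiset.card p.parts := by omega
    rw [h4]
    exact addColumn_removeColumn fun a ha => p.parts_pos ha
  · intro p hp
    have hp := (Finset.mem_filter.1 hp).2
    obtain ⟨h1, h2, h3⟩ := dyson_inv_nonneg h hp
    apply Nat.Partition.ext
    simp only
    rw [card_addColumn (by omega), removeColumn_addColumn _ fun a ha =>
      p.parts_pos (Multiset.mem_of_mem_erase ha)]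
    have h4 : ((((largestPart p : ℤ) - r + 1).toNat : ℤ) + r - 1).toNat = largestPart p := by omega
    rw [h4]
    exact cons_erase_sup_filter fun a ha => p.parts_pos ha

theorem rank_lt_or {n : ℕ} (p : n.Partition) : (n = 0 ∧ rank p = 0) ∨
    (rank p < n ∧ -(n : ℤ) < rank p) := by
  by_cases h0 : p.parts = 0
  · left
    have := p.parts_sum
    rw [h0, Multiset.sum_zero] at this
    exact ⟨this.symm, by simp [rank, largestPart, h0]⟩
  · right
    have h1 := largestPart_le p
    have h2 : 0 < largestPart p := p.parts_pos (sup_mem_of_ne_zero h0)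
    have h3 := Multiset.card_pos.2 h0
    have h4 := sum_removeColumn fun a ha => p.parts_pos ha
    rw [p.parts_sum] at h4
    rw [rank]
    omega

/-- The generating series of the number of partitions of rank at most `m`. -/
noncomputable def rankLe (m : ℤ) : ℤ⟦X⟧ :=
  PowerSeries.mk fun n => ((Finset.univ.filter fun p : n.Partition => rank p ≤ m).card : ℤ)

theorem zcoeff_rankSeries (m : ℤ) : zcoeff m rankSeries = rankLe m - rankLe (m - 1) := by
  ext n
  rw [coeff_zcoeff_rankSeries, map_sub, rankLe, rankLe, coeff_mk, coeff_mk, rankCount,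
    eq_sub_iff_add_eq, ← Nat.cast_add, ← Finset.card_union_of_disjoint]
  · congr 2
    ext p
    simp only [Finset.mem_union, Finset.mem_filter, Finset.mem_univ, true_and]
    omega
  · rw [Finset.disjoint_filter]
    intro p _ h1 h2
    omega

theorem coeff_rankLe_add (m : ℤ) (n : ℕ) : coeff n (rankLe m)
    + ((Finset.univ.filter fun p : n.Partition => m + 1 ≤ rank p).card : ℤ)
    = coeff n partSeries := by
  rw [rankLe, coeff_mk, coeff_partSeries, ← Nat.cast_add, ← Finset.card_union_of_disjoint]
  · rw [Finset.filter_union_right, Finset.filter_true_of_mem, Finset.card_univ]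
    intro p _; omega
  · rw [Finset.disjoint_filter]
    intro p _ h1 h2
    omega

/-- Dyson's map with r = m + 3 carries rank ≤ m + 3 to rank ≥ m + 1 and raises the size by m + 2;
what remains are the partitions of rank at most m. -/
theorem rankLe_add (m : ℕ) : rankLe m + X ^ (m + 2) * rankLe (m + 3) = partSeries := by
  ext n
  rw [map_add, ← coeff_rankLe_add m, coeff_X_pow_mul']
  congr 1
  split_ifs with hn
  · obtain ⟨k, rfl⟩ := Nat.exists_eq_add_of_le' hn
    rw [Nat.add_sub_cancel, rankLe, coeff_mk, card_rank_le_eq_card_le_rank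
      (n' := k + (m + 2)) (by push_cast; ring)]
    simp only [show (m : ℤ) + 3 - 2 = m + 1 by ring]
  · rw [Finset.filter_false_of_mem]
    · simp
    · intro p _ h
      have := rank_lt_or p
      omega

/-- Dyson's map with r = -k - 1 lowers the size by k + 2 and lands in rank ≥ -k - 3, the complement
of rank ≤ -k - 4. -/
theorem rankLe_neg (k : ℕ) : rankLe (-k - 1) = X ^ (k + 2) * (partSeries - rankLe (-k - 4)) := by
  ext n
  rw [coeff_X_pow_mul', rankLe, coeff_mk]
  split_ifs with hn
  · obtain ⟨l, rfl⟩ := Nat.exists_eq_add_of_le' hn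
    rw [Nat.add_sub_cancel, map_sub, ← coeff_rankLe_add (-k - 4), add_sub_cancel_left,
      card_rank_le_eq_card_le_rank (n' := l) (by push_cast; ring)]
    simp only [show -(k : ℤ) - 1 - 2 = -k - 4 + 1 by ring]
  · rw [Finset.filter_false_of_mem]
    · simp
    · intro p _ h
      have := rank_lt_or p
      omega

end Dyson

/-! ### From the rank recursion to the rank-crank differential equation. -/

section RankRecursion

/-- Each use of the recursion gains at least one factor of q, so d m is divisible by every power of
q. -/
theorem eq_zero_of_recursion {d : ℕ → ℤ⟦X⟧} (h : ∀ m, d m = -(X ^ (m + 2) * d (m + 3))) (m : ℕ) :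
    d m = 0 := by
  have key : ∀ K m, X ^ K ∣ d m := by
    intro K
    induction K with
    | zero => intro m; simp
    | succ K ih =>
      intro m
      rw [h m, dvd_neg, pow_succ']
      exact mul_dvd_mul (dvd_pow_self X (by omega)) (ih (m + 3))
  exact eq_zero_of_forall_X_pow_dvd fun K => key K m

/-- Symmetry of the rank distribution, obtained here without conjugation: by `rankLe_add` and
`rankLe_neg` the discrepancy satisfies the contracting recursion. -/
theorem rankLe_neg_sub_one (m : ℕ) : rankLe (-m - 1) = partSeries - rankLe m := by
  rw [← sub_eq_zero]
  refine eq_zero_of_recursion (d := fun m : ℕ => rankLe (-m - 1) - (partSeries - rankLe m))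
    (fun m => ?_) m
  have h1 := rankLe_add m
  have h2 := rankLe_neg m
  push_cast
  rw [show -((m : ℤ) + 3) - 1 = -m - 4 by ring]
  linear_combination h2 + h1

theorem X_pow_dvd_qD {S : Type*} [CommRing S] (K : ℕ) {f : S⟦X⟧} (h : X ^ K ∣ f) :
    X ^ K ∣ qD S f := by
  rw [PowerSeries.X_pow_dvd_iff] at h ⊢
  intro m hm
  rw [coeff_qD, h m hm, mul_zero]

theorem hasQSum_phi_one : HasQSum (fun j => (j : ℤ⟦X⟧) * (coeff j lambert * X ^ j)) (phi 1) := by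
  have h := (hasQSum_tau 1 lambert).map (moment 1) fun K x hx => X_pow_dvd_mapAdd _ K x hx
  rw [moment_tau_lambert] at h
  convert h using 2 with j
  · rw [moment_iota_mul, moment_zpow]; push_cast; ring
  · simp

theorem qD_qpoch (N : ℕ) : qD _ (qpoch N)
    = -((∑ j ∈ Finset.range (N + 1), (j : ℤ⟦X⟧) * (coeff j lambert * X ^ j)) * qpoch N) := by
  induction N with
  | zero => simp [qpoch, qD_one]
  | succ N ih =>
    have h1 := qD_X_pow_mul (S := ℤ) (N + 1) 1
    rw [mul_one, qD_one] at h1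
    have h2 := one_sub_mul_coeff_lambert (k := N + 1) (by omega)
    rw [qpoch_succ, qD_mul, ih, map_sub, qD_one, h1, Finset.sum_range_succ _ (N + 1)]
    push_cast
    linear_combination (((N : ℤ⟦X⟧) + 1) * X ^ (N + 1) * qpoch N) * h2

theorem qD_euler : qD _ euler = -(phi 1 * euler) := by
  apply eq_of_forall_X_pow_dvd_sub
  intro K
  have h1 := X_pow_dvd_euler_sub_qpoch K
  have h2 := X_pow_dvd_qD _ h1
  have h3 := hasQSum_phi_one (K + 1)
  rw [map_sub, qD_qpoch] at h2
  set s := ∑ j ∈ Finset.range (K + 1), (j : ℤ⟦X⟧) * (coeff j lambert * X ^ j)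
  refine (pow_dvd_pow X (Nat.le_succ K)).trans ?_
  have h4 := dvd_add (dvd_add h2 (h1.mul_left s)) (h3.mul_right euler)
  convert h4 using 1
  ring

theorem qD_partSeries : qD _ partSeries = phi 1 * partSeries := by
  have h := congrArg (qD ℤ) partSeries_mul_euler
  rw [qD_mul, qD_one, qD_euler] at h
  linear_combination partSeries * h + (phi 1 * partSeries - qD ℤ partSeries) * partSeries_mul_euler

/-- 6D + m(m+1) is applied to `rankLe_add`. Moving it past q^(m+2) replaces m(m+1) by m(m+1) +
6(m+2) = (m+3)(m+4), the same operator at m + 3. The right side becomes P (m(m+1) + 6 `phi 1`),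
which the reflection law splits into `cubeCoeff (m - 1)` and q^(m+2) `cubeCoeff (m + 2)`. So the
discrepancy satisfies the contracting recursion. -/
theorem qD_rankLe_natCast (m : ℕ) : 6 * qD _ (rankLe m) + ((m * (m + 1) : ℤ) : ℤ⟦X⟧) * rankLe m
    = 2 * (partSeries * cubeCoeff (m - 1)) := by
  rw [← sub_eq_zero]
  refine eq_zero_of_recursion (d := fun m : ℕ => 6 * qD _ (rankLe m)
    + ((m * (m + 1) : ℤ) : ℤ⟦X⟧) * rankLe m - 2 * (partSeries * cubeCoeff (m - 1))) (fun m => ?_) m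
  have h1 := rankLe_add m
  have h2 := congrArg (qD ℤ) h1
  rw [map_add, qD_X_pow_mul, qD_partSeries] at h2
  have h3 := two_mul_cubeCoeff_add (m - 1)
  have h4 := cubeCoeff_neg (m + 2)
  push_cast at h2 h3 h4 ⊢
  rw [show -((m : ℤ) - 1) - 3 = -(m + 2) by ring, h4] at h3
  rw [show (m : ℤ) + 3 - 1 = m + 2 by ring]
  linear_combination 6 * h2 + (m * (m + 1) : ℤ⟦X⟧) * h1 - partSeries * h3

theorem qD_rankLe (m : ℤ) : 6 * qD _ (rankLe m) + ((m * (m + 1) : ℤ) : ℤ⟦X⟧) * rankLe m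
    = 2 * (partSeries * cubeCoeff (m - 1)) := by
  rcases lt_or_ge m 0 with hm | hm
  · obtain ⟨k, rfl⟩ : ∃ k : ℕ, m = -k - 1 := ⟨(-m - 1).toNat, by omega⟩
    have h1 := qD_rankLe_natCast k
    have h2 := two_mul_cubeCoeff_add (k - 1)
    rw [rankLe_neg_sub_one, map_sub, qD_partSeries]
    rw [show -((k : ℤ) - 1) - 3 = -k - 1 - 1 by ring] at h2
    push_cast at h1 h2 ⊢
    linear_combination -h1 - partSeries * h2
  · obtain ⟨k, rfl⟩ := Int.eq_ofNat_of_zero_le hm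
    exact qD_rankLe_natCast k

theorem zcoeff_crankCube_eq (m : ℤ) : zcoeff m crankCube = partSeries * (cubeCoeff m
    - 3 * cubeCoeff (m - 1) + 3 * cubeCoeff (m - 2) - cubeCoeff (m - 3)) := by
  rw [← zcoeff_crankCube, zcoeff_iota_mul, ← mul_assoc, partSeries_mul_euler, one_mul]

/-- The rank-crank partial differential equation of Atkin and Garvan. -/
theorem rank_crank_pde : 2 * crankCube
    = (zpow 1 - 2 + zpow (-1)) * (6 * qD _ rankSeries + zD (zD rankSeries) + zD rankSeries)
      + 2 * (1 - zpow 1) * zD rankSeries + 2 * rankSeries := by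
  apply zcoeff_ext
  intro m
  have h2 : (2 : LSeries) = iota 2 := (map_ofNat iota 2).symm
  have h6 : (6 : LSeries) = iota 6 := (map_ofNat iota 6).symm
  have hexp : (zpow 1 - 2 + zpow (-1)) * (6 * qD _ rankSeries + zD (zD rankSeries) + zD rankSeries)
      + 2 * (1 - zpow 1) * zD rankSeries + 2 * rankSeries
      = zpow 1 * (iota 6 * qD _ rankSeries) + zpow 1 * zD (zD rankSeries)
        - zpow 1 * zD rankSeries - iota 2 * (iota 6 * qD _ rankSeries)
        - iota 2 * zD (zD rankSeries) + zpow (-1) * (iota 6 * qD _ rankSeries)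
        + zpow (-1) * zD (zD rankSeries) + zpow (-1) * zD rankSeries + iota 2 * rankSeries := by
    rw [← h2, ← h6]; ring
  rw [hexp, h2]
  simp only [map_add, map_sub, zcoeff_zpow_mul, zcoeff_iota_mul, zcoeff_zD, zcoeff_qD,
    zcoeff_rankSeries, zcoeff_crankCube_eq]
  -- The factor z - 2 + z⁻¹ takes a second difference, and the coefficients of `rankSeries` are
  -- first differences of `rankLe`. The coefficient of z^m is thus the third difference of
  -- `qD_rankLe` at m + 1, m, m - 1, m - 2.
  have h := qD_rankLe
  have e1 := h (m + 1)
  have e2 := h m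
  have e3 := h (m - 1)
  have e4 := h (m - 2)
  rw [show m + 1 - 1 = m by ring] at e1
  rw [show m - 1 - 1 = m - 2 by ring] at e3
  rw [show m - 2 - 1 = m - 3 by ring] at e4
  rw [show m - -1 = m + 1 by ring, show m - 1 - 1 = m - 2 by ring, show m + 1 - 1 = m by ring]
  push_cast at e1 e2 e3 e4 ⊢
  linear_combination -e1 + 3 * e2 - 3 * e3 + e4

end RankRecursion

/-! ### Moments of the cube in terms of rank moments. -/

section RankMoments

theorem zcoeff_neg_rankSeries (m : ℕ) : zcoeff (-m) rankSeries = zcoeff m rankSeries := by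
  rw [zcoeff_rankSeries, zcoeff_rankSeries, rankLe_neg_sub_one]
  rcases m with _ | m
  · have h := rankLe_neg_sub_one 0
    simp only [Nat.cast_zero, neg_zero, zero_sub] at h ⊢
    linear_combination h
  · have h := rankLe_neg_sub_one m
    rw [show -((m + 1 : ℕ) : ℤ) = -m - 1 by push_cast; ring, h,
      show ((m + 1 : ℕ) : ℤ) - 1 = m by push_cast; ring]
    ring

theorem zcoeff_rankSeries_neg (m : ℤ) : zcoeff (-m) rankSeries = zcoeff m rankSeries := by
  obtain ⟨k, rfl | rfl⟩ := m.eq_nat_or_neg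
  · exact zcoeff_neg_rankSeries k
  · rw [neg_neg, zcoeff_neg_rankSeries]

theorem moment_odd_rankSeries {k : ℕ} (hk : Odd k) : moment k rankSeries = 0 := by
  ext n
  rw [map_zero, ← rankMoment_eq, PartitionStat.rankMoment]
  have h := finsum_comp_equiv (Equiv.neg ℤ) (f := fun m : ℤ => m ^ k * PartitionStat.rankCount m n)
  simp only [Equiv.neg_apply, hk.neg_pow, ← coeff_zcoeff_rankSeries, zcoeff_rankSeries_neg,
    neg_mul] at h ⊢
  rw [finsum_neg_distrib] at h
  linarith

theorem moment_zpow_mul (k : ℕ) (m : ℤ) (F : LSeries) : moment k (zpow m * F)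
    = ∑ i ∈ Finset.range (k + 1), (k.choose i : ℤ⟦X⟧) * ((m : ℤ⟦X⟧) ^ i * moment (k - i) F) := by
  rw [moment_mul]
  simp only [moment_zpow]

/-- The k-th moment of the differential equation; the factor 1 + (-1)^i collects the contributions
of z and z⁻¹. -/
theorem moment_crankCube_eq_rank (k : ℕ) : 2 * moment k crankCube
    = ∑ i ∈ Finset.range (k + 1), (k.choose i : ℤ⟦X⟧) *
        ((1 + (-1) ^ i) * (6 * qD _ (moment (k - i) rankSeries) + moment (k - i + 2) rankSeries
          + moment (k - i + 1) rankSeries) - 2 * moment (k - i + 1) rankSeries)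
      - 2 * (6 * qD _ (moment k rankSeries) + moment (k + 2) rankSeries
        + moment (k + 1) rankSeries) + 2 * moment (k + 1) rankSeries + 2 * moment k rankSeries := by
  have h2 : (2 : LSeries) = iota 2 := (map_ofNat iota 2).symm
  have h6 : (6 : LSeries) = iota 6 := (map_ofNat iota 6).symm
  have hexp : 2 * crankCube
      = zpow 1 * (6 * qD _ rankSeries + zD (zD rankSeries) + zD rankSeries)
        + zpow (-1) * (6 * qD _ rankSeries + zD (zD rankSeries) + zD rankSeries)
        - zpow 1 * (2 * zD rankSeries)
        - 2 * (6 * qD _ rankSeries + zD (zD rankSeries) + zD rankSeries)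
        + 2 * zD rankSeries + 2 * rankSeries := by
    rw [rank_crank_pde]; ring
  have h := congrArg (moment k) hexp
  rw [h2, h6] at h
  simp only [map_add, map_sub, moment_zpow_mul, moment_iota_mul, moment_zD, moment_qD] at h
  rw [h, ← Finset.sum_add_distrib, ← Finset.sum_sub_distrib]
  refine congrArg₂ (· + ·) (congrArg₂ (· + ·) (congrArg₂ (· - ·)
    (Finset.sum_congr rfl fun i _ => ?_) rfl) rfl) rfl
  push_cast
  ring

theorem two_ne_zero_series : (2 : ℤ⟦X⟧) ≠ 0 := by
  intro h
  have := congrArg (constantCoeff (R := ℤ)) h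
  rw [map_ofNat, map_zero] at this
  norm_num at this

/-- In this and the next evaluations the i = 0 term cancels the subtracted term, so the rank moment
of order k + 2 disappears. The rank moment of order k then has coefficient (k-1)(k-2)/2, which is
zero for k = 2. -/
theorem moment_two_crankCube : moment 2 crankCube = 6 * qD _ (moment 0 rankSeries) := by
  have h := moment_crankCube_eq_rank 2
  have h1 := moment_odd_rankSeries (k := 1) (by decide)
  have h3 := moment_odd_rankSeries (k := 3) (by decide)
  simp only [Finset.sum_range_succ, Finset.sum_range_zero, h1, h3, map_zero] at h
  norm_num [Nat.choose] at h
  apply mul_left_cancel₀ two_ne_zero_series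
  linear_combination h

theorem moment_four_crankCube : moment 4 crankCube = 3 * moment 4 rankSeries
    - 3 * moment 2 rankSeries + 36 * qD _ (moment 2 rankSeries)
    + 6 * qD _ (moment 0 rankSeries) := by
  have h := moment_crankCube_eq_rank 4
  have h1 := moment_odd_rankSeries (k := 1) (by decide)
  have h3 := moment_odd_rankSeries (k := 3) (by decide)
  have h5 := moment_odd_rankSeries (k := 5) (by decide)
  simp only [Finset.sum_range_succ, Finset.sum_range_zero, h1, h3, h5, map_zero] at h
  norm_num [Nat.choose] at h
  apply mul_left_cancel₀ two_ne_zero_series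
  linear_combination h

theorem moment_six_crankCube : moment 6 crankCube = 10 * moment 6 rankSeries
    - 5 * moment 4 rankSeries + 90 * qD _ (moment 4 rankSeries) - 5 * moment 2 rankSeries
    + 90 * qD _ (moment 2 rankSeries) + 6 * qD _ (moment 0 rankSeries) := by
  have h := moment_crankCube_eq_rank 6
  have h1 := moment_odd_rankSeries (k := 1) (by decide)
  have h3 := moment_odd_rankSeries (k := 3) (by decide)
  have h5 := moment_odd_rankSeries (k := 5) (by decide)
  have h7 := moment_odd_rankSeries (k := 7) (by decide)
  simp only [Finset.sum_range_succ, Finset.sum_range_zero, h1, h3, h5, h7, map_zero] at h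
  norm_num [Nat.choose] at h
  apply mul_left_cancel₀ two_ne_zero_series
  linear_combination h

theorem moment_eight_crankCube : moment 8 crankCube = 21 * moment 8 rankSeries
    + 14 * moment 6 rankSeries + 168 * qD _ (moment 6 rankSeries) - 28 * moment 4 rankSeries
    + 420 * qD _ (moment 4 rankSeries) - 7 * moment 2 rankSeries
    + 168 * qD _ (moment 2 rankSeries) + 6 * qD _ (moment 0 rankSeries) := by
  have h := moment_crankCube_eq_rank 8
  have h1 := moment_odd_rankSeries (k := 1) (by decide)
  have h3 := moment_odd_rankSeries (k := 3) (by decide)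
  have h5 := moment_odd_rankSeries (k := 5) (by decide)
  have h7 := moment_odd_rankSeries (k := 7) (by decide)
  have h9 := moment_odd_rankSeries (k := 9) (by decide)
  simp only [Finset.sum_range_succ, Finset.sum_range_zero, h1, h3, h5, h7, h9, map_zero] at h
  norm_num [Nat.choose] at h
  apply mul_left_cancel₀ two_ne_zero_series
  linear_combination h

theorem moment_ten_crankCube : moment 10 crankCube = 36 * moment 10 rankSeries
    + 90 * moment 8 rankSeries + 270 * qD _ (moment 8 rankSeries) - 42 * moment 6 rankSeries
    + 1260 * qD _ (moment 6 rankSeries) - 75 * moment 4 rankSeries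
    + 1260 * qD _ (moment 4 rankSeries) - 9 * moment 2 rankSeries
    + 270 * qD _ (moment 2 rankSeries) + 6 * qD _ (moment 0 rankSeries) := by
  have h := moment_crankCube_eq_rank 10
  have h1 := moment_odd_rankSeries (k := 1) (by decide)
  have h3 := moment_odd_rankSeries (k := 3) (by decide)
  have h5 := moment_odd_rankSeries (k := 5) (by decide)
  have h7 := moment_odd_rankSeries (k := 7) (by decide)
  have h9 := moment_odd_rankSeries (k := 9) (by decide)
  have h11 := moment_odd_rankSeries (k := 11) (by decide)
  simp only [Finset.sum_range_succ, Finset.sum_range_zero, h1, h3, h5, h7, h9, h11, map_zero] at h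
  norm_num [Nat.choose] at h
  apply mul_left_cancel₀ two_ne_zero_series
  linear_combination h

theorem moment_twelve_crankCube : moment 12 crankCube = 55 * moment 12 rankSeries
    + 275 * moment 10 rankSeries + 396 * qD _ (moment 10 rankSeries)
    + 132 * moment 8 rankSeries + 2970 * qD _ (moment 8 rankSeries) - 297 * moment 6 rankSeries
    + 5544 * qD _ (moment 6 rankSeries) - 154 * moment 4 rankSeries
    + 2970 * qD _ (moment 4 rankSeries) - 11 * moment 2 rankSeries
    + 396 * qD _ (moment 2 rankSeries) + 6 * qD _ (moment 0 rankSeries) := by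
  have h := moment_crankCube_eq_rank 12
  have h1 := moment_odd_rankSeries (k := 1) (by decide)
  have h3 := moment_odd_rankSeries (k := 3) (by decide)
  have h5 := moment_odd_rankSeries (k := 5) (by decide)
  have h7 := moment_odd_rankSeries (k := 7) (by decide)
  have h9 := moment_odd_rankSeries (k := 9) (by decide)
  have h11 := moment_odd_rankSeries (k := 11) (by decide)
  have h13 := moment_odd_rankSeries (k := 13) (by decide)
  simp only [Finset.sum_range_succ, Finset.sum_range_zero, h1, h3, h5, h7, h9, h11, h13,
    map_zero] at h
  norm_num [Nat.choose] at h
  apply mul_left_cancel₀ two_ne_zero_series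
  linear_combination h

end RankMoments

/-! ### Liouville's method for sums over n = ax + by. -/

section QuadSums

/-- The quadruples `((a, x), (b, y))` of positive integers with `a * x + b * y = n`. -/
def quads (n : ℕ) : Finset ((ℕ × ℕ) × (ℕ × ℕ)) :=
  (Finset.HasAntidiagonal.antidiagonal n).biUnion fun p =>
    p.1.divisorsAntidiagonal ×ˢ p.2.divisorsAntidiagonal

theorem mem_quads {n : ℕ} {w : (ℕ × ℕ) × (ℕ × ℕ)} : w ∈ quads n ↔
    w.1.1 * w.1.2 + w.2.1 * w.2.2 = n ∧ 0 < w.1.1 ∧ 0 < w.1.2 ∧ 0 < w.2.1 ∧ 0 < w.2.2 := by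
  simp only [quads, Finset.mem_biUnion, Finset.mem_product, Nat.mem_divisorsAntidiagonal,
    Finset.HasAntidiagonal.mem_antidiagonal]
  constructor
  · rintro ⟨p, hp, ⟨h1, h2⟩, h3, h4⟩
    rw [← h1] at h2
    rw [← h3] at h4
    simp only [ne_eq, mul_eq_zero, not_or] at h2 h4
    exact ⟨by omega, by omega, by omega, by omega, by omega⟩
  · rintro ⟨h, h1, h2, h3, h4⟩
    exact ⟨(w.1.1 * w.1.2, w.2.1 * w.2.2), h, ⟨rfl, by positivity⟩, rfl, by positivity⟩

theorem coeff_phi_mul_phi (i j n : ℕ) : coeff n (phi i * phi j)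
    = ∑ w ∈ quads n, (w.1.1 : ℤ) ^ i * (w.2.1 : ℤ) ^ j := by
  rw [quads, Finset.sum_biUnion, coeff_mul]
  · refine Finset.sum_congr rfl fun p _ => ?_
    rw [Finset.sum_product, phi, phi, coeff_mk, coeff_mk, Finset.sum_mul_sum,
      ← Nat.sum_divisorsAntidiagonal fun a _ => ∑ b ∈ p.2.divisors, (a : ℤ) ^ i * (b : ℤ) ^ j]
    refine Finset.sum_congr rfl fun u _ => ?_
    rw [← Nat.sum_divisorsAntidiagonal fun b _ => (u.1 : ℤ) ^ i * (b : ℤ) ^ j]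
  · intro p _ r _ hpr
    rw [Function.onFun, Finset.disjoint_left]
    intro w h1 h2
    simp only [Finset.mem_product, Nat.mem_divisorsAntidiagonal] at h1 h2
    exact hpr (Prod.ext (h1.1.1.symm.trans h2.1.1) (h1.2.1.symm.trans h2.2.1))

theorem sum_quads_eq_split (n : ℕ) (u v : (ℕ × ℕ) × (ℕ × ℕ) → ℕ)
    (G : (ℕ × ℕ) × (ℕ × ℕ) → ℤ) : ∑ w ∈ quads n, G w
      = ∑ w ∈ quads n with u w = v w, G w + ∑ w ∈ quads n with v w < u w, G w
        + ∑ w ∈ quads n with u w < v w, G w := by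
  simp only [Finset.sum_filter, ← Finset.sum_add_distrib]
  refine Finset.sum_congr rfl fun w _ => ?_
  rcases lt_trichotomy (u w) (v w) with h | h | h
  · simp [h, h.ne, h.not_gt]
  · simp [h]
  · simp [h, h.ne', h.not_gt]

/-- From ax + by = (a - b)x + b(x + y), the map (a, x, b, y) ↦ (a - b, x, b, x + y) carries the
condition a > b to x < y. -/
theorem sum_quads_gt (n : ℕ) (g : ℤ → ℤ → ℤ) :
    ∑ w ∈ quads n with w.2.1 < w.1.1, g w.1.1 w.2.1
      = ∑ w ∈ quads n with w.1.2 < w.2.2, g (w.1.1 + w.2.1) w.2.1 := by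
  refine Finset.sum_nbij' (fun w => ((w.1.1 - w.2.1, w.1.2), (w.2.1, w.1.2 + w.2.2)))
    (fun w => ((w.1.1 + w.2.1, w.1.2), (w.2.1, w.2.2 - w.1.2))) ?_ ?_ ?_ ?_ ?_
  · rintro ⟨⟨a, x⟩, b, y⟩ h
    simp only [Finset.mem_filter, mem_quads] at h ⊢
    obtain ⟨c, rfl⟩ := Nat.exists_eq_add_of_lt h.2
    rw [show b + c + 1 - b = c + 1 by omega]
    exact ⟨⟨by rw [← h.1.1]; ring, by omega, by omega, by omega, by omega⟩, by omega⟩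
  · rintro ⟨⟨a, x⟩, b, y⟩ h
    simp only [Finset.mem_filter, mem_quads] at h ⊢
    obtain ⟨c, rfl⟩ := Nat.exists_eq_add_of_lt h.2
    rw [show x + c + 1 - x = c + 1 by omega]
    exact ⟨⟨by rw [← h.1.1]; ring, by omega, by omega, by omega, by omega⟩, by omega⟩
  · rintro ⟨⟨a, x⟩, b, y⟩ h
    simp only [Finset.mem_filter, mem_quads] at h
    simp only [Prod.mk.injEq, and_true, true_and]
    omega
  · rintro ⟨⟨a, x⟩, b, y⟩ h
    simp only [Finset.mem_filter, mem_quads] at h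
    simp only [Prod.mk.injEq, and_true, true_and]
    omega
  · rintro ⟨⟨a, x⟩, b, y⟩ h
    simp only [Finset.mem_filter, mem_quads] at h ⊢
    rw [Nat.cast_sub h.2.le, sub_add_cancel]

theorem sum_quads_swap (n : ℕ) (p : (ℕ × ℕ) × (ℕ × ℕ) → Prop) [DecidablePred p]
    (G : (ℕ × ℕ) × (ℕ × ℕ) → ℤ) :
    ∑ w ∈ quads n with p w, G w = ∑ w ∈ quads n with p w.swap, G w.swap := by
  refine Finset.sum_nbij' Prod.swap Prod.swap ?_ ?_ (by simp) (by simp) (by simp)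
  · intro w h
    simp only [Finset.mem_filter, mem_quads, Prod.swap_swap, Prod.fst_swap, Prod.snd_swap] at h ⊢
    exact ⟨⟨by omega, by omega⟩, h.2⟩
  · intro w h
    simp only [Finset.mem_filter, mem_quads, Prod.swap_swap, Prod.fst_swap, Prod.snd_swap] at h ⊢
    exact ⟨⟨by omega, by omega⟩, h.2⟩

theorem sum_quads_lt (n : ℕ) (g : ℤ → ℤ → ℤ) :
    ∑ w ∈ quads n with w.1.1 < w.2.1, g w.1.1 w.2.1
      = ∑ w ∈ quads n with w.2.2 < w.1.2, g w.1.1 (w.1.1 + w.2.1) := by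
  have h := sum_quads_gt n fun a b => g b a
  rw [sum_quads_swap, sum_quads_swap n (fun w => w.1.2 < w.2.2)] at h
  simpa [add_comm] using h

/-- With x = y the equation is n = (a + b)x, so d = a + b is a divisor of n and a runs from 1 to d -
1. -/
theorem sum_quads_snd_eq (n : ℕ) (G : (ℕ × ℕ) × (ℕ × ℕ) → ℤ) :
    ∑ w ∈ quads n with w.1.2 = w.2.2, G w = ∑ d ∈ n.divisors, ∑ i ∈ Finset.range (d - 1),
      G ((i + 1, n / d), (d - 1 - i, n / d)) := by
  rw [Finset.sum_sigma']
  refine Finset.sum_nbij' (fun w => ⟨w.1.1 + w.2.1, w.1.1 - 1⟩)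
    (fun s => ((s.2 + 1, n / s.1), (s.1 - 1 - s.2, n / s.1))) ?_ ?_ ?_ ?_ ?_
  · rintro ⟨⟨a, x⟩, b, y⟩ h
    simp only [Finset.mem_filter, mem_quads, Finset.mem_sigma, Nat.mem_divisors,
      Finset.mem_range] at h ⊢
    obtain ⟨⟨h, h1, h2, h3, h4⟩, rfl⟩ := h
    refine ⟨⟨⟨x, by rw [← h]; ring⟩, ?_⟩, by omega⟩
    rw [← h]; positivity
  · rintro ⟨d, i⟩ h
    simp only [Finset.mem_filter, mem_quads, Finset.mem_sigma, Nat.mem_divisors,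
      Finset.mem_range] at h ⊢
    obtain ⟨⟨⟨c, rfl⟩, h1⟩, h2⟩ := h
    have hd : 0 < d := by omega
    have hc : 0 < c := Nat.pos_of_ne_zero (by rintro rfl; simp at h1)
    rw [Nat.mul_div_cancel_left c hd, ← add_mul, show i + 1 + (d - 1 - i) = d by omega]
    exact ⟨⟨rfl, by omega, hc, by omega, hc⟩, trivial⟩
  · rintro ⟨⟨a, x⟩, b, y⟩ h
    simp only [Finset.mem_filter, mem_quads] at h
    obtain ⟨⟨h, h1, h2, h3, h4⟩, rfl⟩ := h
    have h5 : n / (a + b) = x := by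
      rw [← h, ← add_mul, Nat.mul_div_cancel_left x (by omega)]
    simp only [h5, Prod.mk.injEq, and_true]
    omega
  · rintro ⟨d, i⟩ h
    simp only [Finset.mem_sigma, Nat.mem_divisors, Finset.mem_range] at h
    simp only [Sigma.mk.injEq, heq_eq_eq]
    omega
  · rintro ⟨⟨a, x⟩, b, y⟩ h
    simp only [Finset.mem_filter, mem_quads] at h
    obtain ⟨⟨h, h1, h2, h3, h4⟩, rfl⟩ := h
    have h5 : n / (a + b) = x := by
      rw [← h, ← add_mul, Nat.mul_div_cancel_left x (by omega)]
    have h6 : a - 1 + 1 = a := by omega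
    have h7 : a + b - 1 - (a - 1) = b := by omega
    simp only [h5, h6, h7]

theorem sum_quads_transpose (n : ℕ) (p : (ℕ × ℕ) × (ℕ × ℕ) → Prop) [DecidablePred p]
    (G : (ℕ × ℕ) × (ℕ × ℕ) → ℤ) : ∑ w ∈ quads n with p w, G w
      = ∑ w ∈ quads n with p (w.1.swap, w.2.swap), G (w.1.swap, w.2.swap) := by
  refine Finset.sum_nbij' (fun w => (w.1.swap, w.2.swap)) (fun w => (w.1.swap, w.2.swap))
    ?_ ?_ (by simp) (by simp) (by simp)
  · intro w h
    simp only [Finset.mem_filter, mem_quads, Prod.swap_swap, Prod.fst_swap, Prod.snd_swap] at h ⊢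
    refine ⟨⟨?_, by omega⟩, h.2⟩
    rw [mul_comm w.1.2, mul_comm w.2.2]; exact h.1.1
  · intro w h
    simp only [Finset.mem_filter, mem_quads, Prod.swap_swap, Prod.fst_swap, Prod.snd_swap] at h ⊢
    refine ⟨⟨?_, by omega⟩, h.2⟩
    rw [mul_comm w.1.2, mul_comm w.2.2]; exact h.1.1

/-- With a = b = d the equation is n = d(x + y), which has n/d - 1 solutions; transposing each pair
reduces this to the previous diagonal. -/
theorem sum_quads_fst_eq (n : ℕ) (k : ℤ → ℤ) :
    ∑ w ∈ quads n with w.1.1 = w.2.1, k w.1.1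
      = ∑ d ∈ n.divisors, (((n / d : ℕ) : ℤ) - 1) * k d := by
  rw [sum_quads_transpose]
  simp only [Prod.fst_swap]
  rw [sum_quads_snd_eq n fun w => k w.1.2]
  simp only [Finset.sum_const, Finset.card_range, nsmul_eq_mul]
  rw [← Nat.sum_div_divisors n fun d => (((n / d : ℕ) : ℤ) - 1) * k d]
  refine Finset.sum_congr rfl fun d hd => ?_
  rw [Nat.div_div_self (Nat.dvd_of_mem_divisors hd) (Nat.ne_zero_of_mem_divisors hd),
    Nat.cast_sub (Nat.pos_of_mem_divisors hd), Nat.cast_one]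

/-- Liouville's method: comparison of two sums over the representations `n = a * x + b * y`. -/
theorem sum_quads_sub (n : ℕ) {g g' : ℤ → ℤ → ℤ} (h1 : ∀ a b, g (a + b) b = g' a b)
    (h2 : ∀ a b, g a (a + b) = g' a b) : ∑ w ∈ quads n, (g w.1.1 w.2.1 - g' w.1.1 w.2.1)
      = ∑ d ∈ n.divisors, (((n / d : ℕ) : ℤ) - 1) * g d d
        - ∑ d ∈ n.divisors, (∑ i ∈ Finset.range d, g' i (d - i) - g' 0 d) := by
  -- The sum of g is split by comparing a with b, and that of g' by comparing x with y. The
  -- off-diagonal parts agree by `h1` and `h2`, so only the two diagonals survive.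
  have e1 := sum_quads_eq_split n (fun w => w.1.1) (fun w => w.2.1) fun w => g w.1.1 w.2.1
  have e2 := sum_quads_eq_split n (fun w => w.1.2) (fun w => w.2.2) fun w => g' w.1.1 w.2.1
  have e3 : ∑ w ∈ quads n with w.1.1 = w.2.1, g w.1.1 w.2.1
      = ∑ w ∈ quads n with w.1.1 = w.2.1, g w.1.1 w.1.1 := by
    refine Finset.sum_congr rfl fun w hw => ?_
    rw [(Finset.mem_filter.1 hw).2]
  rw [e3, sum_quads_fst_eq n fun a => g a a, sum_quads_gt, sum_quads_lt] at e1
  rw [sum_quads_snd_eq n fun w => g' w.1.1 w.2.1] at e2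
  simp only [h1, h2] at e1
  -- The range of i is extended to include i = 0, whose term is then subtracted; this makes the
  -- inner sum a convenient power sum.
  have e4 : ∑ d ∈ n.divisors, ∑ i ∈ Finset.range (d - 1), g' (i + 1 : ℕ) (d - 1 - i : ℕ)
      = ∑ d ∈ n.divisors, (∑ i ∈ Finset.range d, g' i (d - i) - g' 0 d) := by
    refine Finset.sum_congr rfl fun d hd => ?_
    obtain ⟨m, rfl⟩ := Nat.exists_eq_add_of_lt (Nat.pos_of_mem_divisors hd)
    rw [Finset.sum_range_succ', Nat.cast_zero, sub_zero, add_sub_cancel_right]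
    refine Finset.sum_congr (by simp) fun i hi => ?_
    have : i < m := by simpa using hi
    rw [show 0 + m + 1 - 1 - i = m - i by omega, Nat.cast_sub this.le]
    push_cast
    congr 1; ring
  rw [Finset.sum_sub_distrib, e1, e2, e4]
  ring

end QuadSums

/-! ### Convolution identities for divisor sums. -/

section Convolutions

theorem coeff_ofNat_mul {S : Type*} [CommRing S] (a : ℕ) [a.AtLeastTwo] (F : S⟦X⟧) (n : ℕ) :
    coeff n ((ofNat(a) : S⟦X⟧) * F) = ofNat(a) * coeff n F := by
  rw [← map_ofNat (C (R := S)) a, coeff_C_mul]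

/-- For even k, g = (a-b)^k + a^k + b^k meets Liouville's hypotheses, and g - g' = (a-b)^k - (a+b)^k
has only monomials with odd exponents. The diagonal x + y = n/d produces the derivative term. The
exponents 4 and 6 work in the same way. -/
theorem liouville_two : -12 * (phi 1 * phi 1)
    = 6 * qD _ (phi 1) - phi 1 - 5 * phi 3 := by
  ext n
  have h := sum_quads_sub n (g := fun a b => (a - b) ^ 2 + a ^ 2 + b ^ 2)
    (g' := fun a b => (a + b) ^ 2 + a ^ 2 + b ^ 2) (fun a b => by ring) fun a b => by ring
  rw [show (∑ w ∈ quads n, _ : ℤ) = (-4) * coeff n (phi 1 * phi 1) by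
    simp only [coeff_phi_mul_phi, Finset.mul_sum, ← Finset.sum_add_distrib]
    exact Finset.sum_congr rfl fun w _ => by ring] at h
  rw [show (∑ e ∈ n.divisors, (((n / e : ℕ) : ℤ) - 1) * _)
      = 2 * (n * coeff n (phi 1)) + (-2) * coeff n (phi 2) by
    simp only [phi, coeff_mk, Finset.mul_sum, ← Finset.sum_add_distrib]
    refine Finset.sum_congr rfl fun e he => ?_
    have h1 : ((n / e : ℕ) : ℤ) * e = n := by
      exact_mod_cast Nat.div_mul_cancel (Nat.dvd_of_mem_divisors he)
    linear_combination 2 * (e : ℤ) ^ 1 * h1] at h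
  -- Faulhaber's formula, with the upper limit m kept independent of d so that induction applies; it
  -- is used at m = d. The factor 3 clears denominators.
  have e3 (d : ℕ) (m : ℕ) : 3 * ∑ i ∈ Finset.range m, (((i : ℤ) + (d - i : ℤ)) ^ 2
      + (i : ℤ) ^ 2 + (d - i : ℤ) ^ 2)
      = 6 * (d : ℤ) ^ 2 * m - 3 * (d : ℤ) * m ^ 2 + 3 * (d : ℤ) * m + 2 * m ^ 3 - 3 * m ^ 2
          + m := by
    induction m with
    | zero => simp
    | succ m ih => rw [Finset.sum_range_succ, mul_add, ih]; push_cast; ring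
  have e4 : 3 * ∑ d ∈ n.divisors, (∑ i ∈ Finset.range d, (((i : ℤ) + (d - i : ℤ)) ^ 2
      + (i : ℤ) ^ 2 + (d - i : ℤ) ^ 2)
      - (((0 : ℤ) + (d : ℤ)) ^ 2 + (0 : ℤ) ^ 2 + (d : ℤ) ^ 2))
      = 1 * coeff n (phi 1) + (-6) * coeff n (phi 2) + 5 * coeff n (phi 3) := by
    rw [Finset.mul_sum]
    simp only [phi, coeff_mk]
    rw [Finset.mul_sum, Finset.mul_sum, Finset.mul_sum, ← Finset.sum_add_distrib,
        ← Finset.sum_add_distrib]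
    exact Finset.sum_congr rfl fun d _ => by linear_combination e3 d d
  simp only [map_add, map_sub, map_neg, neg_mul, coeff_ofNat_mul, coeff_qD]
  linear_combination 3 * h - e4

theorem liouville_four : -240 * (phi 1 * phi 3)
    = 30 * qD _ (phi 3) + phi 1 - 10 * phi 3 - 21 * phi 5 := by
  ext n
  have h := sum_quads_sub n (g := fun a b => (a - b) ^ 4 + a ^ 4 + b ^ 4)
    (g' := fun a b => (a + b) ^ 4 + a ^ 4 + b ^ 4) (fun a b => by ring) fun a b => by ring
  rw [show (∑ w ∈ quads n, _ : ℤ) = (-8) * coeff n (phi 3 * phi 1)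
      + (-8) * coeff n (phi 1 * phi 3) by
    simp only [coeff_phi_mul_phi, Finset.mul_sum, ← Finset.sum_add_distrib]
    exact Finset.sum_congr rfl fun w _ => by ring] at h
  rw [mul_comm (phi 3) (phi 1)] at h
  rw [show (∑ e ∈ n.divisors, (((n / e : ℕ) : ℤ) - 1) * _)
      = 2 * (n * coeff n (phi 3)) + (-2) * coeff n (phi 4) by
    simp only [phi, coeff_mk, Finset.mul_sum, ← Finset.sum_add_distrib]
    refine Finset.sum_congr rfl fun e he => ?_
    have h1 : ((n / e : ℕ) : ℤ) * e = n := by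
      exact_mod_cast Nat.div_mul_cancel (Nat.dvd_of_mem_divisors he)
    linear_combination 2 * (e : ℤ) ^ 3 * h1] at h
  have e3 (d : ℕ) (m : ℕ) : 15 * ∑ i ∈ Finset.range m, (((i : ℤ) + (d - i : ℤ)) ^ 4
      + (i : ℤ) ^ 4 + (d - i : ℤ) ^ 4)
      = 30 * (d : ℤ) ^ 4 * m - 30 * (d : ℤ) ^ 3 * m ^ 2 + 30 * (d : ℤ) ^ 3 * m
      + 30 * (d : ℤ) ^ 2 * m ^ 3 - 45 * (d : ℤ) ^ 2 * m ^ 2 + 15 * (d : ℤ) ^ 2 * m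
      - 15 * (d : ℤ) * m ^ 4 + 30 * (d : ℤ) * m ^ 3 - 15 * (d : ℤ) * m ^ 2 + 6 * m ^ 5
      - 15 * m ^ 4 + 10 * m ^ 3 - m := by
    induction m with
    | zero => simp
    | succ m ih => rw [Finset.sum_range_succ, mul_add, ih]; push_cast; ring
  have e4 : 15 * ∑ d ∈ n.divisors, (∑ i ∈ Finset.range d, (((i : ℤ) + (d - i : ℤ)) ^ 4
      + (i : ℤ) ^ 4 + (d - i : ℤ) ^ 4)
      - (((0 : ℤ) + (d : ℤ)) ^ 4 + (0 : ℤ) ^ 4 + (d : ℤ) ^ 4))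
      = (-1) * coeff n (phi 1) + 10 * coeff n (phi 3) + (-30) * coeff n (phi 4)
          + 21 * coeff n (phi 5) := by
    rw [Finset.mul_sum]
    simp only [phi, coeff_mk]
    rw [Finset.mul_sum, Finset.mul_sum, Finset.mul_sum, Finset.mul_sum,
        ← Finset.sum_add_distrib, ← Finset.sum_add_distrib, ← Finset.sum_add_distrib]
    exact Finset.sum_congr rfl fun d _ => by linear_combination e3 d d
  simp only [map_add, map_sub, map_neg, neg_mul, coeff_ofNat_mul, coeff_qD]
  linear_combination 15 * h - e4

theorem liouville_six : -1008 * (phi 1 * phi 5) - 1680 * (phi 3 * phi 3)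
    = 84 * qD _ (phi 5) - 2 * phi 1 + 14 * phi 3 - 42 * phi 5 - 54 * phi 7 := by
  ext n
  have h := sum_quads_sub n (g := fun a b => (a - b) ^ 6 + a ^ 6 + b ^ 6)
    (g' := fun a b => (a + b) ^ 6 + a ^ 6 + b ^ 6) (fun a b => by ring) fun a b => by ring
  rw [show (∑ w ∈ quads n, _ : ℤ) = (-12) * coeff n (phi 5 * phi 1)
      + (-40) * coeff n (phi 3 * phi 3)
      + (-12) * coeff n (phi 1 * phi 5) by
    simp only [coeff_phi_mul_phi, Finset.mul_sum, ← Finset.sum_add_distrib]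
    exact Finset.sum_congr rfl fun w _ => by ring] at h
  rw [mul_comm (phi 5) (phi 1)] at h
  rw [show (∑ e ∈ n.divisors, (((n / e : ℕ) : ℤ) - 1) * _)
      = 2 * (n * coeff n (phi 5)) + (-2) * coeff n (phi 6) by
    simp only [phi, coeff_mk, Finset.mul_sum, ← Finset.sum_add_distrib]
    refine Finset.sum_congr rfl fun e he => ?_
    have h1 : ((n / e : ℕ) : ℤ) * e = n := by
      exact_mod_cast Nat.div_mul_cancel (Nat.dvd_of_mem_divisors he)
    linear_combination 2 * (e : ℤ) ^ 5 * h1] at h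
  have e3 (d : ℕ) (m : ℕ) : 42 * ∑ i ∈ Finset.range m, (((i : ℤ) + (d - i : ℤ)) ^ 6
      + (i : ℤ) ^ 6 + (d - i : ℤ) ^ 6)
      = 84 * (d : ℤ) ^ 6 * m - 126 * (d : ℤ) ^ 5 * m ^ 2 + 126 * (d : ℤ) ^ 5 * m
      + 210 * (d : ℤ) ^ 4 * m ^ 3 - 315 * (d : ℤ) ^ 4 * m ^ 2 + 105 * (d : ℤ) ^ 4 * m
      - 210 * (d : ℤ) ^ 3 * m ^ 4 + 420 * (d : ℤ) ^ 3 * m ^ 3 - 210 * (d : ℤ) ^ 3 * m ^ 2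
      + 126 * (d : ℤ) ^ 2 * m ^ 5 - 315 * (d : ℤ) ^ 2 * m ^ 4 + 210 * (d : ℤ) ^ 2 * m ^ 3
      - 21 * (d : ℤ) ^ 2 * m - 42 * (d : ℤ) * m ^ 6 + 126 * (d : ℤ) * m ^ 5
      - 105 * (d : ℤ) * m ^ 4 + 21 * (d : ℤ) * m ^ 2 + 12 * m ^ 7 - 42 * m ^ 6 + 42 * m ^ 5
      - 14 * m ^ 3 + 2 * m := by
    induction m with
    | zero => simp
    | succ m ih => rw [Finset.sum_range_succ, mul_add, ih]; push_cast; ring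
  have e4 : 42 * ∑ d ∈ n.divisors, (∑ i ∈ Finset.range d, (((i : ℤ) + (d - i : ℤ)) ^ 6
      + (i : ℤ) ^ 6 + (d - i : ℤ) ^ 6)
      - (((0 : ℤ) + (d : ℤ)) ^ 6 + (0 : ℤ) ^ 6 + (d : ℤ) ^ 6))
      = 2 * coeff n (phi 1) + (-14) * coeff n (phi 3) + 42 * coeff n (phi 5)
      + (-84) * coeff n (phi 6) + 54 * coeff n (phi 7) := by
    rw [Finset.mul_sum]
    simp only [phi, coeff_mk]
    rw [Finset.mul_sum, Finset.mul_sum, Finset.mul_sum, Finset.mul_sum, Finset.mul_sum,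
        ← Finset.sum_add_distrib, ← Finset.sum_add_distrib, ← Finset.sum_add_distrib,
        ← Finset.sum_add_distrib]
    exact Finset.sum_congr rfl fun d _ => by linear_combination e3 d d
  simp only [map_add, map_sub, map_neg, neg_mul, coeff_ofNat_mul, coeff_qD]
  linear_combination 42 * h - e4

/-- This g vanishes for a = b, so no derivative appears, and its correction terms cancel the
monomials a⁵b and ab⁵, leaving products free of `phi 1`. The exponents 6 and 8 are analogous. -/
theorem liouville_mul_four : 120 * (phi 3 * phi 3)
    = -phi 3 + phi 7 := by
  ext n
  have h := sum_quads_sub n (g := fun a b => a * b * (a - b) ^ 4 - b * (a - b) * a ^ 4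
      + a * (a - b) * b ^ 4)
    (g' := fun a b => -(a * b * (a + b) ^ 4) + (a + b) * b * a ^ 4 + a * (a
        + b) * b ^ 4) (fun a b => by ring) fun a b => by ring
  rw [show (∑ w ∈ quads n, _ : ℤ) = 12 * coeff n (phi 3 * phi 3) by
    simp only [coeff_phi_mul_phi, Finset.mul_sum, ← Finset.sum_add_distrib]
    exact Finset.sum_congr rfl fun w _ => by ring] at h
  rw [show (∑ e ∈ n.divisors, (((n / e : ℕ) : ℤ) - 1) * _) = 0 from
    Finset.sum_eq_zero fun e _ => by ring] at h
  have e3 (d : ℕ) (m : ℕ) : 10 * ∑ i ∈ Finset.range m, (-((i : ℤ) * (d - i : ℤ) * ((i : ℤ)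
      + (d - i : ℤ)) ^ 4) + ((i : ℤ) + (d - i : ℤ)) * (d
      - i : ℤ) * (i : ℤ) ^ 4 + (i : ℤ) * ((i : ℤ) + (d - i : ℤ)) * (d - i : ℤ) ^ 4)
      = -10 * (d : ℤ) ^ 4 * m ^ 3 + 15 * (d : ℤ) ^ 4 * m ^ 2 - 5 * (d : ℤ) ^ 4 * m
      + 15 * (d : ℤ) ^ 3 * m ^ 4 - 30 * (d : ℤ) ^ 3 * m ^ 3 + 15 * (d : ℤ) ^ 3 * m ^ 2
      - 6 * (d : ℤ) ^ 2 * m ^ 5 + 15 * (d : ℤ) ^ 2 * m ^ 4 - 10 * (d : ℤ) ^ 2 * m ^ 3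
      + (d : ℤ) ^ 2 * m := by
    induction m with
    | zero => simp
    | succ m ih => rw [Finset.sum_range_succ, mul_add, ih]; push_cast; ring
  have e4 : 10 * ∑ d ∈ n.divisors, (∑ i ∈ Finset.range d, (-((i : ℤ) * (d - i : ℤ) * ((i : ℤ)
      + (d - i : ℤ)) ^ 4) + ((i : ℤ) + (d - i : ℤ)) * (d - i : ℤ) * (i : ℤ) ^ 4
      + (i : ℤ) * ((i : ℤ) + (d - i : ℤ)) * (d - i : ℤ) ^ 4)
      - (-((0 : ℤ) * (d : ℤ) * ((0 : ℤ) + (d : ℤ)) ^ 4) + ((0 : ℤ)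
          + (d : ℤ)) * (d : ℤ) * (0 : ℤ) ^ 4 + (0 : ℤ) * ((0 : ℤ) + (d : ℤ)) * (d : ℤ) ^ 4))
      = 1 * coeff n (phi 3) + (-1) * coeff n (phi 7) := by
    rw [Finset.mul_sum]
    simp only [phi, coeff_mk]
    rw [Finset.mul_sum, Finset.mul_sum, ← Finset.sum_add_distrib]
    exact Finset.sum_congr rfl fun d _ => by linear_combination e3 d d
  simp only [map_add, map_sub, map_neg, neg_mul, coeff_ofNat_mul]
  linear_combination 10 * h - e4

theorem liouville_mul_six : 5040 * (phi 3 * phi 5)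
    = 10 * phi 3 - 21 * phi 5 + 11 * phi 9 := by
  ext n
  have h := sum_quads_sub n (g := fun a b => a * b * (a - b) ^ 6 - b * (a - b) * a ^ 6
      + a * (a - b) * b ^ 6)
    (g' := fun a b => -(a * b * (a + b) ^ 6) + (a + b) * b * a ^ 6 + a * (a
        + b) * b ^ 6) (fun a b => by ring) fun a b => by ring
  rw [show (∑ w ∈ quads n, _ : ℤ) = 30 * coeff n (phi 5 * phi 3) + 30 * coeff n (phi 3 * phi 5) by
    simp only [coeff_phi_mul_phi, Finset.mul_sum, ← Finset.sum_add_distrib]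
    exact Finset.sum_congr rfl fun w _ => by ring] at h
  rw [mul_comm (phi 5) (phi 3)] at h
  rw [show (∑ e ∈ n.divisors, (((n / e : ℕ) : ℤ) - 1) * _) = 0 from
    Finset.sum_eq_zero fun e _ => by ring] at h
  have e3 (d : ℕ) (m : ℕ) : 84 * ∑ i ∈ Finset.range m, (-((i : ℤ) * (d - i : ℤ) * ((i : ℤ)
      + (d - i : ℤ)) ^ 6) + ((i : ℤ) + (d - i : ℤ)) * (d
      - i : ℤ) * (i : ℤ) ^ 6 + (i : ℤ) * ((i : ℤ) + (d - i : ℤ)) * (d - i : ℤ) ^ 6)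
      = -140 * (d : ℤ) ^ 6 * m ^ 3 + 210 * (d : ℤ) ^ 6 * m ^ 2 - 70 * (d : ℤ) ^ 6 * m
      + 315 * (d : ℤ) ^ 5 * m ^ 4 - 630 * (d : ℤ) ^ 5 * m ^ 3 + 315 * (d : ℤ) ^ 5 * m ^ 2
      - 336 * (d : ℤ) ^ 4 * m ^ 5 + 840 * (d : ℤ) ^ 4 * m ^ 4 - 560 * (d : ℤ) ^ 4 * m ^ 3
      + 56 * (d : ℤ) ^ 4 * m + 210 * (d : ℤ) ^ 3 * m ^ 6 - 630 * (d : ℤ) ^ 3 * m ^ 5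
      + 525 * (d : ℤ) ^ 3 * m ^ 4 - 105 * (d : ℤ) ^ 3 * m ^ 2 - 60 * (d : ℤ) ^ 2 * m ^ 7
      + 210 * (d : ℤ) ^ 2 * m ^ 6 - 210 * (d : ℤ) ^ 2 * m ^ 5 + 70 * (d : ℤ) ^ 2 * m ^ 3
      - 10 * (d : ℤ) ^ 2 * m := by
    induction m with
    | zero => simp
    | succ m ih => rw [Finset.sum_range_succ, mul_add, ih]; push_cast; ring
  have e4 : 84 * ∑ d ∈ n.divisors, (∑ i ∈ Finset.range d, (-((i : ℤ) * (d - i : ℤ) * ((i : ℤ)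
      + (d - i : ℤ)) ^ 6) + ((i : ℤ) + (d - i : ℤ)) * (d - i : ℤ) * (i : ℤ) ^ 6
      + (i : ℤ) * ((i : ℤ) + (d - i : ℤ)) * (d - i : ℤ) ^ 6)
      - (-((0 : ℤ) * (d : ℤ) * ((0 : ℤ) + (d : ℤ)) ^ 6) + ((0 : ℤ)
          + (d : ℤ)) * (d : ℤ) * (0 : ℤ) ^ 6 + (0 : ℤ) * ((0 : ℤ) + (d : ℤ)) * (d : ℤ) ^ 6))
      = (-10) * coeff n (phi 3) + 21 * coeff n (phi 5) + (-11) * coeff n (phi 9) := by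
    rw [Finset.mul_sum]
    simp only [phi, coeff_mk]
    rw [Finset.mul_sum, Finset.mul_sum, Finset.mul_sum, ← Finset.sum_add_distrib,
        ← Finset.sum_add_distrib]
    exact Finset.sum_congr rfl fun d _ => by linear_combination e3 d d
  simp only [map_add, map_sub, map_neg, neg_mul, coeff_ofNat_mul]
  linear_combination 84 * h - e4

theorem liouville_mul_eight : 10080 * (phi 3 * phi 7) + 12600 * (phi 5 * phi 5)
    = -21 * phi 3 + 50 * phi 5 - 42 * phi 7 + 13 * phi 11 := by
  ext n
  have h := sum_quads_sub n (g := fun a b => a * b * (a - b) ^ 8 - b * (a - b) * a ^ 8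
      + a * (a - b) * b ^ 8)
    (g' := fun a b => -(a * b * (a + b) ^ 8) + (a + b) * b * a ^ 8 + a * (a
        + b) * b ^ 8) (fun a b => by ring) fun a b => by ring
  rw [show (∑ w ∈ quads n, _ : ℤ) = 56 * coeff n (phi 7 * phi 3)
      + 140 * coeff n (phi 5 * phi 5) + 56 * coeff n (phi 3 * phi 7) by
    simp only [coeff_phi_mul_phi, Finset.mul_sum, ← Finset.sum_add_distrib]
    exact Finset.sum_congr rfl fun w _ => by ring] at h
  rw [mul_comm (phi 7) (phi 3)] at h
  rw [show (∑ e ∈ n.divisors, (((n / e : ℕ) : ℤ) - 1) * _) = 0 from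
    Finset.sum_eq_zero fun e _ => by ring] at h
  have e3 (d : ℕ) (m : ℕ) : 90 * ∑ i ∈ Finset.range m, (-((i : ℤ) * (d - i : ℤ) * ((i : ℤ)
      + (d - i : ℤ)) ^ 8) + ((i : ℤ) + (d - i : ℤ)) * (d
      - i : ℤ) * (i : ℤ) ^ 8 + (i : ℤ) * ((i : ℤ) + (d - i : ℤ)) * (d - i : ℤ) ^ 8)
      = -210 * (d : ℤ) ^ 8 * m ^ 3 + 315 * (d : ℤ) ^ 8 * m ^ 2 - 105 * (d : ℤ) ^ 8 * m
      + 630 * (d : ℤ) ^ 7 * m ^ 4 - 1260 * (d : ℤ) ^ 7 * m ^ 3 + 630 * (d : ℤ) ^ 7 * m ^ 2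
      - 1008 * (d : ℤ) ^ 6 * m ^ 5 + 2520 * (d : ℤ) ^ 6 * m ^ 4 - 1680 * (d : ℤ) ^ 6 * m ^ 3
      + 168 * (d : ℤ) ^ 6 * m + 1050 * (d : ℤ) ^ 5 * m ^ 6 - 3150 * (d : ℤ) ^ 5 * m ^ 5
      + 2625 * (d : ℤ) ^ 5 * m ^ 4 - 525 * (d : ℤ) ^ 5 * m ^ 2 - 720 * (d : ℤ) ^ 4 * m ^ 7
      + 2520 * (d : ℤ) ^ 4 * m ^ 6 - 2520 * (d : ℤ) ^ 4 * m ^ 5 + 840 * (d : ℤ) ^ 4 * m ^ 3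
      - 120 * (d : ℤ) ^ 4 * m + 315 * (d : ℤ) ^ 3 * m ^ 8 - 1260 * (d : ℤ) ^ 3 * m ^ 7
      + 1470 * (d : ℤ) ^ 3 * m ^ 6 - 735 * (d : ℤ) ^ 3 * m ^ 4 + 210 * (d : ℤ) ^ 3 * m ^ 2
      - 70 * (d : ℤ) ^ 2 * m ^ 9 + 315 * (d : ℤ) ^ 2 * m ^ 8 - 420 * (d : ℤ) ^ 2 * m ^ 7
      + 294 * (d : ℤ) ^ 2 * m ^ 5 - 140 * (d : ℤ) ^ 2 * m ^ 3 + 21 * (d : ℤ) ^ 2 * m := by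
    induction m with
    | zero => simp
    | succ m ih => rw [Finset.sum_range_succ, mul_add, ih]; push_cast; ring
  have e4 : 90 * ∑ d ∈ n.divisors, (∑ i ∈ Finset.range d, (-((i : ℤ) * (d - i : ℤ) * ((i : ℤ)
      + (d - i : ℤ)) ^ 8) + ((i : ℤ) + (d - i : ℤ)) * (d - i : ℤ) * (i : ℤ) ^ 8
      + (i : ℤ) * ((i : ℤ) + (d - i : ℤ)) * (d - i : ℤ) ^ 8)
      - (-((0 : ℤ) * (d : ℤ) * ((0 : ℤ) + (d : ℤ)) ^ 8) + ((0 : ℤ)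
          + (d : ℤ)) * (d : ℤ) * (0 : ℤ) ^ 8 + (0 : ℤ) * ((0 : ℤ) + (d : ℤ)) * (d : ℤ) ^ 8))
      = 21 * coeff n (phi 3) + (-50) * coeff n (phi 5) + 42 * coeff n (phi 7)
          + (-13) * coeff n (phi 11) := by
    rw [Finset.mul_sum]
    simp only [phi, coeff_mk]
    rw [Finset.mul_sum, Finset.mul_sum, Finset.mul_sum, Finset.mul_sum,
        ← Finset.sum_add_distrib, ← Finset.sum_add_distrib, ← Finset.sum_add_distrib]
    exact Finset.sum_congr rfl fun d _ => by linear_combination e3 d d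
  simp only [map_add, map_sub, map_neg, neg_mul, coeff_ofNat_mul]
  linear_combination 90 * h - e4

end Convolutions

/-! ### Ramanujan's differential equations and the discriminant. -/

section Eisenstein

/-- The Eisenstein series of weight two. -/
noncomputable def eisenTwo : ℤ⟦X⟧ := 1 - 24 * phi 1

/-- The Eisenstein series of weight four. -/
noncomputable def eisenFour : ℤ⟦X⟧ := 1 + 240 * phi 3

/-- The Eisenstein series of weight six. -/
noncomputable def eisenSix : ℤ⟦X⟧ := 1 - 504 * phi 5

theorem qD_ofNat_mul {S : Type*} [CommRing S] (a : ℕ) [a.AtLeastTwo] (F : S⟦X⟧) :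
    qD S ((ofNat(a) : S⟦X⟧) * F) = ofNat(a) * qD S F := by
  ext n
  rw [coeff_qD, coeff_ofNat_mul, coeff_ofNat_mul, coeff_qD]; ring

theorem qD_eisenTwo : 12 * qD _ eisenTwo = eisenTwo ^ 2 - eisenFour := by
  rw [eisenTwo, eisenFour, map_sub, qD_one, qD_ofNat_mul]
  linear_combination 48 * liouville_two

theorem qD_eisenFour : 3 * qD _ eisenFour = eisenTwo * eisenFour - eisenSix := by
  rw [eisenTwo, eisenFour, eisenSix, map_add, qD_one, qD_ofNat_mul]
  linear_combination -24 * liouville_four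

/-- `liouville_six` mixes `phi 1 * phi 5` with the square of `phi 3`; `liouville_mul_four`
eliminates the latter. -/
theorem qD_eisenSix : 2 * qD _ eisenSix = eisenTwo * eisenSix - eisenFour ^ 2 := by
  rw [eisenTwo, eisenFour, eisenSix, map_sub, qD_one, qD_ofNat_mul]
  linear_combination 12 * liouville_six + 648 * liouville_mul_four

theorem phi_seven_eq : 1 + 480 * phi 7 = eisenFour ^ 2 := by
  rw [eisenFour]
  linear_combination -480 * liouville_mul_four

theorem phi_nine_eq : 1 - 264 * phi 9 = eisenFour * eisenSix := by
  rw [eisenFour, eisenSix]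
  linear_combination 24 * liouville_mul_six

/-- The expression of 691 times the weight-12 Eisenstein series. The square of `phi 5` comes from
`liouville_mul_eight`, and `phi 7` is removed by `liouville_mul_four`. -/
theorem phi_eleven_eq : 691 + 65520 * phi 11 = 441 * eisenFour ^ 3 + 250 * eisenSix ^ 2 := by
  rw [eisenFour, eisenSix]
  linear_combination -5040 * liouville_mul_eight
    - (50803200 * phi 3 + 211680) * liouville_mul_four

theorem qD_pow {S : Type*} [CommRing S] (f : S⟦X⟧) (n : ℕ) :
    qD S (f ^ (n + 1)) = ((n : S⟦X⟧) + 1) * (f ^ n * qD S f) := by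
  induction n with
  | zero => simp
  | succ n ih =>
    rw [pow_succ, qD_mul, ih]; push_cast; ring

theorem qD_discriminant : qD _ (eisenFour ^ 3 - eisenSix ^ 2)
    = eisenTwo * (eisenFour ^ 3 - eisenSix ^ 2) := by
  rw [map_sub, qD_pow _ 2, qD_pow _ 1]
  push_cast
  linear_combination eisenFour ^ 2 * qD_eisenFour - eisenSix * qD_eisenSix

theorem coeff_zero_phi (k : ℕ) : coeff 0 (phi k) = 0 := by simp [phi, -coeff_zero_eq_constantCoeff]

theorem coeff_one_phi (k : ℕ) : coeff 1 (phi k) = 1 := by simp [phi]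

/-- The discriminant has logarithmic derivative E₂ = 1 - 24 `phi 1` and `partSeries ^ 24` has 24
`phi 1`, so the product W satisfies D W = W. Hence only the coefficient of q is nonzero, and it is 3
· 240 + 2 · 504 = 1728. -/
theorem discriminant_mul_partSeries :
    (eisenFour ^ 3 - eisenSix ^ 2) * partSeries ^ 24 = 1728 * X := by
  set W := (eisenFour ^ 3 - eisenSix ^ 2) * partSeries ^ 24 with hW
  have hD : qD _ W = W := by
    rw [hW, qD_mul, qD_discriminant, qD_pow _ 23, qD_partSeries, eisenTwo]
    push_cast
    ring
  have h4 : coeff 0 eisenFour = 1 := by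
    rw [eisenFour, map_add, coeff_ofNat_mul, coeff_zero_phi]; simp
  have h6 : coeff 0 eisenSix = 1 := by
    rw [eisenSix, map_sub, coeff_ofNat_mul, coeff_zero_phi]; simp
  have h4' : coeff 1 eisenFour = 240 := by
    rw [eisenFour, map_add, coeff_ofNat_mul, coeff_one_phi]; simp [coeff_one]
  have h6' : coeff 1 eisenSix = -504 := by
    rw [eisenSix, map_sub, coeff_ofNat_mul, coeff_one_phi]; simp [coeff_one]
  have hP : coeff 0 partSeries = 1 := by rw [coeff_partSeries]; simp
  rw [coeff_zero_eq_constantCoeff_apply] at h4 h6 hP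
  ext n
  have hn := congrArg (coeff n) hD
  rw [coeff_qD] at hn
  rw [coeff_ofNat_mul, coeff_X]
  split_ifs with h
  · subst h
    have h7 : coeff 1 (eisenFour ^ 3 - eisenSix ^ 2) = 1728 := by
      rw [map_sub, pow_succ, pow_two, pow_two, coeff_one_mul, coeff_one_mul, coeff_one_mul,
        map_mul, h4, h6, h4', h6']
      norm_num
    rw [hW, coeff_one_mul, h7]
    simp [h4, h6, hP]
  · have h8 : ((n : ℤ) - 1) * coeff n W = 0 := by linear_combination hn
    rcases mul_eq_zero.1 h8 with h9 | h9
    · omega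
    · rw [h9, mul_zero]

theorem discriminant_mul_partSeries_eq : (eisenFour ^ 3 - eisenSix ^ 2) * partSeries
    = 1728 * (X * euler ^ 23) := by
  have h : (partSeries * euler) ^ 23 = 1 := by rw [partSeries_mul_euler, one_pow]
  linear_combination euler ^ 23 * discriminant_mul_partSeries
    - (eisenFour ^ 3 - eisenSix ^ 2) * partSeries * h

end Eisenstein

/-! ### Polynomial identities in E₂, E₄, E₆ modulo 23. -/

section Reduction

/-- Reduction of power series modulo `23`. -/
noncomputable def red : ℤ⟦X⟧ →+* (ZMod 23)⟦X⟧ := PowerSeries.map (Int.castRingHom (ZMod 23))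

/-- The reduction of the Eisenstein series of weight two. -/
noncomputable def redTwo : (ZMod 23)⟦X⟧ := red eisenTwo

/-- The reduction of the Eisenstein series of weight four. -/
noncomputable def redFour : (ZMod 23)⟦X⟧ := red eisenFour

/-- The reduction of the Eisenstein series of weight six. -/
noncomputable def redSix : (ZMod 23)⟦X⟧ := red eisenSix

theorem red_eisenTwo : red eisenTwo = redTwo := rfl

theorem red_eisenFour : red eisenFour = redFour := rfl

theorem red_eisenSix : red eisenSix = redSix := rfl

theorem coeff_red (n : ℕ) (f : ℤ⟦X⟧) : coeff n (red f) = ((coeff n f : ℤ) : ZMod 23) := by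
  simp [red]

theorem red_qD (f : ℤ⟦X⟧) : red (qD _ f) = qD _ (red f) := by
  ext n
  rw [coeff_red, coeff_qD, coeff_qD, coeff_red]; push_cast; rfl

/-- The identities below hold over the integers up to multiples of 23; the cofactor of `series_char`
in each `linear_combination` records those multiples. -/
theorem series_char : (23 : (ZMod 23)⟦X⟧) = 0 := by
  rw [← map_ofNat (C (R := ZMod 23)) 23, show (OfNat.ofNat 23 : ZMod 23) = 0 from rfl, map_zero]

theorem qD_ofNat {S : Type*} [CommRing S] (a : ℕ) [a.AtLeastTwo] :
    qD S (ofNat(a) : S⟦X⟧) = 0 := by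
  have h := qD_ofNat_mul (S := S) a 1
  rwa [mul_one, qD_one, mul_zero] at h

theorem red_phi_one : red (phi 1) = -redTwo + 1 := by
  have h := congrArg red eisenTwo.eq_1
  simp only [map_add, map_sub, map_mul, map_pow, map_one, map_ofNat, red_eisenTwo,
    red_eisenFour, red_eisenSix] at h
  linear_combination (1) * h + (-red (phi 1)) * series_char

/-- 7 is the inverse of 240 modulo 23. The other divisor-sum series are solved for in the same way,
since their leading factors are units modulo 23. -/
theorem red_phi_three : red (phi 3) = 7 * redFour - 7 := by
  have h := congrArg red eisenFour.eq_1
  simp only [map_add, map_sub, map_mul, map_pow, map_one, map_ofNat, red_eisenTwo,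
    red_eisenFour, red_eisenSix] at h
  linear_combination (-7) * h + (-73 * red (phi 3)) * series_char

theorem red_phi_five : red (phi 5) = 12 * redSix - 12 := by
  have h := congrArg red eisenSix.eq_1
  simp only [map_add, map_sub, map_mul, map_pow, map_one, map_ofNat, red_eisenTwo,
    red_eisenFour, red_eisenSix] at h
  linear_combination (11) * h + (-redSix - 241 * red (phi 5) + 1) * series_char

theorem red_phi_seven : red (phi 7) = 15 * redFour ^ 2 - 15 := by
  have h := congrArg red phi_seven_eq
  simp only [map_add, map_sub, map_mul, map_pow, map_one, map_ofNat, red_eisenTwo,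
    red_eisenFour, red_eisenSix] at h
  linear_combination (-8) * h + (-redFour ^ 2 + 167 * red (phi 7) + 1) * series_char

theorem red_phi_nine : red (phi 9) = -21 * redFour * redSix + 21 := by
  have h := congrArg red phi_nine_eq
  simp only [map_add, map_sub, map_mul, map_pow, map_one, map_ofNat, red_eisenTwo,
    red_eisenFour, red_eisenSix] at h
  linear_combination (2) * h + (redFour * redSix + 23 * red (phi 9) - 1) * series_char

theorem red_phi_eleven : red (phi 11) = 52 * redFour ^ 3 + 260 * redSix ^ 2 - 13 := by
  have h := congrArg red phi_eleven_eq
  simp only [map_add, map_sub, map_mul, map_pow, map_one, map_ofNat, red_eisenTwo,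
    red_eisenFour, red_eisenSix] at h
  linear_combination (-10) * h + (-194 * redFour ^ 3 - 120 * redSix ^ 2 + 28487 * red (phi 11)
    + 301) * series_char

/-- Ramanujan's equations solved for the derivatives: 2, 8 and 12 are the inverses of 12, 3 and 2
modulo 23. -/
theorem qD_redTwo : qD _ redTwo = 2 * redTwo ^ 2 - 2 * redFour := by
  have h := congrArg red qD_eisenTwo
  simp only [map_sub, map_mul, map_pow, map_ofNat, red_qD, red_eisenTwo,
    red_eisenFour, red_eisenSix] at h
  linear_combination (2) * h + (-qD _ redTwo) * series_char

theorem qD_redFour : qD _ redFour = 8 * redTwo * redFour - 8 * redSix := by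
  have h := congrArg red qD_eisenFour
  simp only [map_sub, map_mul, map_pow, map_ofNat, red_qD, red_eisenTwo,
    red_eisenFour, red_eisenSix] at h
  linear_combination (8) * h + (-qD _ redFour) * series_char

theorem qD_redSix : qD _ redSix = 12 * redTwo * redSix - 12 * redFour ^ 2 := by
  have h := congrArg red qD_eisenSix
  simp only [map_sub, map_mul, map_pow, map_ofNat, red_qD, red_eisenTwo,
    red_eisenFour, red_eisenSix] at h
  linear_combination (-11) * h + (-redTwo * redSix + redFour ^ 2 + qD _ redSix) * series_char

theorem qD_red_partSeries : qD _ (red partSeries) = (1 - redTwo) * red partSeries := by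
  rw [← red_qD, qD_partSeries, map_mul, red_phi_one]
  ring

/-- This begins the explicit evaluation of the moments as `partSeries` times polynomials in E₂, E₄,
E₆: the moment recursion is unrolled one order at a time and coefficients are reduced modulo 23. -/
theorem red_moment_two_crankProd : red (moment 2 crankProd)
    = red partSeries * (21 * redTwo + 2) := by
  have h : moment 2 crankProd = 2 * (phi 1 * moment 0 crankProd) := by
    have h := moment_succ_crankProd 1
    simp only [Finset.sum_range_succ, Finset.sum_range_zero] at h
    norm_num [Nat.choose] at h
    linear_combination h
  simp only [h, map_add, map_mul, map_ofNat, red_phi_one, moment_zero_crankProd]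
  linear_combination (-redTwo * red partSeries) * series_char

theorem red_moment_four_crankProd : red (moment 4 crankProd)
    = red partSeries * (12 * redTwo ^ 2 + 22 * redTwo + 14 * redFour + 21) := by
  have h : moment 4 crankProd = 6 * (phi 1 * moment 2 crankProd)
      + 2 * (phi 3 * moment 0 crankProd) := by
    have h := moment_succ_crankProd 3
    simp only [Finset.sum_range_succ, Finset.sum_range_zero] at h
    norm_num [Nat.choose] at h
    linear_combination h
  simp only [h, map_add, map_mul, map_ofNat, red_phi_one, red_phi_three, moment_zero_crankProd,
    red_moment_two_crankProd]
  linear_combination (-6 * redTwo ^ 2 * red partSeries + 4 * redTwo * red partSeries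
    - red partSeries) * series_char

theorem red_moment_six_crankProd : red (moment 6 crankProd)
    = red partSeries * (18 * redTwo ^ 3 + 17 * redTwo * redFour
    + 15 * redTwo ^ 2 + 14 * redTwo + 6 * redFour + redSix + 21) := by
  have h : moment 6 crankProd = 10 * (phi 1 * moment 4 crankProd)
      + 20 * (phi 3 * moment 2 crankProd) + 2 * (phi 5 * moment 0 crankProd) := by
    have h := moment_succ_crankProd 5
    simp only [Finset.sum_range_succ, Finset.sum_range_zero] at h
    norm_num [Nat.choose] at h
    linear_combination h
  simp only [h, map_add, map_mul, map_ofNat, red_phi_one, red_phi_three, red_phi_five,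
    moment_zero_crankProd, red_moment_four_crankProd, red_moment_two_crankProd]
  linear_combination (-6 * redTwo ^ 3 * red partSeries
    + 121 * redTwo * redFour * red partSeries - 5 * redTwo ^ 2 * red partSeries
    - 128 * redTwo * red partSeries + 18 * redFour * red partSeries + redSix * red partSeries
    - 5 * red partSeries) * series_char

theorem red_moment_eight_crankProd : red (moment 8 crankProd)
    = red partSeries * (redTwo ^ 4 + 7 * redTwo ^ 2 * redFour
    + 19 * redTwo ^ 3 + 9 * redTwo * redFour + 13 * redTwo * redSix + 22 * redTwo ^ 2
    + 13 * redFour ^ 2 + 20 * redTwo + 18 * redFour + 10 * redSix + 6) := by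
  have h : moment 8 crankProd = 14 * (phi 1 * moment 6 crankProd)
      + 70 * (phi 3 * moment 4 crankProd) + 42 * (phi 5 * moment 2 crankProd)
      + 2 * (phi 7 * moment 0 crankProd) := by
    have h := moment_succ_crankProd 7
    simp only [Finset.sum_range_succ, Finset.sum_range_zero] at h
    norm_num [Nat.choose] at h
    linear_combination h
  simp only [h, map_add, map_mul, map_ofNat, red_phi_one, red_phi_three, red_phi_five,
    red_phi_seven, moment_zero_crankProd, red_moment_six_crankProd, red_moment_four_crankProd,
    red_moment_two_crankProd]
  linear_combination (-11 * redTwo ^ 4 * red partSeries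
    + 245 * redTwo ^ 2 * redFour * red partSeries + redTwo ^ 3 * red partSeries
    + 475 * redTwo * redFour * red partSeries + 459 * redTwo * redSix * red partSeries
    - 256 * redTwo ^ 2 * red partSeries + 299 * redFour ^ 2 * red partSeries
    - 934 * redTwo * red partSeries + 152 * redFour * red partSeries
    + 44 * redSix * red partSeries - 480 * red partSeries) * series_char

theorem red_moment_ten_crankProd : red (moment 10 crankProd)
    = red partSeries * (5 * redTwo ^ 5 + 20 * redTwo ^ 3 * redFour
    + 21 * redTwo ^ 4 + 3 * redTwo * redFour ^ 2 + 9 * redTwo ^ 2 * redFour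
    + 13 * redTwo ^ 2 * redSix + 7 * redTwo ^ 3 + 13 * redTwo * redFour + 20 * redTwo * redSix
    + 20 * redTwo ^ 2 + 20 * redFour ^ 2 + 12 * redTwo + 8 * redFour + 17 * redSix + 19) := by
  have h : moment 10 crankProd = 18 * (phi 1 * moment 8 crankProd)
      + 168 * (phi 3 * moment 6 crankProd) + 252 * (phi 5 * moment 4 crankProd)
      + 72 * (phi 7 * moment 2 crankProd) + 2 * (phi 9 * moment 0 crankProd) := by
    have h := moment_succ_crankProd 9
    simp only [Finset.sum_range_succ, Finset.sum_range_zero] at h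
    norm_num [Nat.choose] at h
    linear_combination h
  simp only [h, map_add, map_mul, map_ofNat, red_phi_one, red_phi_three, red_phi_five,
    red_phi_seven, red_phi_nine, moment_zero_crankProd, red_moment_eight_crankProd,
    red_moment_six_crankProd, red_moment_four_crankProd, red_moment_two_crankProd]
  linear_combination (-redTwo ^ 5 * red partSeries
    + 914 * redTwo ^ 3 * redFour * red partSeries - 15 * redTwo ^ 4 * red partSeries
    + 1845 * redTwo * redFour ^ 2 * red partSeries
    + 765 * redTwo ^ 2 * redFour * red partSeries + 1567 * redTwo ^ 2 * redSix * red partSeries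
    - 923 * redTwo ^ 3 * red partSeries - 161 * redTwo * redFour * red partSeries
    + 2894 * redTwo * redSix * red partSeries - 2344 * redTwo ^ 2 * red partSeries
    + 1890 * redFour * redSix * red partSeries + 410 * redFour ^ 2 * red partSeries
    - 4584 * redTwo * red partSeries - 1060 * redFour * red partSeries
    + 2717 * redSix * red partSeries - 3923 * red partSeries) * series_char

theorem red_moment_twelve_crankProd : red (moment 12 crankProd)
    = red partSeries * (5 * redTwo ^ 6 + 7 * redTwo ^ 4 * redFour
    + 16 * redTwo ^ 5 + 9 * redTwo ^ 2 * redFour ^ 2 + 18 * redTwo ^ 3 * redFour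
    + 3 * redTwo ^ 3 * redSix + 22 * redTwo ^ 4 + 5 * redTwo * redFour ^ 2
    + 16 * redTwo ^ 2 * redFour + 14 * redTwo ^ 2 * redSix + 17 * redTwo ^ 3 + 6 * redFour ^ 3
    + 2 * redTwo * redFour + 10 * redTwo * redSix + 13 * redTwo ^ 2 + 10 * redFour ^ 2
    + 16 * redSix ^ 2 + 22 * redTwo + 19 * redFour + 15 * redSix + 8) := by
  have h : moment 12 crankProd = 22 * (phi 1 * moment 10 crankProd)
      + 330 * (phi 3 * moment 8 crankProd) + 924 * (phi 5 * moment 6 crankProd)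
      + 660 * (phi 7 * moment 4 crankProd) + 110 * (phi 9 * moment 2 crankProd)
      + 2 * (phi 11 * moment 0 crankProd) := by
    have h := moment_succ_crankProd 11
    simp only [Finset.sum_range_succ, Finset.sum_range_zero] at h
    norm_num [Nat.choose] at h
    linear_combination h
  simp only [h, map_add, map_mul, map_ofNat, red_phi_one, red_phi_three, red_phi_five,
    red_phi_seven, red_phi_nine, red_phi_eleven, moment_zero_crankProd, red_moment_ten_crankProd,
    red_moment_eight_crankProd, red_moment_six_crankProd, red_moment_four_crankProd,
    red_moment_two_crankProd]
  linear_combination (-5 * redTwo ^ 6 * red partSeries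
    + 81 * redTwo ^ 4 * redFour * red partSeries - 16 * redTwo ^ 5 * red partSeries
    + 5865 * redTwo ^ 2 * redFour ^ 2 * red partSeries
    + 1918 * redTwo ^ 3 * redFour * red partSeries
    + 8665 * redTwo ^ 3 * redSix * red partSeries - 88 * redTwo ^ 4 * red partSeries
    + 7392 * redTwo * redFour * redSix * red partSeries
    + 10357 * redTwo * redFour ^ 2 * red partSeries
    + 1502 * redTwo ^ 2 * redFour * red partSeries
    + 7224 * redTwo ^ 2 * redSix * red partSeries - 10599 * redTwo ^ 3 * red partSeries
    + 7336 * redFour ^ 3 * red partSeries - 7086 * redTwo * redFour * red partSeries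
    + 5446 * redTwo * redSix * red partSeries - 14599 * redTwo ^ 2 * red partSeries
    + 3696 * redFour * redSix * red partSeries + 9560 * redFour ^ 2 * red partSeries
    + 504 * redSix ^ 2 * red partSeries - 16126 * redTwo * red partSeries
    - 10117 * redFour * red partSeries + 8653 * redSix * red partSeries
    - 19548 * red partSeries) * series_char

theorem red_moment_two_crankCube : red (moment 2 crankCube)
    = red partSeries * (17 * redTwo + 6) := by
  have h : moment 2 crankCube = 6 * (phi 1 * moment 0 crankCube) := by
    have h := moment_succ_crankCube 1
    simp only [Finset.sum_range_succ, Finset.sum_range_zero] at h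
    norm_num [Nat.choose] at h
    linear_combination h
  simp only [h, map_add, map_mul, map_ofNat, red_phi_one, moment_zero_crankCube]
  linear_combination (-redTwo * red partSeries) * series_char

theorem red_moment_four_crankCube : red (moment 4 crankCube)
    = red partSeries * (16 * redTwo ^ 2 + 14 * redTwo + 19 * redFour + 20) := by
  have h : moment 4 crankCube = 18 * (phi 1 * moment 2 crankCube)
      + 6 * (phi 3 * moment 0 crankCube) := by
    have h := moment_succ_crankCube 3
    simp only [Finset.sum_range_succ, Finset.sum_range_zero] at h
    norm_num [Nat.choose] at h
    linear_combination h
  simp only [h, map_add, map_mul, map_ofNat, red_phi_one, red_phi_three, moment_zero_crankCube,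
    red_moment_two_crankCube]
  linear_combination (-14 * redTwo ^ 2 * red partSeries + 8 * redTwo * red partSeries
    + redFour * red partSeries + 2 * red partSeries) * series_char

theorem red_moment_six_crankCube : red (moment 6 crankCube)
    = red partSeries * (3 * redTwo ^ 3 + 15 * redTwo * redFour
    + 14 * redTwo ^ 2 + 17 * redTwo + 8 * redFour + 3 * redSix + 9) := by
  have h : moment 6 crankCube = 30 * (phi 1 * moment 4 crankCube)
      + 60 * (phi 3 * moment 2 crankCube) + 6 * (phi 5 * moment 0 crankCube) := by
    have h := moment_succ_crankCube 5
    simp only [Finset.sum_range_succ, Finset.sum_range_zero] at h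
    norm_num [Nat.choose] at h
    linear_combination h
  simp only [h, map_add, map_mul, map_ofNat, red_phi_one, red_phi_three, red_phi_five,
    moment_zero_crankCube, red_moment_four_crankCube, red_moment_two_crankCube]
  linear_combination (-21 * redTwo ^ 3 * red partSeries
    + 285 * redTwo * redFour * red partSeries + 2 * redTwo ^ 2 * red partSeries
    - 319 * redTwo * red partSeries + 134 * redFour * red partSeries
    + 3 * redSix * red partSeries - 87 * red partSeries) * series_char

theorem red_moment_eight_crankCube : red (moment 8 crankCube)
    = red partSeries * (12 * redTwo ^ 4 + 5 * redTwo ^ 2 * redFour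
    + 21 * redTwo ^ 3 + 13 * redTwo * redFour + 2 * redTwo * redSix + 21 * redTwo ^ 2
    + 6 * redFour ^ 2 + 6 * redTwo + 12 * redFour + 21 * redSix + 19) := by
  have h : moment 8 crankCube = 42 * (phi 1 * moment 6 crankCube)
      + 210 * (phi 3 * moment 4 crankCube) + 126 * (phi 5 * moment 2 crankCube)
      + 6 * (phi 7 * moment 0 crankCube) := by
    have h := moment_succ_crankCube 7
    simp only [Finset.sum_range_succ, Finset.sum_range_zero] at h
    norm_num [Nat.choose] at h
    linear_combination h
  simp only [h, map_add, map_mul, map_ofNat, red_phi_one, red_phi_three, red_phi_five,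
    red_phi_seven, moment_zero_crankCube, red_moment_six_crankCube, red_moment_four_crankCube,
    red_moment_two_crankCube]
  linear_combination (-6 * redTwo ^ 4 * red partSeries
    + 995 * redTwo ^ 2 * redFour * red partSeries - 21 * redTwo ^ 3 * red partSeries
    + 907 * redTwo * redFour * red partSeries + 1112 * redTwo * redSix * red partSeries
    - 1029 * redTwo ^ 2 * red partSeries + 1218 * redFour ^ 2 * red partSeries
    - 1998 * redTwo * red partSeries + 78 * redFour * red partSeries
    + 399 * redSix * red partSeries - 1661 * red partSeries) * series_char

theorem red_moment_ten_crankCube : red (moment 10 crankCube)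
    = red partSeries * (19 * redTwo ^ 5 + 10 * redTwo ^ 3 * redFour
    + 20 * redTwo ^ 4 + 13 * redTwo * redFour ^ 2 + 16 * redTwo ^ 2 * redFour
    + 6 * redTwo ^ 2 * redSix + 19 * redTwo ^ 3 + 3 * redTwo * redFour + 11 * redTwo * redSix
    + 18 * redTwo ^ 2 + 22 * redFour * redSix + 10 * redFour ^ 2 + 22 * redTwo + 7 * redFour
    + 19 * redSix + 15) := by
  have h : moment 10 crankCube = 54 * (phi 1 * moment 8 crankCube)
      + 504 * (phi 3 * moment 6 crankCube) + 756 * (phi 5 * moment 4 crankCube)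
      + 216 * (phi 7 * moment 2 crankCube) + 6 * (phi 9 * moment 0 crankCube) := by
    have h := moment_succ_crankCube 9
    simp only [Finset.sum_range_succ, Finset.sum_range_zero] at h
    norm_num [Nat.choose] at h
    linear_combination h
  simp only [h, map_add, map_mul, map_ofNat, red_phi_one, red_phi_three, red_phi_five,
    red_phi_seven, red_phi_nine, moment_zero_crankCube, red_moment_eight_crankCube,
    red_moment_six_crankCube, red_moment_four_crankCube, red_moment_two_crankCube]
  linear_combination (-29 * redTwo ^ 5 * red partSeries
    + 448 * redTwo ^ 3 * redFour * red partSeries - 22 * redTwo ^ 4 * red partSeries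
    + 4681 * redTwo * redFour ^ 2 * red partSeries
    + 2128 * redTwo ^ 2 * redFour * red partSeries
    + 6306 * redTwo ^ 2 * redSix * red partSeries - 461 * redTwo ^ 3 * red partSeries
    + 309 * redTwo * redFour * red partSeries + 5477 * redTwo * redSix * red partSeries
    - 8424 * redTwo ^ 2 * red partSeries + 7948 * redFour * redSix * red partSeries
    + 2086 * redFour ^ 2 * red partSeries - 10556 * redTwo * red partSeries
    - 7313 * redFour * red partSeries + 7477 * redSix * red partSeries
    - 10065 * red partSeries) * series_char

theorem red_moment_twelve_crankCube : red (moment 12 crankCube)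
    = red partSeries * (11 * redTwo ^ 6 + 22 * redTwo ^ 4 * redFour
    + 3 * redTwo ^ 5 + 2 * redTwo ^ 2 * redFour ^ 2 + 4 * redTwo ^ 3 * redFour
    + 13 * redTwo ^ 3 * redSix + 5 * redTwo ^ 4 + 5 * redTwo * redFour * redSix
    + 19 * redTwo * redFour ^ 2 + 4 * redTwo ^ 2 * redFour + 7 * redTwo ^ 2 * redSix
    + 16 * redTwo ^ 3 + 4 * redFour ^ 3 + 11 * redTwo * redFour + 20 * redTwo * redSix
    + 14 * redTwo ^ 2 + 18 * redFour * redSix + 14 * redFour ^ 2 + 14 * redSix ^ 2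
    + 17 * redTwo + 8 * redFour + 16 * redSix + 6) := by
  have h : moment 12 crankCube = 66 * (phi 1 * moment 10 crankCube)
      + 990 * (phi 3 * moment 8 crankCube) + 2772 * (phi 5 * moment 6 crankCube)
      + 1980 * (phi 7 * moment 4 crankCube) + 330 * (phi 9 * moment 2 crankCube)
      + 6 * (phi 11 * moment 0 crankCube) := by
    have h := moment_succ_crankCube 11
    simp only [Finset.sum_range_succ, Finset.sum_range_zero] at h
    norm_num [Nat.choose] at h
    linear_combination h
  simp only [h, map_add, map_mul, map_ofNat, red_phi_one, red_phi_three, red_phi_five,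
    red_phi_seven, red_phi_nine, red_phi_eleven, moment_zero_crankCube, red_moment_ten_crankCube,
    red_moment_eight_crankCube, red_moment_six_crankCube, red_moment_four_crankCube,
    red_moment_two_crankCube]
  linear_combination (-55 * redTwo ^ 6 * red partSeries
    + 3586 * redTwo ^ 4 * redFour * red partSeries - 3 * redTwo ^ 5 * red partSeries
    + 22130 * redTwo ^ 2 * redFour ^ 2 * red partSeries
    + 6310 * redTwo ^ 3 * redFour * red partSeries
    + 4321 * redTwo ^ 3 * redSix * red partSeries - 3613 * redTwo ^ 4 * red partSeries
    + 17111 * redTwo * redFour * redSix * red partSeries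
    + 22003 * redTwo * redFour ^ 2 * red partSeries
    + 4858 * redTwo ^ 2 * redFour * red partSeries
    + 20233 * redTwo ^ 2 * redSix * red partSeries - 10664 * redTwo ^ 3 * red partSeries
    + 26356 * redFour ^ 3 * red partSeries - 23815 * redTwo * redFour * red partSeries
    + 23960 * redTwo * redSix * red partSeries - 47248 * redTwo ^ 2 * red partSeries
    + 16152 * redFour * redSix * red partSeries + 27662 * redFour ^ 2 * red partSeries
    + 4406 * redSix ^ 2 * red partSeries - 39331 * redTwo * red partSeries
    - 33976 * redFour * red partSeries + 2404 * redSix * red partSeries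
    - 42720 * red partSeries) * series_char

/-- The power series whose coefficients are the combinations of moments, modulo `23`. -/
noncomputable def momentCombination : (ZMod 23)⟦X⟧ :=
  qD _ (qD _ (qD _ (qD _ (qD _ (4 * red (moment 2 crankProd)) + (15 * red (moment 2 crankCube)
    + 8 * red (moment 4 crankCube) + 8 * red (moment 2 crankProd)
    + 10 * red (moment 4 crankProd))) + (20 * red (moment 2 crankCube)
    + 14 * red (moment 4 crankCube) + 12 * red (moment 6 crankCube)
    + 14 * red (moment 2 crankProd) + 2 * red (moment 4 crankProd)
    + 13 * red (moment 6 crankProd))) + (6 * red (moment 2 crankCube)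
    + 19 * red (moment 4 crankCube) + 2 * red (moment 6 crankCube)
    + 19 * red (moment 8 crankCube) + red (moment 2 crankProd) + 8 * red (moment 4 crankProd)
    + red (moment 6 crankProd) + 5 * red (moment 8 crankProd)))
    + (9 * red (moment 10 crankCube) + 7 * red (moment 2 crankCube)
    + 22 * red (moment 4 crankCube) + 3 * red (moment 6 crankCube)
    + 5 * red (moment 8 crankCube) + 15 * red (moment 10 crankProd)
    + 14 * red (moment 2 crankProd) + 21 * red (moment 4 crankProd)
    + 7 * red (moment 8 crankProd))) + (12 * red (moment 10 crankCube)
    + 18 * red (moment 12 crankCube) + 9 * red (moment 2 crankCube)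
    + 12 * red (moment 4 crankCube) + 15 * red (moment 6 crankCube)
    + 3 * red (moment 8 crankCube) + 9 * red (moment 10 crankProd) + red (moment 12 crankProd)
    + 12 * red (moment 2 crankProd) + 22 * red (moment 4 crankProd) + 6 * red (moment 6 crankProd))

/-- The combination is a polynomial in `qD` in Horner form, evaluated from the innermost bracket
outwards (`h5` down to `h0`). Each stage is `partSeries` times a polynomial in E₂, E₄, E₆, because
`qD` preserves that shape. In the last stage everything of weight below 12, and everything involving
E₂, cancels. -/
theorem momentCombination_eq :
    momentCombination = 8 * (red partSeries * (redFour ^ 3 - redSix ^ 2)) := by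
  have h5 : 4 * red (moment 2 crankProd)
      = red partSeries * (15 * redTwo + 8) := by
    simp only [red_moment_two_crankProd]
    linear_combination (3 * redTwo * red partSeries) * series_char
  have h4 : qD _ (red partSeries * (15 * redTwo + 8))
      + (15 * red (moment 2 crankCube) + 8 * red (moment 4 crankCube)
        + 8 * red (moment 2 crankProd) + 10 * red (moment 4 crankProd))
      = red partSeries * (10 * redTwo * redTwo + 3 * redTwo + 9 * redFour + 1) := by
    simp only [qD_mul, map_add, qD_ofNat_mul, qD_ofNat, qD_one, qD_redTwo, qD_redFour, qD_redSix,
        qD_red_partSeries, red_moment_two_crankProd, red_moment_two_crankCube,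
        red_moment_four_crankProd, red_moment_four_crankCube]
    linear_combination (11 * redTwo ^ 2 * red partSeries + 33 * redTwo * red partSeries
        + 11 * redFour * red partSeries + 21 * red partSeries) * series_char
  have h3 : qD _ (red partSeries * (10 * redTwo * redTwo + 3 * redTwo + 9 * redFour + 1))
      + (20 * red (moment 2 crankCube) + 14 * red (moment 4 crankCube)
        + 12 * red (moment 6 crankCube) + 14 * red (moment 2 crankProd)
        + 2 * red (moment 4 crankProd) + 13 * red (moment 6 crankProd))
      = red partSeries * (redTwo * redTwo * redTwo + 10 * redTwo * redFour
        + 3 * redTwo * redTwo + 20 * redTwo + 11 * redFour + 1) := by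
    simp only [qD_mul, map_add, qD_ofNat_mul, qD_ofNat, qD_one, qD_redTwo, qD_redFour, qD_redSix,
        qD_red_partSeries, red_moment_two_crankProd, red_moment_two_crankCube,
        red_moment_four_crankProd, red_moment_four_crankCube, red_moment_six_crankProd,
        red_moment_six_crankCube]
    linear_combination (13 * redTwo ^ 3 * red partSeries
        + 18 * redTwo * redFour * red partSeries + 27 * redTwo ^ 2 * red partSeries
        + 54 * redTwo * red partSeries + 20 * redFour * red partSeries
        - redSix * red partSeries + 37 * red partSeries) * series_char
  have h2 : qD _ (red partSeries * (redTwo * redTwo * redTwo + 10 * redTwo * redFour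
        + 3 * redTwo * redTwo + 20 * redTwo + 11 * redFour + 1))
      + (6 * red (moment 2 crankCube) + 19 * red (moment 4 crankCube)
        + 2 * red (moment 6 crankCube) + 19 * red (moment 8 crankCube)
        + red (moment 2 crankProd) + 8 * red (moment 4 crankProd) + red (moment 6 crankProd)
        + 5 * red (moment 8 crankProd))
      = red partSeries * (8 * redTwo * redTwo * redTwo * redTwo + 7 * redTwo * redTwo * redFour
        + 22 * redTwo * redTwo * redTwo + 9 * redTwo * redTwo + 21 * redFour * redFour
        + 18 * redTwo + 2 * redFour + 5) := by
    simp only [qD_mul, map_add, qD_ofNat_mul, qD_ofNat, qD_one, qD_redTwo, qD_redFour, qD_redSix,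
        qD_red_partSeries, red_moment_two_crankProd, red_moment_two_crankCube,
        red_moment_four_crankProd, red_moment_four_crankCube, red_moment_six_crankProd,
        red_moment_six_crankCube, red_moment_eight_crankProd, red_moment_eight_crankCube]
    linear_combination (10 * redTwo ^ 4 * red partSeries
        + 9 * redTwo ^ 2 * redFour * red partSeries + 22 * redTwo ^ 3 * red partSeries
        + 18 * redTwo * redFour * red partSeries + redTwo * redSix * red partSeries
        + 42 * redTwo ^ 2 * red partSeries + 6 * redFour ^ 2 * red partSeries
        + 36 * redTwo * red partSeries + 34 * redFour * red partSeries
        + 16 * redSix * red partSeries + 44 * red partSeries) * series_char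
  have h1 : qD _ (red partSeries * (8 * redTwo * redTwo * redTwo * redTwo
        + 7 * redTwo * redTwo * redFour + 22 * redTwo * redTwo * redTwo + 9 * redTwo * redTwo
        + 21 * redFour * redFour + 18 * redTwo + 2 * redFour + 5))
      + (9 * red (moment 10 crankCube) + 7 * red (moment 2 crankCube)
        + 22 * red (moment 4 crankCube) + 3 * red (moment 6 crankCube)
        + 5 * red (moment 8 crankCube) + 15 * red (moment 10 crankProd)
        + 14 * red (moment 2 crankProd) + 21 * red (moment 4 crankProd)
        + 7 * red (moment 8 crankProd))
      = red partSeries * (3 * redTwo * redTwo * redTwo * redTwo * redTwo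
        + 12 * redTwo * redTwo * redTwo * redFour + 13 * redTwo * redTwo * redTwo * redTwo
        + 12 * redTwo * redFour * redFour + 21 * redTwo * redTwo * redFour
        + 9 * redTwo * redTwo * redSix + 20 * redTwo * redTwo * redTwo + 5 * redTwo * redFour
        + 17 * redTwo * redSix + 14 * redTwo * redTwo + 3 * redFour * redFour + redTwo
        + 13 * redFour + 19 * redSix + 22) := by
    simp only [qD_mul, map_add, qD_ofNat_mul, qD_ofNat, qD_one, qD_redTwo, qD_redFour, qD_redSix,
        qD_red_partSeries, red_moment_two_crankProd, red_moment_two_crankCube,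
        red_moment_four_crankProd, red_moment_four_crankCube, red_moment_six_crankCube,
        red_moment_eight_crankProd, red_moment_eight_crankCube, red_moment_ten_crankProd,
        red_moment_ten_crankCube]
    linear_combination (13 * redTwo ^ 5 * red partSeries
        + 17 * redTwo ^ 3 * redFour * red partSeries + 29 * redTwo ^ 4 * red partSeries
        + 19 * redTwo * redFour ^ 2 * red partSeries
        + 9 * redTwo ^ 2 * redFour * red partSeries + 8 * redTwo ^ 2 * redSix * red partSeries
        + 24 * redTwo ^ 3 * red partSeries + 16 * redTwo * redFour * red partSeries
        + 21 * redTwo * redSix * red partSeries + 60 * redTwo ^ 2 * red partSeries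
        - 6 * redFour * redSix * red partSeries + 23 * redFour ^ 2 * red partSeries
        + 78 * redTwo * red partSeries + 46 * redFour * red partSeries
        + 25 * redSix * red partSeries + 66 * red partSeries) * series_char
  have h0 : qD _ (red partSeries * (3 * redTwo * redTwo * redTwo * redTwo * redTwo
        + 12 * redTwo * redTwo * redTwo * redFour + 13 * redTwo * redTwo * redTwo * redTwo
        + 12 * redTwo * redFour * redFour + 21 * redTwo * redTwo * redFour
        + 9 * redTwo * redTwo * redSix + 20 * redTwo * redTwo * redTwo + 5 * redTwo * redFour
        + 17 * redTwo * redSix + 14 * redTwo * redTwo + 3 * redFour * redFour + redTwo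
        + 13 * redFour + 19 * redSix + 22))
      + (12 * red (moment 10 crankCube) + 18 * red (moment 12 crankCube)
        + 9 * red (moment 2 crankCube) + 12 * red (moment 4 crankCube)
        + 15 * red (moment 6 crankCube) + 3 * red (moment 8 crankCube)
        + 9 * red (moment 10 crankProd) + red (moment 12 crankProd)
        + 12 * red (moment 2 crankProd) + 22 * red (moment 4 crankProd)
        + 6 * red (moment 6 crankProd))
      = red partSeries * (8 * redFour * redFour * redFour + 15 * redSix * redSix) := by
    simp only [qD_mul, map_add, qD_ofNat_mul, qD_ofNat, qD_one, qD_redTwo, qD_redFour, qD_redSix,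
        qD_red_partSeries, red_moment_two_crankProd, red_moment_two_crankCube,
        red_moment_four_crankProd, red_moment_four_crankCube, red_moment_six_crankProd,
        red_moment_six_crankCube, red_moment_eight_crankCube, red_moment_ten_crankProd,
        red_moment_ten_crankCube, red_moment_twelve_crankProd, red_moment_twelve_crankCube]
    linear_combination (10 * redTwo ^ 6 * red partSeries
        + 23 * redTwo ^ 4 * redFour * red partSeries + 19 * redTwo ^ 5 * red partSeries
        + 3 * redTwo ^ 2 * redFour ^ 2 * red partSeries
        + 23 * redTwo ^ 3 * redFour * red partSeries
        + 12 * redTwo ^ 3 * redSix * red partSeries + 30 * redTwo ^ 4 * red partSeries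
        - 6 * redTwo * redFour * redSix * red partSeries
        + 13 * redTwo * redFour ^ 2 * red partSeries
        + 14 * redTwo ^ 2 * redFour * red partSeries
        + 17 * redTwo ^ 2 * redSix * red partSeries + 38 * redTwo ^ 3 * red partSeries
        + 2 * redFour ^ 3 * red partSeries + 33 * redTwo * redFour * red partSeries
        + 38 * redTwo * redSix * red partSeries + 65 * redTwo ^ 2 * red partSeries
        + 22 * redFour * redSix * red partSeries + 15 * redFour ^ 2 * red partSeries
        + 11 * redSix ^ 2 * red partSeries + 91 * redTwo * red partSeries
        + 46 * redFour * red partSeries + 31 * redSix * red partSeries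
        + 69 * red partSeries) * series_char
  rw [momentCombination, h5, h4, h3, h2, h1, h0]
  -- The last bracket ends with coefficients 8 and 15, and 15 ≡ -8 modulo 23.
  linear_combination (red partSeries * redSix ^ 2) * series_char

/-- Here x stands for n, and m, k, r for the moments of `crankProd`, `crankCube` and `rankSeries`.
The multipliers of the k's are chosen so that the rank moments of orders 0, 4, 6, 8 and 10 cancel
modulo 23. The moment of order 12 enters with coefficient 18 · 55 ≡ 1. -/
theorem linear_relation (x : ZMod 23) (m k r : ℕ → ZMod 23)
    (h2 : k 2 = 6 * r 0 * x)
    (h4 : k 4 = 6 * r 0 * x + 36 * r 2 * x - 3 * r 2 + 3 * r 4)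
    (h6 : k 6 = 6 * r 0 * x + 90 * r 2 * x + 90 * r 4 * x - 5 * r 2 - 5 * r 4 + 10 * r 6)
    (h8 : k 8 = 6 * r 0 * x + 168 * r 2 * x + 420 * r 4 * x + 168 * r 6 * x - 7 * r 2
        - 28 * r 4 + 14 * r 6
      + 21 * r 8)
    (h10 : k 10 = 6 * r 0 * x + 270 * r 2 * x + 1260 * r 4 * x + 1260 * r 6 * x
        + 270 * r 8 * x + 36 * r 10
      - 9 * r 2 - 75 * r 4 - 42 * r 6 + 90 * r 8)
    (h12 : k 12 = 6 * r 0 * x + 396 * r 10 * x + 396 * r 2 * x + 2970 * r 4 * x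
        + 5544 * r 6 * x + 2970 * r 8 * x
      + 275 * r 10 + 55 * r 12 - 11 * r 2 - 154 * r 4 - 297 * r 6 + 132 * r 8) :
    4 * (x ^ 2 + x + 14) * (x ^ 3 + x ^ 2 + 15) * m 2
      + (10 * x ^ 4 + 2 * x ^ 3 + 8 * x ^ 2 + 21 * x + 22) * m 4
      + 13 * (x + 18) * (x ^ 2 + 21 * x + 13) * m 6 + 5 * x * (x + 6) * m 8
      + 15 * (x + 19) * m 10 + m 12
      + 12 * (x + 10) * (x + 14) * (x + 19) * (x + 20) * (x + 21) * r 2 + r 12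
    = 4 * m 2 * x ^ 5 + 15 * k 2 * x ^ 4 + 8 * k 4 * x ^ 4 + 8 * m 2 * x ^ 4 + 10 * m 4 * x ^ 4
      + 20 * k 2 * x ^ 3 + 14 * k 4 * x ^ 3 + 12 * k 6 * x ^ 3 + 14 * m 2 * x ^ 3
      + 2 * m 4 * x ^ 3 + 13 * m 6 * x ^ 3 + 6 * k 2 * x ^ 2 + 19 * k 4 * x ^ 2
      + 2 * k 6 * x ^ 2 + 19 * k 8 * x ^ 2 + m 2 * x ^ 2 + 8 * m 4 * x ^ 2 + m 6 * x ^ 2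
      + 5 * m 8 * x ^ 2 + 9 * k 10 * x + 7 * k 2 * x + 22 * k 4 * x + 3 * k 6 * x + 5 * k 8 * x
      + 15 * m 10 * x + 14 * m 2 * x + 21 * m 4 * x + 7 * m 8 * x + 12 * k 10 + 18 * k 12
      + 9 * k 2 + 12 * k 4 + 15 * k 6 + 3 * k 8 + 9 * m 10 + m 12 + 12 * m 2 + 22 * m 4
          + 6 * m 6 := by
  have h : (23 : ZMod 23) = 0 := rfl
  linear_combination (5) * h12 + (14 * x + 11) * h10 + (4 * x ^ 2 + 18 * x + 20) * h8
    + (11 * x ^ 3 + 21 * x ^ 2 + 20 * x + 8) * h6 + (15 * x ^ 4 + 9 * x ^ 3 + 4 * x ^ 2 + x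
    + 11) * h4 - (15 * x ^ 4 + 20 * x ^ 3 + 29 * x ^ 2 + 53 * x + 55) * h2 + (24 * r 2 * x ^ 5
    - k 4 * x ^ 4 + 99 * r 2 * x ^ 4 + 45 * r 4 * x ^ 4 - k 4 * x ^ 3 - k 6 * x ^ 3
    + 2 * m 2 * x ^ 3 + 1564 * r 2 * x ^ 3 + 154 * r 4 * x ^ 3 + 34 * r 6 * x ^ 3 + k 2 * x ^ 2
    - k 4 * x ^ 2 - k 6 * x ^ 2 - k 8 * x ^ 2 + 5 * m 2 * x ^ 2 + 22 * m 6 * x ^ 2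
    + 23929 * r 2 * x ^ 2 + 1165 * r 4 * x ^ 2 + 910 * r 6 * x ^ 2 + 168 * r 8 * x ^ 2
    - k 10 * x + 2 * k 2 * x - k 4 * x - k 6 * x - k 8 * x + 2 * m 2 * x + 221 * m 6 * x
    + m 8 * x + 108 * r 10 * x + 187897 * r 2 * x + 1573 * r 4 * x + 1948 * r 6 * x
    + 846 * r 8 * x - k 10 - k 12 + 2 * k 2 - k 4 - k 6 - k 8 + 12 * m 10 + 36 * m 2
    + 132 * m 6 + 77 * r 10 + 12 * r 12 + 582871 * r 2 - 94 * r 4 - 69 * r 6 + 90 * r 8) * h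

/-- On the coefficient of q^n the operator `qD` is multiplication by n, so the Horner form expands
to the polynomial in x of `linear_relation`. -/
theorem coeff_momentCombination (n : ℕ) :
    let x : ℤ := n
    let M : ℕ → ℤ := fun j => PartitionStat.crankMoment j n
    let N : ℕ → ℤ := fun j => PartitionStat.rankMoment j n
    (((4 * (x ^ 2 + x + 14) * (x ^ 3 + x ^ 2 + 15) * M 2
      + (10 * x ^ 4 + 2 * x ^ 3 + 8 * x ^ 2 + 21 * x + 22) * M 4
      + 13 * (x + 18) * (x ^ 2 + 21 * x + 13) * M 6 + 5 * x * (x + 6) * M 8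
      + 15 * (x + 19) * M 10 + M 12
      + 12 * (x + 10) * (x + 14) * (x + 19) * (x + 20) * (x + 21) * N 2
          + N 12) : ℤ) : ZMod 23) = coeff n momentCombination := by
  intro x M N
  have h := linear_relation (n : ZMod 23) (fun j => ((coeff n (moment j crankProd) : ℤ) : ZMod 23))
    (fun j => ((coeff n (moment j crankCube) : ℤ) : ZMod 23))
    (fun j => ((coeff n (moment j rankSeries) : ℤ) : ZMod 23)) ?_ ?_ ?_ ?_ ?_ ?_
  · simp only [x, M, N, crankMoment_eq, rankMoment_eq]
    push_cast
    rw [h]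
    simp only [momentCombination, map_add, coeff_qD, coeff_ofNat_mul, coeff_red]
    ring
  · rw [moment_two_crankCube]
    simp only [map_add, map_sub, coeff_qD, coeff_ofNat_mul]
    push_cast
    ring
  · rw [moment_four_crankCube]
    simp only [map_add, map_sub, coeff_qD, coeff_ofNat_mul]
    push_cast
    ring
  · rw [moment_six_crankCube]
    simp only [map_add, map_sub, coeff_qD, coeff_ofNat_mul]
    push_cast
    ring
  · rw [moment_eight_crankCube]
    simp only [map_add, map_sub, coeff_qD, coeff_ofNat_mul]
    push_cast
    ring
  · rw [moment_ten_crankCube]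
    simp only [map_add, map_sub, coeff_qD, coeff_ofNat_mul]
    push_cast
    ring
  · rw [moment_twelve_crankCube]
    simp only [map_add, map_sub, coeff_qD, coeff_ofNat_mul]
    push_cast
    ring

end Reduction

/-! ### Frobenius and the pentagonal numbers. -/

section Congruence

theorem pow_eq_expand (p : ℕ) [Fact p.Prime] (f : (ZMod p)⟦X⟧) :
    f ^ p = expand p (Fact.out : p.Prime).ne_zero f := by
  have h := MvPowerSeries.map_frobenius_expand (R := ZMod p) p (f := f)
  rw [ZMod.frobenius_zmod, MvPowerSeries.map_id] at h
  exact (h (Fact.out : p.Prime).ne_zero).symm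

/-- The constant is 8 · 1728 = 601 · 23 + 1, and the 23rd power of the reduced Euler product is its
expansion in q^23. -/
theorem momentCombination_eq_expand :
    momentCombination = X * expand 23 (by norm_num) (red euler) := by
  have : Fact (Nat.Prime 23) := ⟨by norm_num⟩
  have h := congrArg red discriminant_mul_partSeries_eq
  simp only [map_sub, map_mul, map_pow, map_ofNat, red_eisenFour, red_eisenSix] at h
  have hX : red X = X := by simp [red]
  rw [momentCombination_eq, ← pow_eq_expand 23]
  rw [hX] at h
  linear_combination 8 * h + (601 * (X * red euler ^ 23)) * series_char

theorem coeff_momentCombination_eq (k : ℤ) :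
    coeff (23 * pentagonal k + 1) momentCombination = ((Int.negOnePow k : ℤ) : ZMod 23) := by
  rw [momentCombination_eq_expand, coeff_succ_X_mul, coeff_expand_mul, coeff_red, euler,
    coeff_pentagonalSeries_pentagonal, Int.cast_id]

theorem coeff_momentCombination_eq_zero {n : ℕ} (h : ∀ k : ℤ, n ≠ 23 * pentagonal k + 1) :
    coeff n momentCombination = 0 := by
  rw [momentCombination_eq_expand]
  rcases n with _ | n
  · simp
  · rw [coeff_succ_X_mul, coeff_expand]
    split_ifs with hd
    · obtain ⟨m, rfl⟩ := hd
      rw [Nat.mul_div_cancel_left m (by norm_num), coeff_red, euler,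
        coeff_pentagonalSeries_eq_zero, Int.cast_zero]
      rintro ⟨k, rfl⟩
      exact h k rfl
    · rfl

/-- The integer division is exact, as k(3k ± 1) is twice a pentagonal number; the sign + corresponds
to the index -k. -/
theorem eq_pentagonal_iff (n k : ℕ) :
    ((n : ℤ) = 23 * k * (3 * k + 1) / 2 + 1 ↔ n = 23 * pentagonal (-k) + 1) ∧
      ((n : ℤ) = 23 * k * (3 * k - 1) / 2 + 1 ↔ n = 23 * pentagonal k + 1) := by
  have h1 := two_mul_natCast_pentagonal_neg (k : ℤ)
  have h2 := two_mul_natCast_pentagonal (k : ℤ)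
  have h3 : (23 * k * (3 * k + 1) : ℤ)
      = 2 * (23 * pentagonal (-k)) := by linear_combination -23 * h1
  have h4 : (23 * k * (3 * k - 1) : ℤ) = 2 * (23 * pentagonal k) := by linear_combination -23 * h2
  rw [h3, h4]
  constructor <;> omega

end Congruence

end RankCrank

theorem theorem6p2 (n : ℕ) :
    let x : ℤ := (n : ℤ)
    let M : ℕ → ℤ := fun j => PartitionStat.crankMoment j n
    let N : ℕ → ℤ := fun j => PartitionStat.rankMoment j n
    let L : ℤ :=
      4 * (x ^ 2 + x + 14) * (x ^ 3 + x ^ 2 + 15) * M 2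
        + (10 * x ^ 4 + 2 * x ^ 3 + 8 * x ^ 2 + 21 * x + 22) * M 4
        + 13 * (x + 18) * (x ^ 2 + 21 * x + 13) * M 6
        + 5 * x * (x + 6) * M 8
        + 15 * (x + 19) * M 10
        + M 12
        + 12 * (x + 10) * (x + 14) * (x + 19) * (x + 20) * (x + 21) * N 2
        + N 12
    (∀ k : ℕ,
        (x = 23 * (k : ℤ) * (3 * (k : ℤ) + 1) / 2 + 1 ∨
          x = 23 * (k : ℤ) * (3 * (k : ℤ) - 1) / 2 + 1) →
        L ≡ (-1) ^ k [ZMOD 23]) ∧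
      ((¬ ∃ k : ℕ,
          x = 23 * (k : ℤ) * (3 * (k : ℤ) + 1) / 2 + 1 ∨
            x = 23 * (k : ℤ) * (3 * (k : ℤ) - 1) / 2 + 1) →
        L ≡ 0 [ZMOD 23]) := by
  intro x M N L
  have hL : ((L : ℤ) : ZMod 23) = coeff n RankCrank.momentCombination :=
    RankCrank.coeff_momentCombination n
  constructor
  · intro k hk
    apply (ZMod.intCast_eq_intCast_iff _ _ 23).1
    rw [hL]
    rcases hk with hk | hk
    · rw [(RankCrank.eq_pentagonal_iff n k).1.1 hk, RankCrank.coeff_momentCombination_eq]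
      simp [Int.negOnePow_neg, Int.coe_negOnePow_natCast]
    · rw [(RankCrank.eq_pentagonal_iff n k).2.1 hk, RankCrank.coeff_momentCombination_eq]
      simp [Int.coe_negOnePow_natCast]
  · intro hk
    apply (ZMod.intCast_eq_intCast_iff _ _ 23).1
    rw [hL, RankCrank.coeff_momentCombination_eq_zero, Int.cast_zero]
    rintro m hm
    -- The pentagonal series is indexed by all integers; splitting by sign gives the two families of
    -- the statement.
    obtain ⟨k, rfl | rfl⟩ := m.eq_nat_or_neg
    · exact hk ⟨k, Or.inr ((RankCrank.eq_pentagonal_iff n k).2.2 hm)⟩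
    · exact hk ⟨k, Or.inl ((RankCrank.eq_pentagonal_iff n k).1.2 hm)⟩
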